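/- Let $A$ be a finite dimensional Hopf algebra over a field $\mathbf{k}$, with counit $\varepsilon$, coproduct $\Delta(a)=\sum a_1\otimes a_2$ and antipode $S$, and let $A^e=A\otimes_{\mathbf k}A^{op}$ be its enveloping algebra. Regard $\mathbf{k}$ as a left $A$-module through $\varepsilon$, regard $A$ as a left $A^e$-module by $(a\otimes b)\cdot x=axb$, and let $A^{ad}$ be $A$ as a left $A$-module under the left adjoint action $a\cdot x=\sum a_1xS(a_2)$. A complete resolution of a finitely generated module $M$ over a finite dimensional $\mathbf k$-algebra $R$ is an exact complex $\mathbb{P}=(P_i,d_i)_{i\in\mathbb{Z}}$ of finitely generated projective $R$-modules such that $\mathrm{Hom}_R(\mathbb{P},R)$ is exact, together with a map $\varepsilon_{\mathbb P}:P_0\to M$ for which $\cdots\to P_1\to P_0\to M\to 0$ is a projective resolution of $M$. Given complete resolutions $\mathbb{P}$ of $\mathbf{k}$ over $A$ and $\mathbb{X}$ of $A$ over $A^e$, put, for all $n\in\mathbb{Z}$, $$\widehat{H}^n(A,M)=H^n(\mathrm{Hom}_A(\mathbb{P},M)),\qquad \widehat{HH}^n(A,N)=H^n(\mathrm{Hom}_{A^e}(\mathbb{X},N)),$$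 where $M$ is a left $A$-module and $N$ an $A$-bimodule. The complete tensor product $\mathbb{P}\widehat\otimes\mathbb{P}$ has $\prod_{i+j=n}P_i\otimes_{\mathbf k}P_j$ in degree $n$ (with $A$ acting through $\Delta$) and differential $d\otimes 1+(-1)^i\,1\otimes d$ on $P_i\otimes P_j$. A complete diagonal approximation is a chain map $\Gamma:\mathbb{P}\to\mathbb{P}\widehat\otimes\mathbb{P}$ of complexes of $A$-modules with $(\varepsilon_{\mathbb P}\otimes\varepsilon_{\mathbb P})\circ\Gamma_0=\varepsilon_{\mathbb P}$ (where $\mathbf k\otimes\mathbf k=\mathbf k$). The cup product of the classes of cocycles $f:P_i\to A^{ad}$ and $g:P_j\to A^{ad}$ is the class of $(-1)^{ij}\,m\circ(f\otimes g)\circ\Gamma_{i,j}$, where $\Gamma_{i,j}:P_{i+j}\to P_i\otimes P_j$ is the component of $\Gamma$ and $m(x\otimes y)=xy$; the unit element of $\widehat{H}^*(A,A^{ad})$ is the class of $p\mapsto\varepsilon_{\mathbb P}(p)1_A$. Complete diagonal approximations $\Theta:\mathbb{X}\to\mathbb{X}\widehat\otimes_A\mathbb{X}$ and the cup product on $\widehat{HH}^*(A,A)$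 are defined in the same way, with $\otimes_A$ for $\otimes_{\mathbf k}$, with $A^e$ acting on $X_i\otimes_AX_j$ by $(a\otimes b)\cdot(x\otimes y)=ax\otimes yb$, and with $A\otimes_AA\cong A$; the unit element of $\widehat{HH}^*(A,A)$ is the class of $\varepsilon_{\mathbb X}:X_0\to A$. Theorem. Complete resolutions $\mathbb{P}$ of $\mathbf{k}$ over $A$ and $\mathbb{X}$ of $A$ over $A^e$ exist, and any such $\mathbb{P}$, $\mathbb{X}$ admit complete diagonal approximations $\Gamma$, $\Theta$. For every choice of $\mathbb{P},\mathbb{X},\Gamma,\Theta$, the cup products make $\widehat{HH}^*(A,A)$ and $\widehat{H}^*(A,A^{ad})$ associative unital $\mathbb{Z}$-graded $\mathbf{k}$-algebras, and there is an isomorphism of graded $\mathbf{k}$-algebras $$\widehat{HH}^*(A,A)\cong\widehat{H}^*(A,A^{ad}),$$ that is, a family of $\mathbf{k}$-linear isomorphisms $\Phi^n:\widehat{HH}^n(A,A)\to\widehat{H}^n(A,A^{ad})$, $n\in\mathbb{Z}$, with $\Phi^{i+j}(x\smile y)=\Phi^i(x)\smile\Phi^j(y)$ for $x$ of degree $i$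 and $y$ of degree $j$, and $\Phi^0(1)=1$. -/

import Mathlib

open scoped TensorProduct

universe u v w w₁ w₂

set_option linter.unusedSectionVars false

namespace TateHopf

noncomputable section

/-! ## Modules given by representations -/

section Modules

variable (k A : Type*) [Field k] [Ring A] [HopfAlgebra k A]

/-- The enveloping algebra `A ⊗ Aᵒᵖ`. -/
def Env : Type _ := A ⊗[k] Aᵐᵒᵖ

instance : Ring (Env k A) := inferInstanceAs (Ring (A ⊗[k] Aᵐᵒᵖ))
instance : Algebra k (Env k A) := inferInstanceAs (Algebra k (A ⊗[k] Aᵐᵒᵖ))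

/-- The identity map `A ⊗ Aᵒᵖ → A ⊗ Aᵒᵖ` onto the enveloping algebra. -/
def Env.of : A ⊗[k] Aᵐᵒᵖ ≃ₐ[k] Env k A := AlgEquiv.refl

variable {k A} in
/-- The element `a ⊗ b` of the enveloping algebra. -/
def Env.tmul (a b : A) : Env k A := Env.of k A (a ⊗ₜ[k] MulOpposite.op b)

variable {k A} in
theorem Env.induction_on {p : Env k A → Prop} (e : Env k A) (zero : p 0)
    (tmul : ∀ a b, p (Env.tmul a b)) (add : ∀ x y, p x → p y → p (x + y)) : p e :=
  TensorProduct.induction_on (motive := fun t : A ⊗[k] Aᵐᵒᵖ => p (Env.of k A t)) e zero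
    (fun a b => tmul a b.unop) (fun _ _ => add _ _)

/-- The action of `A ⊗ Aᵒᵖ` on `A`: `a ⊗ b` acts as `x ↦ a x b`. -/
def Env.action : Env k A →ₐ[k] Module.End k A :=
  (AlgHom.mulLeftRight k A).comp (Env.of k A).symm.toAlgHom

theorem Env.action_tmul (a b x : A) : Env.action k A (Env.tmul a b) x = a * x * b :=
  AlgHom.mulLeftRight_apply k A a (MulOpposite.op b) x

/-- The algebra map `σ : A → A ⊗ Aᵒᵖ`, `σ(a) = ∑ a₁ ⊗ S(a₂)`. -/
def sigma : A →ₐ[k] Env k A :=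
  (Env.of k A).toAlgHom.comp
    ((Algebra.TensorProduct.map (AlgHom.id k A) (HopfAlgebra.antipodeAlgHomOp k A)).comp
      (Bialgebra.comulAlgHom k A))

theorem sigma_eq_sum {ι : Type*} {a : A} (r : Coalgebra.Repr k a ι) :
    sigma k A a = ∑ i ∈ r.index, Env.tmul (r.left i) (HopfAlgebra.antipode k (r.right i)) := by
  rw [sigma, AlgHom.comp_apply, AlgHom.comp_apply, Bialgebra.comulAlgHom_apply, ← r.eq]
  simp only [map_sum, Algebra.TensorProduct.map_tmul]
  rfl

/-- The field `k` as a left `A`-module through the counit: `a • r = ε(a) r`. -/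
def TrivialModule (k _A : Type*) : Type _ := k

namespace TrivialModule

instance : AddCommGroup (TrivialModule k A) := inferInstanceAs (AddCommGroup k)
instance : Module k (TrivialModule k A) := inferInstanceAs (Module k k)
instance : Module A (TrivialModule k A) :=
  Module.compHom k (Bialgebra.counitAlgHom k A).toRingHom

/-- The identity map `k → k` onto the trivial module. -/
def of : k ≃ₗ[k] TrivialModule k A := LinearEquiv.refl k k

theorem smul_of (a : A) (r : k) : a • of k A r = of k A (Coalgebra.counit a * r) := rfl

instance : IsScalarTower k A (TrivialModule k A) where
  smul_assoc c a x := by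
    have h : (Bialgebra.counitAlgHom k A (c • a) * (show k from x) : k) =
        c * (Bialgebra.counitAlgHom k A a * (show k from x) : k) := by
      rw [map_smul, smul_eq_mul, mul_assoc]
    exact h

end TrivialModule

/-- `A` as a left module over `A ⊗ Aᵒᵖ`: `(a ⊗ b) • x = a x b`. -/
def RegularBimodule (_k A : Type*) : Type _ := A

namespace RegularBimodule

instance : AddCommGroup (RegularBimodule k A) := inferInstanceAs (AddCommGroup A)
instance : Module k (RegularBimodule k A) := inferInstanceAs (Module k A)
instance : Module (Env k A) (RegularBimodule k A) :=
  Module.compHom A (Env.action k A).toRingHom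

/-- The identity map `A → A` onto the regular bimodule. -/
def of : A ≃ₗ[k] RegularBimodule k A := LinearEquiv.refl k A

theorem smul_of (t : Env k A) (x : A) : t • of k A x = of k A (Env.action k A t x) := rfl

theorem tmul_smul_of (a b x : A) : (Env.tmul a b : Env k A) • of k A x = of k A (a * x * b) :=
  congrArg (of k A) (Env.action_tmul k A a b x)

instance : IsScalarTower k (Env k A) (RegularBimodule k A) where
  smul_assoc c t x := LinearMap.congr_fun (map_smul (Env.action k A) c t) x

end RegularBimodule

/-- `A` as a left `A`-module through the left adjoint action `a • x = ∑ a₁ x S(a₂)`. -/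
def AdjointModule (_k A : Type*) : Type _ := A

namespace AdjointModule

instance : AddCommGroup (AdjointModule k A) := inferInstanceAs (AddCommGroup A)
instance : Module k (AdjointModule k A) := inferInstanceAs (Module k A)
instance : Module A (AdjointModule k A) :=
  Module.compHom A ((Env.action k A).comp (sigma k A)).toRingHom

/-- The identity map `A → A` onto the adjoint module. -/
def of : A ≃ₗ[k] AdjointModule k A := LinearEquiv.refl k A

theorem smul_of (a x : A) :
    a • of k A x = of k A (Env.action k A (sigma k A a) x) := rfl

theorem smul_of_eq_sum {ι : Type*} {a : A} (r : Coalgebra.Repr k a ι) (x : A) :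
    a • of k A x =
      of k A (∑ i ∈ r.index, r.left i * x * HopfAlgebra.antipode k (r.right i)) := by
  rw [smul_of, sigma_eq_sum k A r]
  simp only [map_sum, LinearMap.sum_apply, Env.action_tmul]

instance : IsScalarTower k A (AdjointModule k A) where
  smul_assoc c a x :=
    LinearMap.congr_fun (map_smul ((Env.action k A).comp (sigma k A)) c a) x

end AdjointModule

end Modules

/-! ## Complete resolutions and the cohomology they compute -/

/-- A complete resolution of a module `M` over a `k`-algebra `R`: an acyclic complex
`⋯ → X₁ → X₀ → X₋₁ → ⋯` of finitely generated projective `R`-modules whose `R`-dual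
`Hom_R(X, R)` is acyclic too and whose part in degrees `≥ 0` is, through the augmentation
`ε : X₀ → M`, a projective resolution of `M`. The map `d i j` is the differential if `j + 1 = i`
and `0` otherwise. The `k`-module structure on `X i` is the one that comes from `k → R`. -/
structure CompleteResolution (k R M : Type*) [Field k] [Ring R] [Algebra k R]
    [AddCommGroup M] [Module R M] where
  X : ℤ → Type w
  [addCommGroup : ∀ i, AddCommGroup (X i)]
  [module : ∀ i, Module R (X i)]
  [moduleBase : ∀ i, Module k (X i)]
  [isScalarTower : ∀ i, IsScalarTower k R (X i)]
  [finite : ∀ i, Module.Finite R (X i)]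
  [projective : ∀ i, Module.Projective R (X i)]
  d : ∀ i j, X i →ₗ[R] X j
  shape : ∀ i j, j + 1 ≠ i → d i j = 0
  exact : ∀ i, Function.Exact (d (i + 1) i) (d i (i - 1))
  dual_exact : ∀ (i : ℤ) (f : X i →ₗ[R] R), f ∘ₗ d (i + 1) i = 0 →
    ∃ g : X (i - 1) →ₗ[R] R, g ∘ₗ d i (i - 1) = f
  ε : X 0 →ₗ[R] M
  ε_surjective : Function.Surjective ε
  ε_exact : Function.Exact (d 1 0) ε

attribute [instance] CompleteResolution.addCommGroup CompleteResolution.module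
  CompleteResolution.moduleBase CompleteResolution.isScalarTower
  CompleteResolution.finite CompleteResolution.projective

section Ext

variable {k R M : Type*} [Field k] [Ring R] [Algebra k R] [AddCommGroup M] [Module R M]

theorem CompleteResolution.d_comp_d (P : CompleteResolution.{w} k R M) (i j l : ℤ) :
    P.d j l ∘ₗ P.d i j = 0 := by
  by_cases h₁ : j + 1 = i
  · by_cases h₂ : l + 1 = j
    · subst h₁
      obtain rfl : l = j - 1 := by omega
      exact LinearMap.ext fun x => (P.exact j).apply_apply_eq_zero x
    · rw [P.shape j l h₂, LinearMap.zero_comp]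
  · rw [P.shape i j h₁, LinearMap.comp_zero]

variable (P : CompleteResolution.{w} k R M)
variable (N : Type*) [AddCommGroup N] [Module R N] [Module k N] [IsScalarTower k R N]

/-- The map `Hom_R(X j, N) → Hom_R(X i, N)`, `f ↦ f ∘ d`. -/
def coboundaryMap (j i : ℤ) : (P.X j →ₗ[R] N) →ₗ[k] (P.X i →ₗ[R] N) where
  toFun f := f ∘ₗ P.d i j
  map_add' _ _ := LinearMap.add_comp _ _ _
  map_smul' _ _ := LinearMap.smul_comp _ _ _

/-- The cocycles of degree `n` of `Hom_R(P, N)`. -/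
def cocycles (n : ℤ) : Submodule k (P.X n →ₗ[R] N) :=
  LinearMap.ker (coboundaryMap P N n (n + 1))

/-- The coboundaries of degree `n` of `Hom_R(P, N)`, as a subspace of the cocycles. -/
def coboundaries (n : ℤ) : Submodule k (cocycles P N n) :=
  (LinearMap.range (coboundaryMap P N (n - 1) n)).comap (cocycles P N n).subtype

/-- The Tate cohomology `Êxt_R^n(M, N) = H^n(Hom_R(P, N))`, computed by the complete
resolution `P` of `M`. -/
abbrev TateExt (n : ℤ) : Type _ := cocycles P N n ⧸ coboundaries P N n

variable {N}

theorem mem_cocycles {n : ℤ} {f : P.X n →ₗ[R] N} :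
    f ∈ cocycles P N n ↔ f ∘ₗ P.d (n + 1) n = 0 := Iff.rfl

theorem mem_coboundaries {n : ℤ} {f : cocycles P N n} :
    f ∈ coboundaries P N n ↔ ∃ g : P.X (n - 1) →ₗ[R] N, g ∘ₗ P.d n (n - 1) = f.1 := Iff.rfl

/-- Composition with a homomorphism of coefficients, on cocycles. -/
def cocyclesMap {N' : Type*} [AddCommGroup N'] [Module R N'] [Module k N'] [IsScalarTower k R N']
    (φ : N →ₗ[R] N') (n : ℤ) : cocycles P N n →ₗ[k] cocycles P N' n where
  toFun f := ⟨φ ∘ₗ f.1, by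
    have hf := (mem_cocycles P).1 f.2
    rw [mem_cocycles, LinearMap.comp_assoc, hf, LinearMap.comp_zero]⟩
  map_add' f g := Subtype.ext (LinearMap.comp_add _ _ _)
  map_smul' c f := Subtype.ext (LinearMap.ext fun x =>
    (φ.restrictScalars k).map_smul c (f.1 x))

/-- The map induced on Tate cohomology by a homomorphism of coefficients. -/
def TateExt.map {N' : Type*} [AddCommGroup N'] [Module R N'] [Module k N'] [IsScalarTower k R N']
    (φ : N →ₗ[R] N') (n : ℤ) : TateExt P N n →ₗ[k] TateExt P N' n :=
  Submodule.mapQ _ _ (cocyclesMap P φ n) (by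
    intro f hf
    obtain ⟨g, hg⟩ := (mem_coboundaries P).1 hf
    refine (mem_coboundaries P).2 ⟨φ ∘ₗ g, ?_⟩
    rw [LinearMap.comp_assoc, hg]; rfl)

variable [Module k M] [IsScalarTower k R M]

/-- The class of the augmentation `ε : P₀ → M` in `Êxt_R^0(M, M)`. -/
def augClass : TateExt P M 0 :=
  Submodule.Quotient.mk ⟨P.ε, by
    rw [mem_cocycles]
    exact LinearMap.ext fun x => P.ε_exact.apply_apply_eq_zero x⟩

end Ext

/-! ## The cup product on Tate cohomology of a Hopf algebra -/

section Diagonal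

variable (k A : Type*) [Field k] [Ring A] [HopfAlgebra k A]

section

variable (M N : Type*) [AddCommGroup M] [Module k M] [Module A M] [IsScalarTower k A M]
  [AddCommGroup N] [Module k N] [Module A N] [IsScalarTower k A N]

/-- The action of `A` on `M ⊗ N` through the coproduct: `a • (m ⊗ n) = ∑ a₁ m ⊗ a₂ n`. -/
def diagAction : A →ₐ[k] Module.End k (M ⊗[k] N) :=
  (Module.endTensorEndAlgHom (R := k) (S := k) (A := k) (M := M) (N := N)).comp
    ((Algebra.TensorProduct.map (Algebra.lsmul k k M) (Algebra.lsmul k k N)).comp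
      (Bialgebra.comulAlgHom k A))

/-- `M ⊗ N` as a left `A`-module through the coproduct. -/
def DiagTensor (k _A M N : Type*) [Field k] [AddCommGroup M] [Module k M]
    [AddCommGroup N] [Module k N] : Type _ := M ⊗[k] N

instance : AddCommGroup (DiagTensor k A M N) := inferInstanceAs (AddCommGroup (M ⊗[k] N))
instance : Module k (DiagTensor k A M N) := inferInstanceAs (Module k (M ⊗[k] N))
instance : Module A (DiagTensor k A M N) :=
  Module.compHom (M ⊗[k] N) (diagAction k A M N).toRingHom

/-- The identity map `M ⊗ N → M ⊗ N` onto the `A`-module `M ⊗ N`. -/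
def DiagTensor.of : M ⊗[k] N ≃ₗ[k] DiagTensor k A M N := LinearEquiv.refl k (M ⊗[k] N)

theorem DiagTensor.smul_of (a : A) (t : M ⊗[k] N) :
    a • DiagTensor.of k A M N t = DiagTensor.of k A M N (diagAction k A M N a t) := rfl

theorem DiagTensor.smul_of_tmul_eq_sum {ι : Type*} {a : A} (r : Coalgebra.Repr k a ι)
    (m : M) (n : N) :
    a • DiagTensor.of k A M N (m ⊗ₜ[k] n) =
      DiagTensor.of k A M N (∑ i ∈ r.index, (r.left i • m) ⊗ₜ[k] (r.right i • n)) := by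
  rw [DiagTensor.smul_of, diagAction, AlgHom.comp_apply, AlgHom.comp_apply,
    Bialgebra.comulAlgHom_apply, ← r.eq]
  simp only [map_sum, LinearMap.sum_apply]
  rfl

instance : IsScalarTower k A (DiagTensor k A M N) where
  smul_assoc c a x := LinearMap.congr_fun (map_smul (diagAction k A M N) c a) x

end

variable {k A}

/-- The homomorphism `f ⊗ g : M ⊗ N → M' ⊗ N'` of `A`-modules. -/
def DiagTensor.map {M N M' N' : Type*}
    [AddCommGroup M] [Module k M] [Module A M] [IsScalarTower k A M]
    [AddCommGroup N] [Module k N] [Module A N] [IsScalarTower k A N]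
    [AddCommGroup M'] [Module k M'] [Module A M'] [IsScalarTower k A M']
    [AddCommGroup N'] [Module k N'] [Module A N'] [IsScalarTower k A N']
    (f : M →ₗ[A] M') (g : N →ₗ[A] N') : DiagTensor k A M N →ₗ[A] DiagTensor k A M' N' where
  toFun := TensorProduct.map (f.restrictScalars k) (g.restrictScalars k)
  map_add' := map_add _
  map_smul' a t := by
    have key : (TensorProduct.map (f.restrictScalars k) (g.restrictScalars k)) ∘ₗ
        diagAction k A M N a = diagAction k A M' N' a ∘ₗ
          (TensorProduct.map (f.restrictScalars k) (g.restrictScalars k)) := by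
      ext m n
      simp only [diagAction, AlgHom.comp_apply, Bialgebra.comulAlgHom_apply,
        TensorProduct.AlgebraTensorModule.curry_apply, LinearMap.restrictScalars_self,
        TensorProduct.curry_apply, LinearMap.comp_apply, TensorProduct.map_tmul]
      induction Coalgebra.comul (R := k) a using TensorProduct.induction_on with
      | zero => simp
      | tmul x y =>
        exact congrArg₂ (fun u v => u ⊗ₜ[k] v) (map_smul f x m) (map_smul g y n)
      | add x y hx hy => simp only [map_add, LinearMap.add_apply, hx, hy]
    exact LinearMap.congr_fun key t


theorem DiagTensor.map_of_tmul {M N M' N' : Type*}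
    [AddCommGroup M] [Module k M] [Module A M] [IsScalarTower k A M]
    [AddCommGroup N] [Module k N] [Module A N] [IsScalarTower k A N]
    [AddCommGroup M'] [Module k M'] [Module A M'] [IsScalarTower k A M']
    [AddCommGroup N'] [Module k N'] [Module A N'] [IsScalarTower k A N']
    (f : M →ₗ[A] M') (g : N →ₗ[A] N') (m : M) (n : N) :
    DiagTensor.map f g (DiagTensor.of k A M N (m ⊗ₜ[k] n)) =
      DiagTensor.of k A M' N' (f m ⊗ₜ[k] g n) :=
  rfl

variable (k A)

/-- The isomorphism `k ⊗ k ≅ k`, `r ⊗ s ↦ r s`, as a homomorphism of `A`-modules. -/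
def trivialMul :
    DiagTensor k A (TrivialModule k A) (TrivialModule k A) →ₗ[A] TrivialModule k A where
  toFun := LinearMap.mul' k k
  map_add' := map_add (LinearMap.mul' k k)
  map_smul' a t := by
    have key : (LinearMap.mul' k k) ∘ₗ
        (show Module.End k (k ⊗[k] k) from
          diagAction k A (TrivialModule k A) (TrivialModule k A) a) =
        (Coalgebra.counit (R := k) a) • LinearMap.mul' k k := by
      refine TensorProduct.ext' fun x y => ?_
      have h := DiagTensor.smul_of_tmul_eq_sum k A (TrivialModule k A) (TrivialModule k A)
        (Coalgebra.Repr.arbitrary k a) x y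
      refine (congrArg (LinearMap.mul' k k) h).trans ?_
      refine (map_sum (LinearMap.mul' k k) _ _).trans ?_
      have h2 := congrArg (Coalgebra.counit (R := k))
        (Coalgebra.sum_counit_smul (R := k) (Coalgebra.Repr.arbitrary k a))
      simp only [map_sum, map_smul, smul_eq_mul] at h2
      rw [LinearMap.smul_apply, LinearMap.mul'_apply, ← h2, smul_eq_mul, Finset.sum_mul]
      refine Finset.sum_congr rfl fun i _ => ?_
      exact mul_mul_mul_comm _ _ _ _
    exact LinearMap.congr_fun key t

theorem adjoint_smul_mul {ι : Type*} {a : A} (r : Coalgebra.Repr k a ι) (x y : A) :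
    ∑ i ∈ r.index, (AdjointModule.of k A).symm (r.left i • AdjointModule.of k A x) *
      (AdjointModule.of k A).symm (r.right i • AdjointModule.of k A y) =
      (AdjointModule.of k A).symm (a • AdjointModule.of k A (x * y)) := by
  let R (z : A) : WithConv (A →ₗ[k] A) := WithConv.toConv (LinearMap.mulRight k z)
  let S : WithConv (A →ₗ[k] A) := WithConv.toConv (HopfAlgebra.antipode k)
  have had (z b : A) : (R z * S).ofConv b = 
      (AdjointModule.of k A).symm (b • AdjointModule.of k A z) := by
    refine ((Coalgebra.Repr.arbitrary k b).convMul_apply (R z) S).trans ?_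
    exact (AdjointModule.smul_of_eq_sum k A (Coalgebra.Repr.arbitrary k b) z).symm
  have hSR : S * R y = WithConv.toConv (LinearMap.mulRight k y ∘ₗ
      Algebra.linearMap k A ∘ₗ Coalgebra.counit) := by
    apply WithConv.ofConv_injective
    refine LinearMap.ext fun b => ?_
    refine ((Coalgebra.Repr.arbitrary k b).convMul_apply S (R y)).trans ?_
    change ∑ i ∈ _, HopfAlgebra.antipode k _ * (_ * y) = algebraMap k A (Coalgebra.counit b) * y
    rw [← HopfAlgebra.sum_antipode_mul_eq_algebraMap_counit (Coalgebra.Repr.arbitrary k b),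
      Finset.sum_mul]
    exact Finset.sum_congr rfl fun i _ => (mul_assoc _ _ _).symm
  have hRR : R x * (S * R y) = R (x * y) := by
    apply WithConv.ofConv_injective
    refine LinearMap.ext fun b => ?_
    rw [hSR]
    refine ((Coalgebra.Repr.arbitrary k b).convMul_apply _ _).trans ?_
    change ∑ i ∈ _, (_ * x) * (algebraMap k A (Coalgebra.counit _) * y) = b * (x * y)
    have hb := congrArg (TensorProduct.rid k A)
      (Coalgebra.sum_tmul_counit_eq (R := k) (Coalgebra.Repr.arbitrary k b))
    simp only [map_sum, TensorProduct.rid_tmul, one_smul] at hb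
    rw [← congrArg (fun c => c * (x * y)) hb, Finset.sum_mul]
    refine Finset.sum_congr rfl fun i _ => ?_
    rw [← Algebra.smul_def, mul_smul_comm, smul_mul_assoc, mul_assoc]
  refine Eq.trans ?_ (had (x * y) a)
  rw [← hRR]
  have hassoc : R x * (S * R y) * S = (R x * S) * (R y * S) := by simp only [mul_assoc]
  rw [hassoc]
  refine Eq.trans ?_ (r.convMul_apply (R x * S) (R y * S)).symm
  exact Finset.sum_congr rfl fun i _ => congrArg₂ (· * ·) (had _ _).symm (had _ _).symm

/-- The multiplication `A^ad ⊗ A^ad → A^ad`, `x ⊗ y ↦ x y`, a homomorphism of `A`-modules. -/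
def adjointMul :
    DiagTensor k A (AdjointModule k A) (AdjointModule k A) →ₗ[A] AdjointModule k A where
  toFun := LinearMap.mul' k A
  map_add' := map_add (LinearMap.mul' k A)
  map_smul' a t := by
    have key : (LinearMap.mul' k A) ∘ₗ
        (show Module.End k (A ⊗[k] A) from
          diagAction k A (AdjointModule k A) (AdjointModule k A) a) =
        (Env.action k A (sigma k A a)) ∘ₗ LinearMap.mul' k A := by
      refine TensorProduct.ext' fun x y => ?_
      have h := DiagTensor.smul_of_tmul_eq_sum k A (AdjointModule k A) (AdjointModule k A)
        (Coalgebra.Repr.arbitrary k a) x y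
      refine (congrArg (LinearMap.mul' k A) h).trans ?_
      refine (map_sum (LinearMap.mul' k A) _ _).trans ?_
      exact adjoint_smul_mul k A (Coalgebra.Repr.arbitrary k a) x y
    exact LinearMap.congr_fun key t

/-- The unit `k → A^ad`, `r ↦ r 1`, a homomorphism of `A`-modules. -/
def adjointUnit : TrivialModule k A →ₗ[A] AdjointModule k A where
  toFun r := algebraMap k A r
  map_add' := map_add (algebraMap k A)
  map_smul' a r := by
    have h := AdjointModule.smul_of_eq_sum k A (Coalgebra.Repr.arbitrary k a) (algebraMap k A r)
    refine Eq.trans ?_ h.symm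
    change algebraMap k A (Coalgebra.counit a * (show k from r)) = _
    rw [map_mul, ← HopfAlgebra.sum_mul_antipode_eq_algebraMap_counit
      (Coalgebra.Repr.arbitrary k a), Finset.sum_mul]
    refine Finset.sum_congr rfl fun i _ => ?_
    have hc (c : k) (u v : A) : u * v * algebraMap k A c = u * algebraMap k A c * v := by
      rw [mul_assoc, ← Algebra.commutes c v, mul_assoc]
    exact hc _ _ _


end Diagonal

section Cup

variable {k A : Type*} [Field k] [Ring A] [HopfAlgebra k A]

/-- The degree `n` part `∏_{i + j = n} P_i ⊗ P_j` of the complete tensor product. -/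
abbrev CompleteTensor (P : CompleteResolution.{w} k A (TrivialModule k A)) (n : ℤ) : Type _ :=
  ∀ p : {p : ℤ × ℤ // p.1 + p.2 = n}, DiagTensor k A (P.X p.1.1) (P.X p.1.2)

/-- The projection of the complete tensor product to its factor `P_i ⊗ P_j`. -/
def CompleteTensor.proj (P : CompleteResolution.{w} k A (TrivialModule k A)) (i j n : ℤ)
    (h : i + j = n) : CompleteTensor P n →ₗ[A] DiagTensor k A (P.X i) (P.X j) where
  toFun z := z ⟨(i, j), h⟩
  map_add' _ _ := rfl
  map_smul' _ _ := rfl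

/-- The total differential of the complete tensor product from degree `n` to degree `m = n - 1`:
its component at `(i, j)` is `d ⊗ 1` on `P_{i+1} ⊗ P_j` plus `(-1)^i (1 ⊗ d)` on
`P_i ⊗ P_{j+1}`. -/
def totalD (P : CompleteResolution.{w} k A (TrivialModule k A)) (n m : ℤ) (h : m + 1 = n) :
    CompleteTensor P n →ₗ[A] CompleteTensor P m :=
  LinearMap.pi fun p =>
    DiagTensor.map (P.d (p.1.1 + 1) p.1.1) LinearMap.id ∘ₗ
        CompleteTensor.proj P (p.1.1 + 1) p.1.2 n (by have := p.2; omega) +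
      p.1.1.negOnePow • (DiagTensor.map LinearMap.id (P.d (p.1.2 + 1) p.1.2) ∘ₗ
        CompleteTensor.proj P p.1.1 (p.1.2 + 1) n (by have := p.2; omega))

/-- A complete diagonal approximation: a chain map `Γ` from `P` to the complete tensor product of
`P` with itself such that `(ε ⊗ ε) ∘ Γ₀ = ε`. -/
structure DiagonalApprox (P : CompleteResolution.{w} k A (TrivialModule k A)) where
  Γ : ∀ n, P.X n →ₗ[A] CompleteTensor P n
  comm : ∀ n m (h : m + 1 = n), totalD P n m h ∘ₗ Γ n = Γ m ∘ₗ P.d n m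
  aug : ∀ x : P.X 0,
    trivialMul k A (DiagTensor.map P.ε P.ε (Γ 0 x ⟨(0, 0), add_zero 0⟩)) = P.ε x

variable {P : CompleteResolution.{w} k A (TrivialModule k A)} (Γ : DiagonalApprox P)

/-- The component `P_n → P_i ⊗ P_j` of a diagonal approximation. -/
def DiagonalApprox.comp (i j n : ℤ) (h : i + j = n) :
    P.X n →ₗ[A] DiagTensor k A (P.X i) (P.X j) :=
  CompleteTensor.proj P i j n h ∘ₗ Γ.Γ n

theorem DiagonalApprox.comp_d (i j i' j' n m : ℤ) (hi : i + 1 = i') (hj : j + 1 = j')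
    (hn : m + 1 = n) (h : i + j = m) :
    Γ.comp i j m h ∘ₗ P.d n m =
      DiagTensor.map (P.d i' i) LinearMap.id ∘ₗ Γ.comp i' j n (by omega) +
        i.negOnePow • (DiagTensor.map LinearMap.id (P.d j' j) ∘ₗ Γ.comp i j' n (by omega)) := by
  subst hi hj
  refine LinearMap.ext fun x => ?_
  exact (congrFun (LinearMap.congr_fun (Γ.comm n m hn) x) ⟨(i, j), h⟩).symm

variable {M N : Type*} [AddCommGroup M] [Module k M] [Module A M] [IsScalarTower k A M]
  [AddCommGroup N] [Module k N] [Module A N] [IsScalarTower k A N]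

/-- The cup product of cochains `f : P_i → M` and `g : P_j → N`: the composite of `Γ` with
`f ⊗̂ g`, which is `(-1)^{ij} f ⊗ g` on `P_i ⊗ P_j` and vanishes on the other factors. -/
def cupCochain {i j n : ℤ} (h : i + j = n) (f : P.X i →ₗ[A] M) (g : P.X j →ₗ[A] N) :
    P.X n →ₗ[A] DiagTensor k A M N :=
  (i * j).negOnePow • (DiagTensor.map f g ∘ₗ Γ.comp i j n h)

theorem DiagTensor.map_comp_map {M' N' M'' N'' : Type*}
    [AddCommGroup M'] [Module k M'] [Module A M'] [IsScalarTower k A M']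
    [AddCommGroup N'] [Module k N'] [Module A N'] [IsScalarTower k A N']
    [AddCommGroup M''] [Module k M''] [Module A M''] [IsScalarTower k A M'']
    [AddCommGroup N''] [Module k N''] [Module A N''] [IsScalarTower k A N'']
    (f : M →ₗ[A] M') (g : N →ₗ[A] N') (f' : M' →ₗ[A] M'') (g' : N' →ₗ[A] N'') :
    DiagTensor.map f' g' ∘ₗ DiagTensor.map f g =
      (DiagTensor.map (f' ∘ₗ f) (g' ∘ₗ g) : DiagTensor k A M N →ₗ[A] _) :=
  LinearMap.ext fun x => (LinearMap.congr_fun (TensorProduct.map_comp (f'.restrictScalars k)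
    (g'.restrictScalars k) (f.restrictScalars k) (g.restrictScalars k)) x).symm

theorem DiagTensor.map_add_left {M' N' : Type*}
    [AddCommGroup M'] [Module k M'] [Module A M'] [IsScalarTower k A M']
    [AddCommGroup N'] [Module k N'] [Module A N'] [IsScalarTower k A N']
    (f f' : M →ₗ[A] M') (g : N →ₗ[A] N') :
    (DiagTensor.map (f + f') g : DiagTensor k A M N →ₗ[A] _) =
      DiagTensor.map f g + DiagTensor.map f' g :=
  LinearMap.ext fun x => LinearMap.congr_fun (TensorProduct.map_add_left
    (f.restrictScalars k) (f'.restrictScalars k) (g.restrictScalars k)) x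

theorem DiagTensor.map_add_right {M' N' : Type*}
    [AddCommGroup M'] [Module k M'] [Module A M'] [IsScalarTower k A M']
    [AddCommGroup N'] [Module k N'] [Module A N'] [IsScalarTower k A N']
    (f : M →ₗ[A] M') (g g' : N →ₗ[A] N') :
    (DiagTensor.map f (g + g') : DiagTensor k A M N →ₗ[A] _) =
      DiagTensor.map f g + DiagTensor.map f g' :=
  LinearMap.ext fun x => LinearMap.congr_fun (TensorProduct.map_add_right
    (f.restrictScalars k) (g.restrictScalars k) (g'.restrictScalars k)) x

theorem DiagTensor.map_smul_left {M' N' : Type*}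
    [AddCommGroup M'] [Module k M'] [Module A M'] [IsScalarTower k A M']
    [AddCommGroup N'] [Module k N'] [Module A N'] [IsScalarTower k A N']
    (c : k) (f : M →ₗ[A] M') (g : N →ₗ[A] N') :
    (DiagTensor.map (c • f) g : DiagTensor k A M N →ₗ[A] _) = c • DiagTensor.map f g :=
  LinearMap.ext fun x => LinearMap.congr_fun (TensorProduct.map_smul_left
    c (f.restrictScalars k) (g.restrictScalars k)) x

theorem DiagTensor.map_smul_right {M' N' : Type*}
    [AddCommGroup M'] [Module k M'] [Module A M'] [IsScalarTower k A M']
    [AddCommGroup N'] [Module k N'] [Module A N'] [IsScalarTower k A N']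
    (c : k) (f : M →ₗ[A] M') (g : N →ₗ[A] N') :
    (DiagTensor.map f (c • g) : DiagTensor k A M N →ₗ[A] _) = c • DiagTensor.map f g :=
  LinearMap.ext fun x => LinearMap.congr_fun (TensorProduct.map_smul_right
    c (f.restrictScalars k) (g.restrictScalars k)) x

theorem DiagTensor.map_zero_left {M' N' : Type*}
    [AddCommGroup M'] [Module k M'] [Module A M'] [IsScalarTower k A M']
    [AddCommGroup N'] [Module k N'] [Module A N'] [IsScalarTower k A N'] (g : N →ₗ[A] N') :
    DiagTensor.map (0 : M →ₗ[A] M') g = (0 : DiagTensor k A M N →ₗ[A] _) :=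
  LinearMap.ext fun x => LinearMap.congr_fun (TensorProduct.map_zero_left (g.restrictScalars k)) x

theorem DiagTensor.map_zero_right {M' N' : Type*}
    [AddCommGroup M'] [Module k M'] [Module A M'] [IsScalarTower k A M']
    [AddCommGroup N'] [Module k N'] [Module A N'] [IsScalarTower k A N'] (f : M →ₗ[A] M') :
    DiagTensor.map f (0 : N →ₗ[A] N') = (0 : DiagTensor k A M N →ₗ[A] _) :=
  LinearMap.ext fun x => LinearMap.congr_fun (TensorProduct.map_zero_right (f.restrictScalars k)) x

/-- The cup product of cochains as a bilinear map. -/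
def cupCochainBilin (M N : Type*)
    [AddCommGroup M] [Module k M] [Module A M] [IsScalarTower k A M]
    [AddCommGroup N] [Module k N] [Module A N] [IsScalarTower k A N]
    {i j n : ℤ} (h : i + j = n) :
    (P.X i →ₗ[A] M) →ₗ[k] (P.X j →ₗ[A] N) →ₗ[k] (P.X n →ₗ[A] DiagTensor k A M N) :=
  LinearMap.mk₂ k (cupCochain Γ h)
    (fun f f' g => by
      simp only [cupCochain, DiagTensor.map_add_left, LinearMap.add_comp, smul_add])
    (fun c f g => by
      simp only [cupCochain, DiagTensor.map_smul_left, LinearMap.smul_comp]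
      exact smul_comm _ _ _)
    (fun f g g' => by
      simp only [cupCochain, DiagTensor.map_add_right, LinearMap.add_comp, smul_add])
    (fun c f g => by
      simp only [cupCochain, DiagTensor.map_smul_right, LinearMap.smul_comp]
      exact smul_comm _ _ _)

theorem cupCochain_comp_d {i j i' j' n n' : ℤ} (h : i + j = n) (hi : i + 1 = i') (hj : j + 1 = j')
    (hn : n + 1 = n') (f : P.X i →ₗ[A] M) (g : P.X j →ₗ[A] N) :
    cupCochain Γ h f g ∘ₗ P.d n' n =
      j.negOnePow • cupCochain Γ (show i' + j = n' by omega) (f ∘ₗ P.d i' i) g +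
        cupCochain Γ (show i + j' = n' by omega) f (g ∘ₗ P.d j' j) := by
  have hs₁ : (i' * j).negOnePow = j.negOnePow * (i * j).negOnePow := by
    rw [← hi, ← Int.negOnePow_add]; congr 1; ring
  have hs₂ : (i * j').negOnePow = (i * j).negOnePow * i.negOnePow := by
    rw [← hj, ← Int.negOnePow_add]; congr 1; ring
  have hs₃ : j.negOnePow * j.negOnePow = 1 := Int.units_mul_self _
  have e₁ := DiagTensor.map_comp_map (k := k) (P.d i' i) (LinearMap.id (M := P.X j)) f g
  have e₂ := DiagTensor.map_comp_map (k := k) (LinearMap.id (M := P.X i)) (P.d j' j) f g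
  rw [LinearMap.comp_id] at e₁ e₂
  simp only [cupCochain, LinearMap.smul_comp]
  rw [LinearMap.comp_assoc, Γ.comp_d i j i' j' n' n hi hj hn h, LinearMap.comp_add,
    ← LinearMap.comp_assoc, e₁, smul_smul, hs₁, ← mul_assoc, hs₃, one_mul, hs₂, mul_smul,
    smul_add]
  congr 2
  rw [← e₂]
  refine LinearMap.ext fun x => ?_
  rcases Int.units_eq_one_or i.negOnePow with h | h <;> simp [h]

/-- The cup product of cocycles. -/
def cupCocycle (M N : Type*)
    [AddCommGroup M] [Module k M] [Module A M] [IsScalarTower k A M]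
    [AddCommGroup N] [Module k N] [Module A N] [IsScalarTower k A N]
    {i j n : ℤ} (h : i + j = n) :
    cocycles P M i →ₗ[k] cocycles P N j →ₗ[k] cocycles P (DiagTensor k A M N) n :=
  LinearMap.mk₂ k
    (fun f g => ⟨cupCochainBilin Γ M N h f.1 g.1, by
      have hf := (mem_cocycles P).1 f.2
      have hg := (mem_cocycles P).1 g.2
      rw [mem_cocycles]
      refine (cupCochain_comp_d Γ h rfl rfl rfl f.1 g.1).trans ?_
      rw [hf, hg, cupCochain, cupCochain, DiagTensor.map_zero_left, DiagTensor.map_zero_right]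
      simp⟩)
    (fun f f' g => Subtype.ext (LinearMap.map_add₂ _ _ _ _))
    (fun c f g => Subtype.ext (LinearMap.map_smul₂ _ _ _ _))
    (fun f g g' => Subtype.ext (map_add _ _ _))
    (fun c f g => Subtype.ext (map_smul _ _ _))

/-- The cup product `Ĥ^i(A, M) × Ĥ^j(A, N) → Ĥ^n(A, M ⊗ N)`, `n = i + j`, in Tate cohomology. -/
def cup (M N : Type*)
    [AddCommGroup M] [Module k M] [Module A M] [IsScalarTower k A M]
    [AddCommGroup N] [Module k N] [Module A N] [IsScalarTower k A N]
    {i j n : ℤ} (h : i + j = n) :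
    TateExt P M i →ₗ[k] TateExt P N j →ₗ[k] TateExt P (DiagTensor k A M N) n :=
  LinearMap.liftQ₂ _ _
    ((cupCocycle Γ M N h).compr₂ (coboundaries P (DiagTensor k A M N) n).mkQ)
    (by
      intro f hf
      obtain ⟨f', hf'⟩ := (mem_coboundaries P).1 hf
      refine LinearMap.ext fun g => (Submodule.Quotient.mk_eq_zero _).2 ?_
      have hg := (mem_cocycles P).1 g.2
      refine (mem_coboundaries P).2
        ⟨j.negOnePow • cupCochain Γ (show i - 1 + j = n - 1 by omega) f' g.1, ?_⟩
      rw [LinearMap.smul_comp, cupCochain_comp_d Γ (i := i - 1) (i' := i) (n' := n) _ (by omega) rfl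
        (by omega) f' g.1, hf', hg, cupCochain, cupCochain, DiagTensor.map_zero_right,
        LinearMap.zero_comp, smul_zero, add_zero, smul_smul, Int.units_mul_self, one_smul]
      rfl)
    (by
      intro g hg
      obtain ⟨g', hg'⟩ := (mem_coboundaries P).1 hg
      refine LinearMap.ext fun f => (Submodule.Quotient.mk_eq_zero _).2 ?_
      have hf := (mem_cocycles P).1 f.2
      refine (mem_coboundaries P).2
        ⟨cupCochain Γ (show i + (j - 1) = n - 1 by omega) f.1 g', ?_⟩
      rw [cupCochain_comp_d Γ (j := j - 1) (j' := j) (n' := n) _ rfl (by omega)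
        (by omega) f.1 g', hg', hf, cupCochain, cupCochain, DiagTensor.map_zero_left,
        LinearMap.zero_comp, smul_zero, smul_zero, zero_add]
      rfl)

/-- The product of `Ĥ^*(A, A^ad)`: the cup product followed by the map induced by the
multiplication `A^ad ⊗ A^ad → A^ad`. -/
def tateMul (i j n : ℤ) (h : i + j = n) :
    TateExt P (AdjointModule k A) i →ₗ[k] TateExt P (AdjointModule k A) j →ₗ[k]
      TateExt P (AdjointModule k A) n :=
  (cup Γ (AdjointModule k A) (AdjointModule k A) h).compr₂ (TateExt.map P (adjointMul k A) n)

/-- The identity of `Ĥ^*(A, A^ad)`: the image of `1 ∈ Ĥ^0(A, k)` under `k → A^ad`. -/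
def tateOne (P : CompleteResolution.{w} k A (TrivialModule k A)) :
    TateExt P (AdjointModule k A) 0 :=
  TateExt.map P (adjointUnit k A) 0 (augClass P)

end Cup

/-! ## The cup product on Tate-Hochschild cohomology -/

section Bimodules

variable (k A : Type*) [Field k] [Ring A] [HopfAlgebra k A]

section

variable (M N : Type*)
  [AddCommGroup M] [Module k M] [Module (Env k A) M] [IsScalarTower k (Env k A) M]
  [AddCommGroup N] [Module k N] [Module (Env k A) N] [IsScalarTower k (Env k A) N]

/-- The outer action of `A ⊗ Aᵒᵖ` on `M ⊗ N`, for bimodules `M` and `N`: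
`(a ⊗ b) • (m ⊗ n) = a m ⊗ n b`. -/
def outerAction : Env k A →ₐ[k] Module.End k (M ⊗[k] N) :=
  ((Module.endTensorEndAlgHom (R := k) (S := k) (A := k) (M := M) (N := N)).comp
    (Algebra.TensorProduct.map
      ((Algebra.lsmul k k M).comp ((Env.of k A).toAlgHom.comp
        (Algebra.TensorProduct.includeLeft : A →ₐ[k] A ⊗[k] Aᵐᵒᵖ)))
      ((Algebra.lsmul k k N).comp ((Env.of k A).toAlgHom.comp
        (Algebra.TensorProduct.includeRight : Aᵐᵒᵖ →ₐ[k] A ⊗[k] Aᵐᵒᵖ))))).comp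
    (Env.of k A).symm.toAlgHom

/-- The tensor product `M ⊗ N` over `k` of two bimodules, with the outer bimodule structure. -/
def OuterTensor (k _A M N : Type*) [Field k] [AddCommGroup M] [Module k M]
    [AddCommGroup N] [Module k N] : Type _ := M ⊗[k] N

instance : AddCommGroup (OuterTensor k A M N) := inferInstanceAs (AddCommGroup (M ⊗[k] N))
instance : Module k (OuterTensor k A M N) := inferInstanceAs (Module k (M ⊗[k] N))
instance : Module (Env k A) (OuterTensor k A M N) :=
  Module.compHom (M ⊗[k] N) (outerAction k A M N).toRingHom

/-- The identity map `M ⊗ N → M ⊗ N` onto the bimodule `M ⊗ N`. -/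
def OuterTensor.of : M ⊗[k] N ≃ₗ[k] OuterTensor k A M N := LinearEquiv.refl k (M ⊗[k] N)

theorem OuterTensor.smul_of (e : Env k A) (t : M ⊗[k] N) :
    e • OuterTensor.of k A M N t = OuterTensor.of k A M N (outerAction k A M N e t) := rfl

theorem OuterTensor.tmul_smul_of_tmul (a b : A) (m : M) (n : N) :
    (Env.tmul a b : Env k A) • OuterTensor.of k A M N (m ⊗ₜ[k] n) =
      OuterTensor.of k A M N
        (((Env.tmul a 1 : Env k A) • m) ⊗ₜ[k] ((Env.tmul 1 b : Env k A) • n)) := rfl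

instance : IsScalarTower k (Env k A) (OuterTensor k A M N) where
  smul_assoc c e x := LinearMap.congr_fun (map_smul (outerAction k A M N) c e) x

/-- The relations `m a ⊗ n = m ⊗ a n`. They are stable under the outer action, so the
sub-bimodule that they span is the subspace that they span. -/
def balancedRelations : Submodule (Env k A) (OuterTensor k A M N) :=
  Submodule.span (Env k A) {t | ∃ (a : A) (m : M) (n : N),
    t = OuterTensor.of k A M N
      (((Env.tmul 1 a : Env k A) • m) ⊗ₜ[k] n - m ⊗ₜ[k] ((Env.tmul a 1 : Env k A) • n))}

/-- The tensor product `M ⊗_A N` of two `A`-bimodules, a bimodule through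
`(a ⊗ b) • (m ⊗ n) = a m ⊗ n b`. -/
def BimodTensor : Type _ := OuterTensor k A M N ⧸ balancedRelations k A M N

instance : AddCommGroup (BimodTensor k A M N) :=
  inferInstanceAs (AddCommGroup (OuterTensor k A M N ⧸ balancedRelations k A M N))
instance : Module k (BimodTensor k A M N) :=
  inferInstanceAs (Module k (OuterTensor k A M N ⧸ balancedRelations k A M N))
instance : Module (Env k A) (BimodTensor k A M N) :=
  inferInstanceAs (Module (Env k A) (OuterTensor k A M N ⧸ balancedRelations k A M N))
instance : IsScalarTower k (Env k A) (BimodTensor k A M N) :=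
  inferInstanceAs (IsScalarTower k (Env k A) (OuterTensor k A M N ⧸ balancedRelations k A M N))

/-- The quotient map `M ⊗ N → M ⊗_A N`. -/
def BimodTensor.mk : OuterTensor k A M N →ₗ[Env k A] BimodTensor k A M N :=
  (balancedRelations k A M N).mkQ

/-- The element `m ⊗ n` of `M ⊗_A N`. -/
def BimodTensor.tmul (m : M) (n : N) : BimodTensor k A M N :=
  BimodTensor.mk k A M N (OuterTensor.of k A M N (m ⊗ₜ[k] n))

theorem BimodTensor.balanced (a : A) (m : M) (n : N) :
    BimodTensor.tmul k A M N ((Env.tmul 1 a : Env k A) • m) n =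
      BimodTensor.tmul k A M N m ((Env.tmul a 1 : Env k A) • n) := by
  refine (Submodule.Quotient.eq _).2 (Submodule.subset_span ⟨a, m, n, ?_⟩)
  rw [map_sub]

end

variable {k A}

variable {M N M' N' : Type*}
    [AddCommGroup M] [Module k M] [Module (Env k A) M] [IsScalarTower k (Env k A) M]
    [AddCommGroup N] [Module k N] [Module (Env k A) N] [IsScalarTower k (Env k A) N]
    [AddCommGroup M'] [Module k M'] [Module (Env k A) M'] [IsScalarTower k (Env k A) M']
    [AddCommGroup N'] [Module k N'] [Module (Env k A) N'] [IsScalarTower k (Env k A) N']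

theorem BimodTensor.induction_on {p : BimodTensor k A M N → Prop} (x : BimodTensor k A M N)
    (zero : p 0) (tmul : ∀ m n, p (BimodTensor.tmul k A M N m n))
    (add : ∀ x y, p x → p y → p (x + y)) : p x := by
  obtain ⟨t, rfl⟩ := Submodule.Quotient.mk_surjective _ x
  exact TensorProduct.induction_on
    (motive := fun t : M ⊗[k] N => p (BimodTensor.mk k A M N (OuterTensor.of k A M N t))) t
    zero tmul (fun x y hx hy => add _ _ hx hy)

/-- The homomorphism `f ⊗ g` of bimodules on tensor products over `k`. -/
def OuterTensor.map (f : M →ₗ[Env k A] M') (g : N →ₗ[Env k A] N') :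
    OuterTensor k A M N →ₗ[Env k A] OuterTensor k A M' N' where
  toFun := TensorProduct.map (f.restrictScalars k) (g.restrictScalars k)
  map_add' := map_add _
  map_smul' e t := by
    have key : (TensorProduct.map (f.restrictScalars k) (g.restrictScalars k)) ∘ₗ
        outerAction k A M N e = outerAction k A M' N' e ∘ₗ
          (TensorProduct.map (f.restrictScalars k) (g.restrictScalars k)) := by
      refine TensorProduct.ext' fun m n => ?_
      induction e using Env.induction_on with
      | zero => simp
      | tmul a b =>
        exact congrArg₂ (fun u v => u ⊗ₜ[k] v) (map_smul f (Env.tmul a 1 : Env k A) m)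
          (map_smul g (Env.tmul 1 b : Env k A) n)
      | add x y hx hy =>
        simp only [LinearMap.comp_apply, map_add, LinearMap.add_apply] at hx hy ⊢
        rw [hx, hy]
    exact LinearMap.congr_fun key t

/-- The homomorphism `f ⊗ g : M ⊗_A N → M' ⊗_A N'` of bimodules. -/
def BimodTensor.map (f : M →ₗ[Env k A] M') (g : N →ₗ[Env k A] N') :
    BimodTensor k A M N →ₗ[Env k A] BimodTensor k A M' N' :=
  Submodule.mapQ _ _ (OuterTensor.map f g) (by
    refine Submodule.span_le.2 ?_
    rintro _ ⟨a, m, n, rfl⟩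
    refine Submodule.subset_span ⟨a, f m, g n, ?_⟩
    rw [← map_smul, ← map_smul]
    exact map_sub (OuterTensor.map f g) (OuterTensor.of k A M N (_ ⊗ₜ[k] n))
      (OuterTensor.of k A M N (m ⊗ₜ[k] _)))

theorem BimodTensor.map_tmul (f : M →ₗ[Env k A] M') (g : N →ₗ[Env k A] N') (m : M) (n : N) :
    BimodTensor.map f g (BimodTensor.tmul k A M N m n) =
      BimodTensor.tmul k A M' N' (f m) (g n) := rfl

theorem BimodTensor.tmul_add (m : M) (n n' : N) :
    BimodTensor.tmul k A M N m (n + n') =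
      BimodTensor.tmul k A M N m n + BimodTensor.tmul k A M N m n' :=
  congrArg (fun t => BimodTensor.mk k A M N (OuterTensor.of k A M N t))
    (TensorProduct.tmul_add m n n')

theorem BimodTensor.add_tmul (m m' : M) (n : N) :
    BimodTensor.tmul k A M N (m + m') n =
      BimodTensor.tmul k A M N m n + BimodTensor.tmul k A M N m' n :=
  congrArg (fun t => BimodTensor.mk k A M N (OuterTensor.of k A M N t))
    (TensorProduct.add_tmul m m' n)

theorem BimodTensor.zero_tmul (n : N) : BimodTensor.tmul k A M N 0 n = 0 :=
  congrArg (fun t => BimodTensor.mk k A M N (OuterTensor.of k A M N t))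
    (TensorProduct.zero_tmul M n)

theorem BimodTensor.tmul_zero (m : M) : BimodTensor.tmul k A M N m 0 = 0 :=
  congrArg (fun t => BimodTensor.mk k A M N (OuterTensor.of k A M N t))
    (TensorProduct.tmul_zero N m)

theorem BimodTensor.tmul_smul (c : k) (m : M) (n : N) :
    BimodTensor.tmul k A M N m (c • n) = c • BimodTensor.tmul k A M N m n :=
  congrArg (fun t => BimodTensor.mk k A M N (OuterTensor.of k A M N t))
    (TensorProduct.tmul_smul c m n)

theorem BimodTensor.smul_tmul (c : k) (m : M) (n : N) :
    BimodTensor.tmul k A M N (c • m) n = c • BimodTensor.tmul k A M N m n :=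
  congrArg (fun t => BimodTensor.mk k A M N (OuterTensor.of k A M N t))
    (TensorProduct.smul_tmul' c m n).symm

/-- Homomorphisms on `M ⊗_A N` agree if they agree on the elements `m ⊗ n`. -/
theorem BimodTensor.hom_ext {Q : Type*} [AddCommGroup Q] [Module (Env k A) Q]
    {φ ψ : BimodTensor k A M N →ₗ[Env k A] Q}
    (h : ∀ m n, φ (BimodTensor.tmul k A M N m n) = ψ (BimodTensor.tmul k A M N m n)) : φ = ψ := by
  refine LinearMap.ext fun x => BimodTensor.induction_on (p := fun x => φ x = ψ x) x ?_ h
    fun x y hx hy => ?_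
  · rw [map_zero, map_zero]
  · rw [map_add, map_add, hx, hy]

variable (k A)

/-- The multiplication `A ⊗ A → A` as a homomorphism of bimodules. -/
def outerMul :
    OuterTensor k A (RegularBimodule k A) (RegularBimodule k A) →ₗ[Env k A]
      RegularBimodule k A where
  toFun := LinearMap.mul' k A
  map_add' := map_add (LinearMap.mul' k A)
  map_smul' e t := by
    have key : (LinearMap.mul' k A) ∘ₗ
        (show Module.End k (A ⊗[k] A) from
          outerAction k A (RegularBimodule k A) (RegularBimodule k A) e) =
        (Env.action k A e) ∘ₗ LinearMap.mul' k A := by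
      refine TensorProduct.ext' fun x y => ?_
      induction e using Env.induction_on with
      | zero => rw [map_zero, map_zero]; rfl
      | tmul a b =>
        have h₁ := RegularBimodule.tmul_smul_of k A a 1 x
        have h₂ := RegularBimodule.tmul_smul_of k A 1 b y
        refine (congrArg₂ (fun u v : A => u * v) h₁ h₂).trans ?_
        refine Eq.trans ?_ (Env.action_tmul k A a b (x * y)).symm
        change (a * x * 1) * (1 * y * b) = a * (x * y) * b
        rw [mul_one, one_mul]
        simp only [mul_assoc]
      | add e e' he he' =>
        rw [map_add, map_add]
        exact (map_add (LinearMap.mul' k A) _ _).trans (congrArg₂ (· + ·) he he')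
    exact LinearMap.congr_fun key t

theorem outerMul_of_tmul (x y : RegularBimodule k A) :
    outerMul k A (OuterTensor.of k A _ _ (x ⊗ₜ[k] y)) =
      RegularBimodule.of k A
        ((RegularBimodule.of k A).symm x * (RegularBimodule.of k A).symm y) := rfl

/-- The isomorphism `A ⊗_A A ≅ A`, `x ⊗ y ↦ x y`, as a homomorphism of bimodules. -/
def regularMul :
    BimodTensor k A (RegularBimodule k A) (RegularBimodule k A) →ₗ[Env k A]
      RegularBimodule k A :=
  Submodule.liftQ _ (outerMul k A) (by
    refine Submodule.span_le.2 ?_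
    rintro _ ⟨a, m, n, rfl⟩
    refine LinearMap.mem_ker.2 ?_
    have h₁ := RegularBimodule.tmul_smul_of k A 1 a ((RegularBimodule.of k A).symm m)
    have h₂ := RegularBimodule.tmul_smul_of k A a 1 ((RegularBimodule.of k A).symm n)
    rw [LinearEquiv.apply_symm_apply] at h₁ h₂
    rw [map_sub, map_sub, outerMul_of_tmul, outerMul_of_tmul, h₁, h₂, sub_eq_zero]
    simp only [LinearEquiv.symm_apply_apply, mul_one, one_mul, mul_assoc])

theorem regularMul_tmul (x y : A) :
    regularMul k A (BimodTensor.tmul k A _ _ (RegularBimodule.of k A x)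
      (RegularBimodule.of k A y)) = RegularBimodule.of k A (x * y) := rfl

end Bimodules


section BimodCup

variable {k A : Type*} [Field k] [Ring A] [HopfAlgebra k A]

/-- The degree `n` part `∏_{i + j = n} P_i ⊗_A P_j` of the complete tensor product over `A`. -/
abbrev BimodCompleteTensor (P : CompleteResolution.{w} k (Env k A) (RegularBimodule k A)) (n : ℤ) :
    Type _ :=
  ∀ p : {p : ℤ × ℤ // p.1 + p.2 = n}, BimodTensor k A (P.X p.1.1) (P.X p.1.2)

/-- The projection of the complete tensor product to its factor `P_i ⊗_A P_j`. -/
def BimodCompleteTensor.proj (P : CompleteResolution.{w} k (Env k A) (RegularBimodule k A))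
    (i j n : ℤ) (h : i + j = n) : BimodCompleteTensor P n →ₗ[Env k A] BimodTensor k A (P.X i) (P.X j) where
  toFun z := z ⟨(i, j), h⟩
  map_add' _ _ := rfl
  map_smul' _ _ := rfl

/-- The total differential of the complete tensor product from degree `n` to degree `m = n - 1`:
its component at `(i, j)` is `d ⊗ 1` on `P_{i+1} ⊗_A P_j` plus `(-1)^i (1 ⊗ d)` on
`P_i ⊗_A P_{j+1}`. -/
def bimodTotalD (P : CompleteResolution.{w} k (Env k A) (RegularBimodule k A))
    (n m : ℤ) (h : m + 1 = n) :
    BimodCompleteTensor P n →ₗ[Env k A] BimodCompleteTensor P m :=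
  LinearMap.pi fun p =>
    BimodTensor.map (P.d (p.1.1 + 1) p.1.1) LinearMap.id ∘ₗ
        BimodCompleteTensor.proj P (p.1.1 + 1) p.1.2 n (by have := p.2; omega) +
      p.1.1.negOnePow • (BimodTensor.map LinearMap.id (P.d (p.1.2 + 1) p.1.2) ∘ₗ
        BimodCompleteTensor.proj P p.1.1 (p.1.2 + 1) n (by have := p.2; omega))

/-- A complete diagonal approximation: a chain map `Γ` from `P` to the complete tensor product over
`A` of `P` with itself such that `(ε ⊗ ε) ∘ Γ₀ = ε`, where `A ⊗_A A` is identified with `A`. -/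
structure BimodDiagonalApprox (P : CompleteResolution.{w} k (Env k A) (RegularBimodule k A)) where
  Γ : ∀ n, P.X n →ₗ[Env k A] BimodCompleteTensor P n
  comm : ∀ n m (h : m + 1 = n), bimodTotalD P n m h ∘ₗ Γ n = Γ m ∘ₗ P.d n m
  aug : ∀ x : P.X 0,
    regularMul k A (BimodTensor.map P.ε P.ε (Γ 0 x ⟨(0, 0), add_zero 0⟩)) = P.ε x

variable {P : CompleteResolution.{w} k (Env k A) (RegularBimodule k A)} (Γ : BimodDiagonalApprox P)

/-- The component `P_n → P_i ⊗_A P_j` of a diagonal approximation. -/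
def BimodDiagonalApprox.comp (i j n : ℤ) (h : i + j = n) :
    P.X n →ₗ[Env k A] BimodTensor k A (P.X i) (P.X j) :=
  BimodCompleteTensor.proj P i j n h ∘ₗ Γ.Γ n

theorem BimodDiagonalApprox.comp_d (i j i' j' n m : ℤ) (hi : i + 1 = i') (hj : j + 1 = j')
    (hn : m + 1 = n) (h : i + j = m) :
    Γ.comp i j m h ∘ₗ P.d n m =
      BimodTensor.map (P.d i' i) LinearMap.id ∘ₗ Γ.comp i' j n (by omega) +
        i.negOnePow • (BimodTensor.map LinearMap.id (P.d j' j) ∘ₗ Γ.comp i j' n (by omega)) := by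
  subst hi hj
  refine LinearMap.ext fun x => ?_
  exact (congrFun (LinearMap.congr_fun (Γ.comm n m hn) x) ⟨(i, j), h⟩).symm

variable {M N : Type*}
  [AddCommGroup M] [Module k M] [Module (Env k A) M] [IsScalarTower k (Env k A) M]
  [AddCommGroup N] [Module k N] [Module (Env k A) N] [IsScalarTower k (Env k A) N]

/-- The cup product of cochains `f : P_i → M` and `g : P_j → N`: the composite of `Γ` with
`f ⊗̂ g`, which is `(-1)^{ij} f ⊗ g` on `P_i ⊗_A P_j` and vanishes on the other factors. -/
def bimodCupCochain {i j n : ℤ} (h : i + j = n)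
    (f : P.X i →ₗ[Env k A] M) (g : P.X j →ₗ[Env k A] N) :
    P.X n →ₗ[Env k A] BimodTensor k A M N :=
  (i * j).negOnePow • (BimodTensor.map f g ∘ₗ Γ.comp i j n h)

theorem BimodTensor.map_comp_map {M' N' M'' N'' : Type*}
    [AddCommGroup M'] [Module k M'] [Module (Env k A) M'] [IsScalarTower k (Env k A) M']
    [AddCommGroup N'] [Module k N'] [Module (Env k A) N'] [IsScalarTower k (Env k A) N']
    [AddCommGroup M''] [Module k M''] [Module (Env k A) M''] [IsScalarTower k (Env k A) M'']
    [AddCommGroup N''] [Module k N''] [Module (Env k A) N''] [IsScalarTower k (Env k A) N'']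
    (f : M →ₗ[Env k A] M') (g : N →ₗ[Env k A] N')
    (f' : M' →ₗ[Env k A] M'') (g' : N' →ₗ[Env k A] N'') :
    BimodTensor.map f' g' ∘ₗ BimodTensor.map f g =
      (BimodTensor.map (f' ∘ₗ f) (g' ∘ₗ g) : BimodTensor k A M N →ₗ[Env k A] _) :=
  BimodTensor.hom_ext fun _ _ => rfl

theorem BimodTensor.map_add_left {M' N' : Type*}
    [AddCommGroup M'] [Module k M'] [Module (Env k A) M'] [IsScalarTower k (Env k A) M']
    [AddCommGroup N'] [Module k N'] [Module (Env k A) N'] [IsScalarTower k (Env k A) N']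
    (f f' : M →ₗ[Env k A] M') (g : N →ₗ[Env k A] N') :
    (BimodTensor.map (f + f') g : BimodTensor k A M N →ₗ[Env k A] _) =
      BimodTensor.map f g + BimodTensor.map f' g :=
  BimodTensor.hom_ext fun m n => BimodTensor.add_tmul (f m) (f' m) (g n)

theorem BimodTensor.map_add_right {M' N' : Type*}
    [AddCommGroup M'] [Module k M'] [Module (Env k A) M'] [IsScalarTower k (Env k A) M']
    [AddCommGroup N'] [Module k N'] [Module (Env k A) N'] [IsScalarTower k (Env k A) N']
    (f : M →ₗ[Env k A] M') (g g' : N →ₗ[Env k A] N') :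
    (BimodTensor.map f (g + g') : BimodTensor k A M N →ₗ[Env k A] _) =
      BimodTensor.map f g + BimodTensor.map f g' :=
  BimodTensor.hom_ext fun m n => BimodTensor.tmul_add (f m) (g n) (g' n)

theorem BimodTensor.map_smul_left {M' N' : Type*}
    [AddCommGroup M'] [Module k M'] [Module (Env k A) M'] [IsScalarTower k (Env k A) M']
    [AddCommGroup N'] [Module k N'] [Module (Env k A) N'] [IsScalarTower k (Env k A) N']
    (c : k) (f : M →ₗ[Env k A] M') (g : N →ₗ[Env k A] N') :
    (BimodTensor.map (c • f) g : BimodTensor k A M N →ₗ[Env k A] _) = c • BimodTensor.map f g :=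
  BimodTensor.hom_ext fun m n => BimodTensor.smul_tmul c (f m) (g n)

theorem BimodTensor.map_smul_right {M' N' : Type*}
    [AddCommGroup M'] [Module k M'] [Module (Env k A) M'] [IsScalarTower k (Env k A) M']
    [AddCommGroup N'] [Module k N'] [Module (Env k A) N'] [IsScalarTower k (Env k A) N']
    (c : k) (f : M →ₗ[Env k A] M') (g : N →ₗ[Env k A] N') :
    (BimodTensor.map f (c • g) : BimodTensor k A M N →ₗ[Env k A] _) = c • BimodTensor.map f g :=
  BimodTensor.hom_ext fun m n => BimodTensor.tmul_smul c (f m) (g n)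

theorem BimodTensor.map_zero_left {M' N' : Type*}
    [AddCommGroup M'] [Module k M'] [Module (Env k A) M'] [IsScalarTower k (Env k A) M']
    [AddCommGroup N'] [Module k N'] [Module (Env k A) N'] [IsScalarTower k (Env k A) N']
    (g : N →ₗ[Env k A] N') :
    BimodTensor.map (0 : M →ₗ[Env k A] M') g = (0 : BimodTensor k A M N →ₗ[Env k A] _) :=
  BimodTensor.hom_ext fun _ n => BimodTensor.zero_tmul (g n)

theorem BimodTensor.map_zero_right {M' N' : Type*}
    [AddCommGroup M'] [Module k M'] [Module (Env k A) M'] [IsScalarTower k (Env k A) M']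
    [AddCommGroup N'] [Module k N'] [Module (Env k A) N'] [IsScalarTower k (Env k A) N']
    (f : M →ₗ[Env k A] M') :
    BimodTensor.map f (0 : N →ₗ[Env k A] N') = (0 : BimodTensor k A M N →ₗ[Env k A] _) :=
  BimodTensor.hom_ext fun m _ => BimodTensor.tmul_zero (f m)

/-- The cup product of cochains as a bilinear map. -/
def bimodCupCochainBilin (M N : Type*)
    [AddCommGroup M] [Module k M] [Module (Env k A) M] [IsScalarTower k (Env k A) M]
    [AddCommGroup N] [Module k N] [Module (Env k A) N] [IsScalarTower k (Env k A) N]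
    {i j n : ℤ} (h : i + j = n) :
    (P.X i →ₗ[Env k A] M) →ₗ[k] (P.X j →ₗ[Env k A] N) →ₗ[k]
      (P.X n →ₗ[Env k A] BimodTensor k A M N) :=
  LinearMap.mk₂ k (bimodCupCochain Γ h)
    (fun f f' g => by
      simp only [bimodCupCochain, BimodTensor.map_add_left, LinearMap.add_comp, smul_add])
    (fun c f g => by
      simp only [bimodCupCochain, BimodTensor.map_smul_left, LinearMap.smul_comp]
      exact smul_comm _ _ _)
    (fun f g g' => by
      simp only [bimodCupCochain, BimodTensor.map_add_right, LinearMap.add_comp, smul_add])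
    (fun c f g => by
      simp only [bimodCupCochain, BimodTensor.map_smul_right, LinearMap.smul_comp]
      exact smul_comm _ _ _)

theorem bimodCupCochain_comp_d {i j i' j' n n' : ℤ} (h : i + j = n)
    (hi : i + 1 = i') (hj : j + 1 = j')
    (hn : n + 1 = n') (f : P.X i →ₗ[Env k A] M) (g : P.X j →ₗ[Env k A] N) :
    bimodCupCochain Γ h f g ∘ₗ P.d n' n =
      j.negOnePow • bimodCupCochain Γ (show i' + j = n' by omega) (f ∘ₗ P.d i' i) g +
        bimodCupCochain Γ (show i + j' = n' by omega) f (g ∘ₗ P.d j' j) := by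
  have hs₁ : (i' * j).negOnePow = j.negOnePow * (i * j).negOnePow := by
    rw [← hi, ← Int.negOnePow_add]; congr 1; ring
  have hs₂ : (i * j').negOnePow = (i * j).negOnePow * i.negOnePow := by
    rw [← hj, ← Int.negOnePow_add]; congr 1; ring
  have hs₃ : j.negOnePow * j.negOnePow = 1 := Int.units_mul_self _
  have e₁ := BimodTensor.map_comp_map (k := k) (P.d i' i) (LinearMap.id (M := P.X j)) f g
  have e₂ := BimodTensor.map_comp_map (k := k) (LinearMap.id (M := P.X i)) (P.d j' j) f g
  rw [LinearMap.comp_id] at e₁ e₂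
  simp only [bimodCupCochain, LinearMap.smul_comp]
  rw [LinearMap.comp_assoc, Γ.comp_d i j i' j' n' n hi hj hn h, LinearMap.comp_add,
    ← LinearMap.comp_assoc, e₁, smul_smul, hs₁, ← mul_assoc, hs₃, one_mul, hs₂, mul_smul,
    smul_add]
  congr 2
  rw [← e₂]
  refine LinearMap.ext fun x => ?_
  rcases Int.units_eq_one_or i.negOnePow with h | h <;> simp [h]

/-- The cup product of cocycles. -/
def bimodCupCocycle (M N : Type*)
    [AddCommGroup M] [Module k M] [Module (Env k A) M] [IsScalarTower k (Env k A) M]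
    [AddCommGroup N] [Module k N] [Module (Env k A) N] [IsScalarTower k (Env k A) N]
    {i j n : ℤ} (h : i + j = n) :
    cocycles P M i →ₗ[k] cocycles P N j →ₗ[k] cocycles P (BimodTensor k A M N) n :=
  LinearMap.mk₂ k
    (fun f g => ⟨bimodCupCochainBilin Γ M N h f.1 g.1, by
      have hf := (mem_cocycles P).1 f.2
      have hg := (mem_cocycles P).1 g.2
      rw [mem_cocycles]
      refine (bimodCupCochain_comp_d Γ h rfl rfl rfl f.1 g.1).trans ?_
      rw [hf, hg, bimodCupCochain, bimodCupCochain, BimodTensor.map_zero_left,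
        BimodTensor.map_zero_right]
      simp⟩)
    (fun f f' g => Subtype.ext (LinearMap.map_add₂ _ _ _ _))
    (fun c f g => Subtype.ext (LinearMap.map_smul₂ _ _ _ _))
    (fun f g g' => Subtype.ext (map_add _ _ _))
    (fun c f g => Subtype.ext (map_smul _ _ _))

/-- The cup product `HĤ^i(A, M) × HĤ^j(A, N) → HĤ^n(A, M ⊗_A N)`, `n = i + j`, in
Tate-Hochschild cohomology. -/
def bimodCup (M N : Type*)
    [AddCommGroup M] [Module k M] [Module (Env k A) M] [IsScalarTower k (Env k A) M]
    [AddCommGroup N] [Module k N] [Module (Env k A) N] [IsScalarTower k (Env k A) N]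
    {i j n : ℤ} (h : i + j = n) :
    TateExt P M i →ₗ[k] TateExt P N j →ₗ[k] TateExt P (BimodTensor k A M N) n :=
  LinearMap.liftQ₂ _ _
    ((bimodCupCocycle Γ M N h).compr₂ (coboundaries P (BimodTensor k A M N) n).mkQ)
    (by
      intro f hf
      obtain ⟨f', hf'⟩ := (mem_coboundaries P).1 hf
      refine LinearMap.ext fun g => (Submodule.Quotient.mk_eq_zero _).2 ?_
      have hg := (mem_cocycles P).1 g.2
      refine (mem_coboundaries P).2
        ⟨j.negOnePow • bimodCupCochain Γ (show i - 1 + j = n - 1 by omega) f' g.1, ?_⟩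
      rw [LinearMap.smul_comp, bimodCupCochain_comp_d Γ (i := i - 1) (i' := i) (n' := n) _
        (by omega) rfl
        (by omega) f' g.1, hf', hg, bimodCupCochain, bimodCupCochain, BimodTensor.map_zero_right,
        LinearMap.zero_comp, smul_zero, add_zero, smul_smul, Int.units_mul_self, one_smul]
      rfl)
    (by
      intro g hg
      obtain ⟨g', hg'⟩ := (mem_coboundaries P).1 hg
      refine LinearMap.ext fun f => (Submodule.Quotient.mk_eq_zero _).2 ?_
      have hf := (mem_cocycles P).1 f.2
      refine (mem_coboundaries P).2
        ⟨bimodCupCochain Γ (show i + (j - 1) = n - 1 by omega) f.1 g', ?_⟩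
      rw [bimodCupCochain_comp_d Γ (j := j - 1) (j' := j) (n' := n) _ rfl (by omega)
        (by omega) f.1 g', hg', hf, bimodCupCochain, bimodCupCochain, BimodTensor.map_zero_left,
        LinearMap.zero_comp, smul_zero, smul_zero, zero_add]
      rfl)

/-- The product of `HĤ^*(A, A)`: the cup product followed by the map induced by
`A ⊗_A A ≅ A`. -/
def hochschildMul (i j n : ℤ) (h : i + j = n) :
    TateExt P (RegularBimodule k A) i →ₗ[k] TateExt P (RegularBimodule k A) j →ₗ[k]
      TateExt P (RegularBimodule k A) n :=
  (bimodCup Γ (RegularBimodule k A) (RegularBimodule k A) h).compr₂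
    (TateExt.map P (regularMul k A) n)

/-- The identity of `HĤ^*(A, A)`: the class of the augmentation, that is, of the identity of
`A`. -/
def hochschildOne (P : CompleteResolution.{w} k (Env k A) (RegularBimodule k A)) :
    TateExt P (RegularBimodule k A) 0 :=
  augClass P

end BimodCup

/-! ## Graded algebras -/

/-- The bilinear maps `H_i × H_j → H_{i + j}` and the element `1 ∈ H_0` make the sum of the `H_n`
an associative unital graded `k`-algebra. -/
structure IsGradedAlgebra (k : Type*) [Field k] (H : ℤ → Type*) [∀ n, AddCommGroup (H n)]
    [∀ n, Module k (H n)] (mul : ∀ i j n : ℤ, i + j = n → H i →ₗ[k] H j →ₗ[k] H n)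
    (one : H 0) : Prop where
  one_mul : ∀ (n : ℤ) (x : H n), mul 0 n n (zero_add n) one x = x
  mul_one : ∀ (n : ℤ) (x : H n), mul n 0 n (add_zero n) x one = x
  mul_assoc : ∀ (i j l a b n : ℤ) (hij : i + j = a) (hal : a + l = n) (hjl : j + l = b)
    (hib : i + b = n) (x : H i) (y : H j) (z : H l),
    mul a l n hal (mul i j a hij x y) z = mul i b n hib x (mul j l b hjl y z)

end

end TateHopf

/-! The argument rests on two facts. First, a finite dimensional Hopf algebra is a Frobenius algebra
with bijective antipode (Larson and Sweedler), and hence so is its enveloping algebra. Frobenius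
algebras are self-injective, so Hom into a finitely generated projective module is exact on every
exact complex. Splicing free covers of kernels with embeddings of cokernels then gives complete
resolutions. Secondly, an analogue of the comparison theorem holds for exact complexes that are
unbounded in both directions. A map in degree 0 extends upwards because the source is projective,
and downwards because Hom into the target terms is exact on the source
(`ExactComplex.exists_chainMap`). If two chain maps agree up to a coboundary after the augmentation
of the target, they agree up to coboundaries after every cocycle of the target
(`ExactComplex.exists_coboundary`).

Diagonal approximations arise from the same extension principle, with the product total complex of P
⊗ P as target. It is exact because P is contractible over the field (over the right action of A in
the bimodule case), and this contraction can be tensored with the other factor. The degree 0 part is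
obtained by lifting a degree -1 cycle. That cycle is built by a zigzag from its (0, -1) component,
which takes values on the augmentation module M itself. M need not be projective, so the zigzag
needs rows and columns that are contractible by module homomorphisms.

For the ring structure, each cocycle g of degree j gives a chain endomorphism `slant Θ g` of degree
-j of the bimodule resolution, and f ⌣ g is, up to sign, f composed with it. Moreover ε composed
with `slant Θ g` is cohomologous to g. The unit laws and associativity thus become statements about
chain maps with cohomologous augmentations. No triple tensor product is needed.

The comparison goes through σ : A → A ⊗ Aᵒᵖ. The enveloping algebra is free over A along σ, the
regular bimodule is induced from the trivial module, and its restriction is the adjoint module. A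
chain map u : P → X over σ lifting the unit k → A induces the map on cohomology. It is bijective
because the bimodule complex induced from P is again an exact complex of projectives augmented to A,
so it can be compared with X (`ComparisonMap.cohomology_bijective`). It is multiplicative because
slanting before or after u gives two chain maps P → X with cohomologous augmentations
(`ComparisonMap.cohomology_mul`). The algebra axioms for the adjoint side are then transported along
the isomorphism. -/

set_option linter.unusedSectionVars false

namespace TateHopf
noncomputable section

/-! ## Exact complexes indexed by the integers -/

section Complexes

/-- A sequence indexed by the integers whose consecutive terms are related can be built from one
term, if every term has a successor and a predecessor. -/
theorem exists_int_sequence {S : ℤ → Type*} (r : ∀ n, S n → S (n + 1) → Prop)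
    (up : ∀ n (s : S n), ∃ t, r n s t) (down : ∀ n (t : S (n + 1)), ∃ s, r n s t) (s₀ : S 0) :
    ∃ f : ∀ n, S n, f 0 = s₀ ∧ ∀ n, r n (f n) (f (n + 1)) := by
  choose u hu using up
  choose b hb using down
  -- `pos n` sits in degree n and `neg n` in degree -(n + 1), so the two recursions meet between
  -- degrees -1 and 0, at s₀.
  let pos : ∀ n : ℕ, S (n : ℤ) := Nat.rec s₀ fun n s => u n s
  let neg : ∀ n : ℕ, S (Int.negSucc n) :=
    Nat.rec (b (Int.negSucc 0) s₀) fun n s => b (Int.negSucc (n + 1)) s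
  refine ⟨fun n => match n with
    | Int.ofNat n => pos n
    | Int.negSucc n => neg n, rfl, ?_⟩
  rintro (n | n)
  · exact hu n (pos n)
  · cases n with
    | zero => exact hb (Int.negSucc 0) s₀
    | succ n => exact hb (Int.negSucc (n + 1)) (neg n)

/-- An exact complex `⋯ → X₁ → X₀ → X₋₁ → ⋯` of modules. -/
structure ExactComplex (R : Type*) [Ring R] where
  X : ℤ → Type w
  [addCommGroup : ∀ i, AddCommGroup (X i)]
  [module : ∀ i, Module R (X i)]
  d : ∀ i j, X i →ₗ[R] X j
  exact : ∀ a b c, b + 1 = a → c + 1 = b → Function.Exact (d a b) (d b c)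

attribute [instance] ExactComplex.addCommGroup ExactComplex.module

/-- The complex that underlies a complete resolution. -/
@[reducible] def CompleteResolution.toExactComplex {k R M : Type*} [Field k] [Ring R] [Algebra k R]
    [AddCommGroup M] [Module R M] (P : CompleteResolution.{w} k R M) : ExactComplex.{w} R where
  X := P.X
  d := P.d
  exact := by
    rintro a b c rfl h
    obtain rfl : c = b - 1 := by omega
    exact P.exact b

/-! ### Exactness of Hom and finite retracts -/

variable {R : Type*} [Ring R]

/-- The complex `C` with degrees shifted: its term in degree `n` is `C_{n - j}`. -/
@[reducible] def ExactComplex.shift (C : ExactComplex.{w} R) (j : ℤ) : ExactComplex.{w} R where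
  X n := C.X (n - j)
  d a b := C.d (a - j) (b - j)
  exact a b c _ _ := C.exact _ _ _ (by omega) (by omega)

/-- The functor `Hom(-, Q)` is exact on `C`. -/
def HomExact (C : ExactComplex.{w} R) (Q : Type*) [AddCommGroup Q] [Module R Q] : Prop :=
  ∀ a b c, b + 1 = a → c + 1 = b → ∀ f : C.X b →ₗ[R] Q, f ∘ₗ C.d a b = 0 →
    ∃ g : C.X c →ₗ[R] Q, g ∘ₗ C.d b c = f

/-- `Q` is a direct summand of a finite power of `B`. -/
def FinRetract (R B Q : Type*) [Ring R] [AddCommGroup B] [Module R B] [AddCommGroup Q]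
    [Module R Q] : Prop :=
  ∃ (s : Type) (_ : Fintype s) (i : s → Q →ₗ[R] B) (r : s → B →ₗ[R] Q),
    ∑ x, r x ∘ₗ i x = LinearMap.id

theorem FinRetract.trans {B Q Q' : Type*} [AddCommGroup B] [Module R B] [AddCommGroup Q]
    [Module R Q] [AddCommGroup Q'] [Module R Q'] (h : FinRetract R B Q) (h' : FinRetract R Q Q') :
    FinRetract R B Q' := by
  obtain ⟨s, _, i, r, h⟩ := h
  obtain ⟨s', _, i', r', h'⟩ := h'
  refine ⟨s × s', inferInstance, fun x => i x.1 ∘ₗ i' x.2, fun x => r' x.2 ∘ₗ r x.1, ?_⟩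
  rw [Fintype.sum_prod_type_right, ← h']
  refine Finset.sum_congr rfl fun y _ => LinearMap.ext fun q => ?_
  have := LinearMap.congr_fun h (i' y q)
  simp only [LinearMap.sum_apply, LinearMap.comp_apply, LinearMap.id_apply] at this ⊢
  rw [← map_sum, this]

theorem FinRetract.of_equiv {B Q : Type*} [AddCommGroup B] [Module R B] [AddCommGroup Q]
    [Module R Q] {s : Type} [Fintype s] (e : (s → B) ≃ₗ[R] Q) : FinRetract R B Q := by
  classical
  refine ⟨s, inferInstance, fun x => LinearMap.proj x ∘ₗ e.symm.toLinearMap,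
    fun x => e.toLinearMap ∘ₗ LinearMap.single R (fun _ => B) x, LinearMap.ext fun q => ?_⟩
  simp only [LinearMap.sum_apply, LinearMap.comp_apply, LinearMap.id_apply]
  rw [← map_sum]
  refine (congrArg e ?_).trans (e.apply_symm_apply q)
  exact Finset.univ_sum_single (e.symm q)

/-- Retracts of finite powers replace finitely generated projectives throughout: a property stable
under such retracts needs checking only on the ring itself, and the tensor constructions below
visibly preserve retracts. -/
theorem FinRetract.of_projective (Q : Type*) [AddCommGroup Q] [Module R Q] [Module.Finite R Q]
    [Module.Projective R Q] : FinRetract R R Q := by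
  obtain ⟨n, f, g, -, -, h⟩ := Module.Finite.exists_comp_eq_id_of_projective R Q
  exact (FinRetract.of_equiv (LinearEquiv.refl R (Fin n → R))).trans
    ⟨Unit, inferInstance, fun _ => g, fun _ => f, by simpa using h⟩

theorem FinRetract.projective {Q : Type*} [AddCommGroup Q] [Module R Q]
    (h : FinRetract R R Q) : Module.Projective R Q := by
  classical
  obtain ⟨s, _, i, r, h⟩ := h
  refine Module.Projective.of_split (LinearMap.pi i) (LinearMap.lsum R (fun _ : s => R) ℤ r) ?_
  rw [← h]
  refine LinearMap.ext fun q => ?_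
  simp

theorem HomExact.of_finRetract {C : ExactComplex.{w} R} {B Q : Type*} [AddCommGroup B]
    [Module R B] [AddCommGroup Q] [Module R Q] (hB : HomExact C B) (h : FinRetract R B Q) :
    HomExact C Q := by
  obtain ⟨s, _, i, r, h⟩ := h
  intro a b c hab hbc f hf
  have (x : s) : ∃ g : C.X c →ₗ[R] B, g ∘ₗ C.d b c = i x ∘ₗ f :=
    hB a b c hab hbc _ (by rw [LinearMap.comp_assoc, hf, LinearMap.comp_zero])
  choose g hg using this
  refine ⟨∑ x, r x ∘ₗ g x, LinearMap.ext fun y => ?_⟩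
  have h1 := LinearMap.congr_fun h (f y)
  simp only [LinearMap.sum_apply, LinearMap.comp_apply, LinearMap.id_apply] at h1 ⊢
  rw [← h1]
  exact Finset.sum_congr rfl fun x _ => congrArg (r x) (LinearMap.congr_fun (hg x) y)

/-- The terms of a product total complex are infinite products of projectives, in general not
finitely generated. As targets they only need this exactness, which is inherited factor by factor.
-/
theorem HomExact.pi {C : ExactComplex.{w} R} {ι : Type*} {Q : ι → Type*}
    [∀ x, AddCommGroup (Q x)] [∀ x, Module R (Q x)] (h : ∀ x, HomExact C (Q x)) :
    HomExact C (∀ x, Q x) := by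
  intro a b c hab hbc f hf
  have (x : ι) : ∃ g : C.X c →ₗ[R] Q x, g ∘ₗ C.d b c = LinearMap.proj x ∘ₗ f :=
    h x a b c hab hbc _ (by rw [LinearMap.comp_assoc, hf, LinearMap.comp_zero])
  choose g hg using this
  exact ⟨LinearMap.pi g, LinearMap.ext fun y => funext fun x => LinearMap.congr_fun (hg x) y⟩

/-- `Hom` into the ring is exact on a complete resolution, hence so is `Hom` into a summand of a
finite free module. -/
theorem CompleteResolution.homExact {k R M Q : Type*} [Field k] [Ring R] [Algebra k R]
    [AddCommGroup M] [Module R M] (P : CompleteResolution.{w} k R M) [AddCommGroup Q]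
    [Module R Q] (h : FinRetract R R Q) : HomExact P.toExactComplex Q := by
  refine HomExact.of_finRetract ?_ h
  rintro a b c rfl hbc f hf
  obtain rfl : c = b - 1 := by omega
  exact P.dual_exact b f hf

/-! ### Chain maps, homotopies and contractions -/

namespace ExactComplex

variable (C : ExactComplex.{w₁} R) (D : ExactComplex.{w₂} R)

theorem d_comp_d {a b c : ℤ} (hab : b + 1 = a) (hbc : c + 1 = b) : C.d b c ∘ₗ C.d a b = 0 :=
  LinearMap.ext fun x => (C.exact a b c hab hbc).apply_apply_eq_zero x

theorem exists_lift {a b c : ℤ} (hab : b + 1 = a) (hbc : c + 1 = b) {P : Type*} [AddCommGroup P]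
    [Module R P] [Module.Projective R P] (f : P →ₗ[R] C.X b) (hf : C.d b c ∘ₗ f = 0) :
    ∃ g : P →ₗ[R] C.X a, C.d a b ∘ₗ g = f := by
  have h (x : P) : f x ∈ LinearMap.range (C.d a b) :=
    (C.exact a b c hab hbc _).1 (LinearMap.congr_fun hf x)
  obtain ⟨g, hg⟩ := Module.projective_lifting_property (C.d a b).rangeRestrict (f.codRestrict _ h)
    (LinearMap.surjective_rangeRestrict _)
  exact ⟨g, LinearMap.ext fun x => congrArg Subtype.val (LinearMap.congr_fun hg x)⟩

variable {C D}

/-- A chain map from a complex of projective modules on which `Hom` into the terms of the target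
is exact is null-homotopic if it is so in one degree. -/
theorem exists_homotopy [∀ n, Module.Projective R (C.X n)] (hD : ∀ n, HomExact C (D.X n))
    (φ : ∀ n, C.X n →ₗ[R] D.X n) (comm : ∀ a b, b + 1 = a → D.d a b ∘ₗ φ a = φ b ∘ₗ C.d a b)
    {j j' : ℤ} (hj : j' + 1 = j) (s : C.X j' →ₗ[R] D.X j)
    (hs : D.d j j' ∘ₗ φ j = D.d j j' ∘ₗ s ∘ₗ C.d j j') (n : ℤ) :
    ∀ a c, n + 1 = a → c + 1 = n → ∃ (s : C.X n →ₗ[R] D.X a) (s' : C.X c →ₗ[R] D.X n),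
      φ n = D.d a n ∘ₗ s + s' ∘ₗ C.d n c := by
  -- Upwards, φ - s d takes values in cycles and is lifted by projectivity of the source. Downwards,
  -- φ - d s' vanishes on boundaries and is factored by `HomExact`. Each step reuses one of the two
  -- maps of the neighbouring degree.
  induction n using Int.inductionOn' (b := j) with
  | zero =>
    intro a c ha hc
    obtain rfl : c = j' := by omega
    obtain ⟨t, ht⟩ := D.exists_lift ha hc (φ j - s ∘ₗ C.d j c)
      (by rw [LinearMap.comp_sub, hs, sub_self])
    exact ⟨t, s, by rw [ht, sub_add_cancel]⟩
  | succ n _ ih =>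
    intro a c ha hc
    obtain rfl : c = n := by omega
    obtain ⟨t, t', h⟩ := ih (c + 1) (c - 1) rfl (by omega)
    obtain ⟨t'', h''⟩ := D.exists_lift ha hc (φ (c + 1) - t ∘ₗ C.d (c + 1) c) (by
      rw [LinearMap.comp_sub, comm _ _ rfl, h, LinearMap.add_comp, LinearMap.comp_assoc,
        LinearMap.comp_assoc, C.d_comp_d rfl (by omega), LinearMap.comp_zero, add_zero, sub_self])
    exact ⟨t'', t, by rw [h'', sub_add_cancel]⟩
  | pred n _ ih =>
    intro a c ha hc
    obtain rfl : a = n := by omega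
    obtain ⟨t, t', h⟩ := ih (a + 1) (a - 1) rfl (by omega)
    obtain ⟨t'', h''⟩ := hD (a - 1) a (a - 1) c ha hc (φ (a - 1) - D.d a (a - 1) ∘ₗ t') (by
      rw [LinearMap.sub_comp, ← comm _ _ (by omega), h, LinearMap.comp_add,
        ← LinearMap.comp_assoc, D.d_comp_d rfl (by omega), LinearMap.zero_comp, zero_add,
        LinearMap.comp_assoc, sub_self])
    exact ⟨t', t'', by rw [h'', add_sub_cancel]⟩

/-- Two chain maps that agree up to a coboundary after an augmentation of the target agree up to
coboundaries after every cocycle of the target. -/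
theorem exists_coboundary [∀ n, Module.Projective R (C.X n)] (hD : ∀ n, HomExact C (D.X n))
    (φ ψ : ∀ n, C.X n →ₗ[R] D.X n) (hφ : ∀ a b, b + 1 = a → D.d a b ∘ₗ φ a = φ b ∘ₗ C.d a b)
    (hψ : ∀ a b, b + 1 = a → D.d a b ∘ₗ ψ a = ψ b ∘ₗ C.d a b)
    {j j₁ j' : ℤ} (hj₁ : j + 1 = j₁) (hj : j' + 1 = j) {N : Type*} [AddCommGroup N] [Module R N]
    (e : D.X j →ₗ[R] N) (he : Function.Surjective e) (hed : Function.Exact (D.d j₁ j) e)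
    (c : C.X j' →ₗ[R] N) (hc : e ∘ₗ φ j - e ∘ₗ ψ j = c ∘ₗ C.d j j')
    {L : Type*} [AddCommGroup L] [Module R L] {n n₁ n' : ℤ} (hn₁ : n + 1 = n₁) (hn : n' + 1 = n)
    (F : D.X n →ₗ[R] L) (hF : F ∘ₗ D.d n₁ n = 0) :
    ∃ b : C.X n' →ₗ[R] L, b ∘ₗ C.d n n' = F ∘ₗ φ n - F ∘ₗ ψ n := by
  -- Lifting c along e turns the coboundary into a homotopy in degree j: φ - ψ - s d dies under e,
  -- so it lands in the boundaries and the next differential kills it. At degree n, F kills the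
  -- summand d t of the resulting homotopy, which leaves F t' as the primitive.
  obtain ⟨s, hs⟩ := Module.projective_lifting_property e c he
  obtain ⟨t, t', h⟩ := exists_homotopy hD (fun n => φ n - ψ n)
    (fun a b h => by rw [LinearMap.comp_sub, LinearMap.sub_comp, hφ a b h, hψ a b h]) hj s (by
      rw [← sub_eq_zero, ← LinearMap.comp_sub]
      refine LinearMap.ext fun x => (D.exact j₁ j j' hj₁ hj _).2 ((hed _).1 ?_)
      have h1 := LinearMap.congr_fun hc x
      have h2 := LinearMap.congr_fun hs (C.d j j' x)
      simp only [LinearMap.sub_apply, LinearMap.comp_apply, map_sub] at h1 h2 ⊢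
      rw [h1, h2, sub_self]) n n₁ n' hn₁ hn
  refine ⟨F ∘ₗ t', ?_⟩
  rw [← LinearMap.comp_sub, h, LinearMap.comp_add, ← LinearMap.comp_assoc, hF,
    LinearMap.zero_comp, zero_add, LinearMap.comp_assoc]

/-- A chain map can be constructed from its term in degree zero. -/
theorem exists_chainMap [∀ n, Module.Projective R (C.X n)] (hD : ∀ n, HomExact C (D.X n))
    (φ₀ : C.X 0 →ₗ[R] D.X 0) (h₀ : D.d 0 (-1) ∘ₗ φ₀ ∘ₗ C.d 1 0 = 0) :
    ∃ φ : ∀ n, C.X n →ₗ[R] D.X n, φ 0 = φ₀ ∧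
      ∀ a b, b + 1 = a → D.d a b ∘ₗ φ a = φ b ∘ₗ C.d a b := by
  -- The condition d φ d = 0 is what both extensions need: φ d then takes values in cycles, and d φ
  -- vanishes on boundaries. The new map satisfies the condition again because d d = 0.
  let S (n : ℤ) : Type _ := {φ : C.X n →ₗ[R] D.X n //
    ∀ a c, n + 1 = a → c + 1 = n → D.d n c ∘ₗ φ ∘ₗ C.d a n = 0}
  obtain ⟨f, hf₀, hf⟩ := exists_int_sequence (S := S)
    (fun n φ φ' => D.d (n + 1) n ∘ₗ φ'.1 = φ.1 ∘ₗ C.d (n + 1) n)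
    (fun n φ => by
      obtain ⟨g, hg⟩ := D.exists_lift rfl (sub_add_cancel n 1) (φ.1 ∘ₗ C.d (n + 1) n)
        (φ.2 _ _ rfl (sub_add_cancel n 1))
      refine ⟨⟨g, fun a c ha hc => ?_⟩, hg⟩
      obtain rfl : c = n := by omega
      rw [← LinearMap.comp_assoc, hg, LinearMap.comp_assoc, C.d_comp_d ha rfl,
        LinearMap.comp_zero])
    (fun n φ => by
      obtain ⟨g, hg⟩ := hD n _ _ n rfl rfl (D.d (n + 1) n ∘ₗ φ.1)
        (by rw [LinearMap.comp_assoc]; exact φ.2 _ _ rfl rfl)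
      refine ⟨⟨g, fun a c ha hc => ?_⟩, hg.symm⟩
      subst ha
      rw [hg, ← LinearMap.comp_assoc, D.d_comp_d rfl hc, LinearMap.zero_comp])
    ⟨φ₀, fun a c ha hc => by
      obtain rfl : c = -1 := by omega
      obtain rfl : a = 1 := by omega
      exact h₀⟩
  exact ⟨fun n => (f n).1, congrArg Subtype.val hf₀, fun a b h => by subst h; exact hf b⟩

/-- A chain map that lifts a homomorphism between the augmentation modules. -/
theorem exists_chainMap_of_augmented [∀ n, Module.Projective R (C.X n)]
    (hD : ∀ n, HomExact C (D.X n)) {M N : Type*} [AddCommGroup M] [Module R M] [AddCommGroup N]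
    [Module R N] (ε : C.X 0 →ₗ[R] M) (hε : ε ∘ₗ C.d 1 0 = 0) (e : D.X 0 →ₗ[R] N)
    (he : Function.Surjective e) (hed : Function.Exact (D.d 1 0) e) (α : M →ₗ[R] N) :
    ∃ φ : ∀ n, C.X n →ₗ[R] D.X n, e ∘ₗ φ 0 = α ∘ₗ ε ∧
      ∀ a b, b + 1 = a → D.d a b ∘ₗ φ a = φ b ∘ₗ C.d a b := by
  obtain ⟨φ₀, h₀⟩ := Module.projective_lifting_property e (α ∘ₗ ε) he
  obtain ⟨φ, hφ₀, hφ⟩ := exists_chainMap hD φ₀ (by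
    refine LinearMap.ext fun x => (D.exact 1 0 (-1) rfl rfl _).2 ((hed _).1 ?_)
    have h1 := LinearMap.congr_fun h₀ (C.d 1 0 x)
    have h2 := LinearMap.congr_fun hε x
    simp only [LinearMap.comp_apply, LinearMap.zero_apply] at h1 h2 ⊢
    rw [h1, h2, map_zero])
  exact ⟨φ, by rw [hφ₀, h₀], hφ⟩

variable (C) in
/-- A complex whose differentials are split is contractible. -/
theorem exists_contraction
    (h : ∀ a b, b + 1 = a → ∃ s : C.X b →ₗ[R] C.X a, C.d a b ∘ₗ s ∘ₗ C.d a b = C.d a b) :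
    ∃ h : ∀ i j, C.X i →ₗ[R] C.X j, ∀ a b c, b + 1 = a → c + 1 = b → ∀ x,
      C.d a b (h b a x) + h c b (C.d b c x) = x := by
  have (i j : ℤ) : ∃ s : C.X i →ₗ[R] C.X j, i + 1 = j → ∀ x, C.d j i (s (C.d j i x)) = C.d j i x := by
    by_cases hij : i + 1 = j
    · obtain ⟨s, hs⟩ := h j i hij
      exact ⟨s, fun _ => LinearMap.congr_fun hs⟩
    · exact ⟨0, fun h => absurd h hij⟩
  choose s hs using this
  -- Since x - s d x is a cycle, hence a boundary, it is fixed by d s. Therefore d s x + (1 - d s) s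
  -- d x = x. The factor 1 - d s removes the overlap between the two terms, and it disappears under
  -- d.
  refine ⟨fun i j => (LinearMap.id - C.d (j + 1) j ∘ₗ s j (j + 1)) ∘ₗ s i j ∘ₗ C.d j i ∘ₗ s i j, ?_⟩
  intro a b c hab hbc x
  have hdd (y : C.X (a + 1)) : C.d a b (C.d (a + 1) a y) = 0 :=
    LinearMap.congr_fun (C.d_comp_d rfl hab) y
  have hz : C.d b c (x - s c b (C.d b c x)) = 0 := by rw [map_sub, hs c b hbc, sub_self]
  obtain ⟨y, hy⟩ := (C.exact a b c hab hbc _).1 hz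
  subst hab
  have h1 := hs b (b + 1) rfl y
  rw [hy] at h1
  simp only [LinearMap.comp_apply, LinearMap.sub_apply, LinearMap.id_apply, map_sub, hdd, sub_zero,
    hs b (b + 1) rfl, hs c b hbc] at h1 ⊢
  rw [← sub_eq_zero] at h1 ⊢
  rw [← h1]
  abel

/-- One split differential makes the identity null-homotopic in one degree, and `exists_homotopy`
spreads this to all degrees. Composing 1 = d t + t' d with d gives d t d = d, so every differential
splits. -/
theorem exists_contraction_of_degree [∀ n, Module.Projective R (C.X n)]
    (hC : ∀ n, HomExact C (C.X n)) {j j' : ℤ} (hj : j' + 1 = j) (s : C.X j' →ₗ[R] C.X j)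
    (hs : C.d j j' ∘ₗ s ∘ₗ C.d j j' = C.d j j') :
    ∃ h : ∀ i j, C.X i →ₗ[R] C.X j, ∀ a b c, b + 1 = a → c + 1 = b → ∀ x,
      C.d a b (h b a x) + h c b (C.d b c x) = x := by
  refine C.exists_contraction fun a b hab => ?_
  obtain ⟨t, t', h⟩ := exists_homotopy hC (fun n => LinearMap.id)
    (fun _ _ _ => by rw [LinearMap.id_comp, LinearMap.comp_id]) hj s
    (by rw [LinearMap.comp_id, hs]) b a (b - 1) hab (sub_add_cancel b 1)
  refine ⟨t, ?_⟩
  have h1 := congrArg (fun f => f ∘ₗ C.d a b) h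
  simp only [LinearMap.id_comp, LinearMap.add_comp] at h1
  rw [LinearMap.comp_assoc (C.d a b) (C.d b (b - 1)) t', C.d_comp_d hab (sub_add_cancel b 1),
    LinearMap.comp_zero, add_zero] at h1
  exact h1.symm

end ExactComplex

/-! ## Double complexes and their product total complexes -/

/-- A double complex with commuting differentials. -/
structure DoubleComplex (R : Type*) [Ring R] where
  X : ℤ → ℤ → Type w
  [addCommGroup : ∀ i j, AddCommGroup (X i j)]
  [module : ∀ i j, Module R (X i j)]
  d₁ : ∀ i i' j, X i j →ₗ[R] X i' j
  d₂ : ∀ i j j', X i j →ₗ[R] X i j'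
  comm : ∀ i i' j j' x, d₁ i i' j' (d₂ i j j' x) = d₂ i' j j' (d₁ i i' j x)
  d₁_d₁ : ∀ a b c j, b + 1 = a → c + 1 = b → ∀ x, d₁ b c j (d₁ a b j x) = 0
  d₂_d₂ : ∀ i a b c, b + 1 = a → c + 1 = b → ∀ x, d₂ i b c (d₂ i a b x) = 0

attribute [instance] DoubleComplex.addCommGroup DoubleComplex.module

namespace DoubleComplex

variable (T : DoubleComplex.{w} R)

/-- The degree `n` part of the product total complex. -/
abbrev Tot (n : ℤ) : Type _ := ∀ p : {p : ℤ × ℤ // p.1 + p.2 = n}, T.X p.1.1 p.1.2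

/-- The total differential, with the sign `(-1)^i` on the second differential. -/
def totD (n m : ℤ) (h : m + 1 = n) : T.Tot n →ₗ[R] T.Tot m :=
  LinearMap.pi fun p =>
    T.d₁ (p.1.1 + 1) p.1.1 p.1.2 ∘ₗ
        LinearMap.proj (⟨(p.1.1 + 1, p.1.2), by have := p.2; dsimp only; omega⟩ :
          {p : ℤ × ℤ // p.1 + p.2 = n}) +
      p.1.1.negOnePow • (T.d₂ p.1.1 (p.1.2 + 1) p.1.2 ∘ₗ
        LinearMap.proj (⟨(p.1.1, p.1.2 + 1), by have := p.2; dsimp only; omega⟩ :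
          {p : ℤ × ℤ // p.1 + p.2 = n}))

variable {T}

theorem totD_apply {n m : ℤ} (h : m + 1 = n) (z : T.Tot n) (i i' j j' : ℤ) (hi : i + 1 = i')
    (hj : j + 1 = j') (hij : i + j = m) :
    T.totD n m h z ⟨(i, j), hij⟩ = T.d₁ i' i j (z ⟨(i', j), by dsimp only; omega⟩) +
      i.negOnePow • T.d₂ i j' j (z ⟨(i, j'), by dsimp only; omega⟩) := by
  subst hi hj; rfl

theorem totD_totD {a b c : ℤ} (hab : b + 1 = a) (hbc : c + 1 = b) (z : T.Tot a) :
    T.totD b c hbc (T.totD a b hab z) = 0 := by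
  funext ⟨⟨i, j⟩, hij⟩
  dsimp only at hij
  rw [totD_apply hbc _ i (i + 1) j (j + 1) rfl rfl, totD_apply hab _ (i + 1) (i + 1 + 1) j (j + 1) rfl rfl,
    totD_apply hab _ i (i + 1) (j + 1) (j + 1 + 1) rfl rfl, map_add, map_add, T.d₁_d₁ _ _ _ _ rfl rfl,
    zero_add, Int.negOnePow_succ, smul_add]
  simp only [Units.smul_def, map_neg, map_zsmul, T.comm, T.d₂_d₂ _ _ _ _ rfl rfl, smul_zero, add_zero,
    Units.val_neg, neg_smul]
  exact neg_add_cancel (_ : T.X i j)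

/-- The product total complex is exact if the first differential has a contraction that commutes
with the second one. -/
@[reducible] def total (h : ∀ i i' j, T.X i j →+ T.X i' j)
    (h₁ : ∀ a b c j, b + 1 = a → c + 1 = b → ∀ x,
      T.d₁ a b j (h b a j x) + h c b j (T.d₁ b c j x) = x)
    (h₂ : ∀ i i' j j' x, T.d₂ i' j j' (h i i' j x) = h i i' j' (T.d₂ i j j' x)) :
    ExactComplex.{w} R where
  X := T.Tot
  d a b := if hab : b + 1 = a then T.totD a b hab else 0
  exact := by
    intro a b c hab hbc z
    rw [dif_pos hab, dif_pos hbc]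
    refine ⟨fun hz => ?_, ?_⟩
    -- A primitive of z is obtained by applying h to each component of z along the first direction.
    -- Its differential differs from z by terms that cancel when h is applied to the cycle equation
    -- at (i - 1, j). No infinite sum occurs, so products cause no trouble.
    · refine ⟨fun p => h (p.1.1 - 1) p.1.1 p.1.2 (z ⟨(p.1.1 - 1, p.1.2), by
        have := p.2; dsimp only; omega⟩), ?_⟩
      funext ⟨⟨i, j⟩, hij⟩
      dsimp only at hij
      rw [totD_apply hab _ i (i + 1) j (j + 1) rfl rfl]
      dsimp only
      -- The component of the primitive at i + 1 refers to the index i + 1 - 1, which is only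
      -- propositionally equal to i.
      have key : ∀ i₀ (hi₀ : i₀ = i) (hi : i₀ + j = b),
          T.d₁ (i + 1) i j (h i₀ (i + 1) j (z ⟨(i₀, j), hi⟩)) =
            T.d₁ (i + 1) i j (h i (i + 1) j (z ⟨(i, j), hij⟩)) := by
        rintro i₀ rfl _; rfl
      rw [key _ (add_sub_cancel_right i 1), h₂]
      have h3 := congrFun hz ⟨(i - 1, j), by dsimp only; omega⟩
      rw [totD_apply hbc _ (i - 1) i j (j + 1) (by omega) rfl, Pi.zero_apply] at h3
      have h4 := congrArg (h (i - 1) i j) h3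
      have h5 := h₁ (i + 1) i (i - 1) j rfl (by omega) (z ⟨(i, j), hij⟩)
      have h6 : i.negOnePow = - (i - 1).negOnePow := by
        rw [← Int.negOnePow_succ, sub_add_cancel]
      rw [h6]
      simp only [Units.smul_def, Units.val_neg, neg_smul, map_add, map_zsmul, map_zero] at h4 ⊢
      conv_rhs => rw [← h5]
      rw [add_left_cancel_iff, eq_comm, ← sub_eq_zero, sub_neg_eq_add]
      exact h4
    · rintro ⟨y, rfl⟩
      exact totD_totD hab hbc y

/-- Construction of a chain map into a product total complex from its value `y₀` on the
component of degree `(0, -1)`. -/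
theorem exists_chainMap_tot {C : ExactComplex.{w₁} R} [∀ n, Module.Projective R (C.X n)]
    (hT : ∀ i j, HomExact C (T.X i j)) (h : ∀ i i' j, T.X i j →+ T.X i' j)
    (h₁ : ∀ a b c j, b + 1 = a → c + 1 = b → ∀ x,
      T.d₁ a b j (h b a j x) + h c b j (T.d₁ b c j x) = x)
    (h₂ : ∀ i i' j j' x, T.d₂ i' j j' (h i i' j x) = h i i' j' (T.d₂ i j j' x))
    {M : Type*} [AddCommGroup M] [Module R M]
    (row : ∀ a b c j, b + 1 = a → c + 1 = b → ∀ z : M →ₗ[R] T.X b j, T.d₁ b c j ∘ₗ z = 0 →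
      ∃ z' : M →ₗ[R] T.X a j, T.d₁ a b j ∘ₗ z' = z)
    (col : ∀ i a b c, b + 1 = a → c + 1 = b → ∀ z : M →ₗ[R] T.X i b, T.d₂ i b c ∘ₗ z = 0 →
      ∃ z' : M →ₗ[R] T.X i a, T.d₂ i a b ∘ₗ z' = z)
    (ε : C.X 0 →ₗ[R] M) (hε : ε ∘ₗ C.d 1 0 = 0) (y₀ : M →ₗ[R] T.X 0 (-1))
    (hy₀ : ∀ m, T.d₁ 0 (-1) (-2) (T.d₂ 0 (-1) (-2) (y₀ m)) = 0) :
    ∃ Γ : ∀ n, C.X n →ₗ[R] T.Tot n, (∀ n m h, T.totD n m h ∘ₗ Γ n = Γ m ∘ₗ C.d n m) ∧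
      ∀ x, T.d₁ 1 0 (-1) (Γ 0 x ⟨(1, -1), rfl⟩) + T.d₂ 0 0 (-1) (Γ 0 x ⟨(0, 0), rfl⟩) =
        y₀ (ε x) := by
  -- The antidiagonal of degree -1 is indexed by p, with q tied to it by an equation to avoid
  -- transports. The invariant d₁ d₂ y = 0 lets the zigzag continue both ways: consecutive
  -- components must satisfy d₁ y' = ∓ d₂ y, which is solved for y' along a row and for y along a
  -- column.
  let S (p : ℤ) : Type _ := {y : ∀ q, p + q = -1 → (M →ₗ[R] T.X p q) //
    ∀ q q' p' (hq : p + q = -1), q' + 1 = q → p' + 1 = p →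
      ∀ m, T.d₁ p p' q' (T.d₂ p q q' (y q hq m)) = 0}
  obtain ⟨y, hy0, hy⟩ := exists_int_sequence (S := S)
    (fun p y y' => ∀ q q' (hq : p + q = -1) (hq' : p + 1 + q' = -1) m,
      T.d₁ (p + 1) p q' (y'.1 q' hq' m) + p.negOnePow • T.d₂ p q q' (y.1 q hq m) = 0)
    (fun p y => by
      obtain ⟨z, hz⟩ := row (p + 1) p (p - 1) (-2 - p) rfl (by omega)
        (-(p.negOnePow • (T.d₂ p (-1 - p) (-2 - p) ∘ₗ y.1 (-1 - p) (by omega))))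
        (LinearMap.ext fun m => by
          have := y.2 (-1 - p) (-2 - p) (p - 1) (by omega) (by omega) (by omega) m
          simp only [Units.smul_def, LinearMap.comp_apply, LinearMap.neg_apply,
            LinearMap.smul_apply, map_neg, map_zsmul, this]
          simp)
      have hz' (m : M) : T.d₁ (p + 1) p (-2 - p) (z m) =
          -(p.negOnePow • T.d₂ p (-1 - p) (-2 - p) (y.1 (-1 - p) (by omega) m)) :=
        LinearMap.congr_fun hz m
      refine ⟨⟨fun q hq => (show -2 - p = q by omega) ▸ z, ?_⟩, ?_⟩
      · intro q q' p' hq hq' hp' m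
        obtain rfl : q = -2 - p := by omega
        obtain rfl : p' = p := by omega
        dsimp only
        rw [T.comm, hz']
        simp only [Units.smul_def, map_neg, map_zsmul]
        rw [T.d₂_d₂ _ _ _ _ (by omega) hq', smul_zero, neg_zero]
      · intro q q' hq hq' m
        obtain rfl : q' = -2 - p := by omega
        obtain rfl : q = -1 - p := by omega
        dsimp only
        rw [hz']
        exact neg_add_cancel _)
    (fun p y => by
      obtain ⟨z, hz⟩ := col p (-1 - p) (-2 - p) (-3 - p) (by omega) (by omega)
        (-(p.negOnePow • (T.d₁ (p + 1) p (-2 - p) ∘ₗ y.1 (-2 - p) (by omega))))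
        (LinearMap.ext fun m => by
          have := y.2 (-2 - p) (-3 - p) p (by omega) (by omega) (by omega) m
          simp only [Units.smul_def, LinearMap.comp_apply, LinearMap.neg_apply,
            LinearMap.smul_apply, map_neg, map_zsmul, ← T.comm, this]
          simp)
      have hz' (m : M) : T.d₂ p (-1 - p) (-2 - p) (z m) =
          -(p.negOnePow • T.d₁ (p + 1) p (-2 - p) (y.1 (-2 - p) (by omega) m)) :=
        LinearMap.congr_fun hz m
      refine ⟨⟨fun q hq => (show -1 - p = q by omega) ▸ z, ?_⟩, ?_⟩
      · intro q q' p' hq hq' hp' m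
        obtain rfl : q = -1 - p := by omega
        obtain rfl : q' = -2 - p := by omega
        dsimp only
        rw [hz']
        simp only [Units.smul_def, map_neg, map_zsmul]
        rw [T.d₁_d₁ _ _ _ _ rfl hp', smul_zero, neg_zero]
      · intro q q' hq hq' m
        obtain rfl : q' = -2 - p := by omega
        obtain rfl : q = -1 - p := by omega
        dsimp only
        rw [hz', smul_neg, smul_smul, Int.units_mul_self, one_smul]
        exact add_neg_cancel _)
    ⟨fun q hq => (show -1 = q by omega) ▸ y₀, by
      intro q q' p' hq hq' hp' m
      obtain rfl : q = -1 := by omega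
      obtain rfl : q' = -2 := by omega
      obtain rfl : p' = -1 := by omega
      exact hy₀ m⟩
  let Y : M →ₗ[R] T.Tot (-1) := LinearMap.pi fun p => (y p.1.1).1 p.1.2 p.2
  have hY (m : M) : T.totD (-1) (-2) rfl (Y m) = 0 := by
    funext ⟨⟨i, j⟩, hij⟩
    dsimp only at hij
    rw [totD_apply _ _ i (i + 1) j (j + 1) rfl rfl]
    exact hy i (j + 1) j (by omega) (by omega) m
  let D := T.total h h₁ h₂
  have hd (a b : ℤ) (hab : b + 1 = a) : D.d a b = T.totD a b hab := dif_pos hab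
  -- The components assemble to a cycle Y of degree -1 on M. As Y ∘ ε vanishes on boundaries, any Γ₀
  -- with total differential Y ∘ ε satisfies the condition for extension to all degrees.
  obtain ⟨Γ₀, hΓ₀⟩ := D.exists_lift (a := 0) (b := -1) (c := -2) rfl rfl (Y ∘ₗ ε) (by
    rw [hd (-1) (-2) rfl]
    exact LinearMap.ext fun x => hY (ε x))
  obtain ⟨Γ, h0, hΓ⟩ := ExactComplex.exists_chainMap (C := C) (D := D)
    (fun n => HomExact.pi fun p => hT _ _) Γ₀ (by
      rw [← LinearMap.comp_assoc, hΓ₀, LinearMap.comp_assoc, hε, LinearMap.comp_zero])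
  refine ⟨Γ, fun n m h => by rw [← hd]; exact hΓ n m h, fun x => ?_⟩
  have h3 := congrFun (LinearMap.congr_fun hΓ₀ x) ⟨(0, -1), rfl⟩
  rw [hd 0 (-1) rfl, ← h0] at h3
  have h4 : Y (ε x) ⟨(0, -1), rfl⟩ = y₀ (ε x) := by
    change (y 0).1 (-1) _ (ε x) = _
    rw [hy0]
  rw [LinearMap.comp_apply, LinearMap.comp_apply, h4,
    totD_apply _ _ 0 1 (-1) 0 rfl rfl, Int.negOnePow_zero, one_smul] at h3
  exact h3

end DoubleComplex

end Complexes

end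

end TateHopf

namespace TateHopf
noncomputable section

/-! ## Induced modules -/

section Induced

variable {k R : Type*} [Field k] [Ring R] [Algebra k R]

/-- The `R`-linear map `R ⊗ V → G`, `r ⊗ v ↦ r • j v`. -/
def extendScalars {V G : Type*} [AddCommGroup V] [Module k V] [AddCommGroup G] [Module k G]
    [Module R G] [IsScalarTower k R G] (j : V →ₗ[k] G) : R ⊗[k] V →ₗ[R] G :=
  TensorProduct.AlgebraTensorModule.lift (LinearMap.toSpanSingleton R (V →ₗ[k] G) j)

variable {V G : Type*} [AddCommGroup V] [Module k V] [AddCommGroup G] [Module k G]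
    [Module R G] [IsScalarTower k R G]

@[simp]
theorem extendScalars_tmul (j : V →ₗ[k] G) (r : R) (v : V) :
    extendScalars j (r ⊗ₜ[k] v) = r • j v := rfl

theorem FinRetract.of_linearEquiv {B Q : Type*} [AddCommGroup B] [Module R B] [AddCommGroup Q]
    [Module R Q] (e : B ≃ₗ[R] Q) : FinRetract R B Q :=
  ⟨Unit, inferInstance, fun _ => e.symm.toLinearMap, fun _ => e.toLinearMap,
    LinearMap.ext fun _ => by simp⟩

/-- R ⊗ V is free on a basis of V; the coordinates of the basis give the maps to R. -/
theorem FinRetract.tensor (V : Type*) [AddCommGroup V] [Module k V] [Module.Finite k V] :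
    FinRetract R R (R ⊗[k] V) := by
  let b := Module.finBasis k V
  refine ⟨_, inferInstance, fun x => extendScalars (Algebra.linearMap k R ∘ₗ b.coord x),
    fun x => LinearMap.toSpanSingleton R _ (1 ⊗ₜ[k] b x), ?_⟩
  refine TensorProduct.AlgebraTensorModule.ext fun r v => ?_
  simp only [LinearMap.sum_apply, LinearMap.comp_apply, extendScalars_tmul,
    LinearMap.toSpanSingleton_apply, LinearMap.id_apply, Algebra.linearMap_apply, smul_eq_mul,
    TensorProduct.smul_tmul', mul_one, Module.Basis.coord_apply]
  conv_rhs => rw [← b.sum_repr v, TensorProduct.tmul_sum]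
  refine Finset.sum_congr rfl fun x _ => ?_
  rw [← Algebra.commutes, ← Algebra.smul_def, TensorProduct.smul_tmul]

/-- A dimension count spares the inverse. In the applications to Hopf algebras, surjectivity is one
antipode identity, while an explicit inverse would require its own verification. -/
theorem extendScalars_bijective [Module.Finite k R] [Module.Finite k V] [Module.Finite k G]
    (j : V →ₗ[k] G)
    (hG : Module.finrank k G = Module.finrank k R * Module.finrank k V)
    (h : Function.Surjective (extendScalars (R := R) j)) :
    Function.Bijective (extendScalars (R := R) j) := by
  refine ⟨?_, h⟩
  have h1 := LinearMap.injective_iff_surjective_of_finrank_eq_finrank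
    (f := (extendScalars (R := R) j).restrictScalars k)
    (by rw [hG, Module.finrank_tensorProduct])
  exact h1.2 h

theorem FinRetract.of_surjective [Module.Finite k R] [Module.Finite k V] [Module.Finite k G]
    (j : V →ₗ[k] G)
    (hG : Module.finrank k G = Module.finrank k R * Module.finrank k V)
    (h : Function.Surjective (extendScalars (R := R) j)) : FinRetract R R G :=
  (FinRetract.tensor V).trans
    (FinRetract.of_linearEquiv (LinearEquiv.ofBijective _ (extendScalars_bijective j hG h)))

variable (k) in
/-- The map `a ↦ a • m`. -/
def orbitMap (R : Type*) [Ring R] [Algebra k R] {M : Type*} [AddCommGroup M] [Module k M]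
    [Module R M] [IsScalarTower k R M] (m : M) : R →ₗ[k] M :=
  (LinearMap.toSpanSingleton R M m).restrictScalars k

@[simp]
theorem orbitMap_apply (m : G) (a : R) : orbitMap k R m a = a • m := rfl

end Induced

/-! ## Frobenius algebras -/

section Frobenius

variable (k : Type*) [Field k]

theorem exists_generalized_inverse {k L L' : Type*} [Field k] [AddCommGroup L] [Module k L]
    [AddCommGroup L'] [Module k L'] (d : L →ₗ[k] L') :
    ∃ s : L' →ₗ[k] L, d ∘ₗ s ∘ₗ d = d := by
  obtain ⟨s₀, hs₀⟩ := d.rangeRestrict.exists_rightInverse_of_surjective d.range_rangeRestrict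
  obtain ⟨s, hs⟩ := s₀.exists_extend
  refine ⟨s, LinearMap.ext fun x => ?_⟩
  have h1 := LinearMap.congr_fun hs (d.rangeRestrict x)
  have h2 := congrArg Subtype.val (LinearMap.congr_fun hs₀ (d.rangeRestrict x))
  rw [LinearMap.comp_apply, ← h1] at h2
  exact h2

/-- A finite dimensional algebra is Frobenius if it has a linear form whose kernel contains no
nonzero right ideal. -/
def IsFrobenius (R : Type*) [Ring R] [Algebra k R] : Prop :=
  ∃ l : R →ₗ[k] k, ∀ a, (∀ b, l (a * b) = 0) → a = 0

variable {k} {R : Type*} [Ring R] [Algebra k R] [Module.Finite k R]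

theorem bijective_of_injective_dual {V : Type*} [AddCommGroup V] [Module k V] [Module.Finite k V]
    (f : V →ₗ[k] Module.Dual k V) (h : Function.Injective f) : Function.Bijective f :=
  ⟨h, (LinearMap.injective_iff_surjective_of_finrank_eq_finrank
    Subspace.dual_finrank_eq.symm).1 h⟩

theorem IsFrobenius.exists_equiv (h : IsFrobenius k R) :
    ∃ (l : R →ₗ[k] k) (β β' : R ≃ₗ[k] Module.Dual k R),
      (∀ a b, β a b = l (a * b)) ∧ ∀ a b, β' a b = l (b * a) := by
  obtain ⟨l, hl⟩ := h
  let L : R →ₗ[k] Module.Dual k R := (LinearMap.mul k R).compr₂ l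
  have hL : Function.Injective L := by
    rw [injective_iff_map_eq_zero]
    exact fun a ha => hl a fun b => LinearMap.congr_fun ha b
  have hL' := (bijective_of_injective_dual L hL)
  -- Nondegeneracy passes to the other side: every linear form is l(b ·) for some b, so an element a
  -- with l(b a) = 0 for all b is annihilated by all linear forms.
  have hF : Function.Injective L.flip := by
    rw [injective_iff_map_eq_zero]
    intro a ha
    rw [← Module.forall_dual_apply_eq_zero_iff k]
    intro f
    obtain ⟨b, rfl⟩ := hL'.2 f
    exact LinearMap.congr_fun ha b
  exact ⟨l, LinearEquiv.ofBijective L hL', LinearEquiv.ofBijective L.flip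
    (bijective_of_injective_dual _ hF), fun _ _ => rfl, fun _ _ => rfl⟩

theorem IsFrobenius.mulOpposite (h : IsFrobenius k R) : IsFrobenius k Rᵐᵒᵖ := by
  obtain ⟨l, -, β, -, hβ⟩ := h.exists_equiv
  refine ⟨l ∘ₗ (MulOpposite.opLinearEquiv k).symm.toLinearMap, fun a ha => ?_⟩
  refine MulOpposite.unop_injective (β.injective (LinearMap.ext fun b => ?_))
  rw [hβ, MulOpposite.unop_zero, map_zero]
  exact ha (MulOpposite.op b)

/-- The form l ⊗ l' works: the associated map to the dual is the tensor product of the two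
isomorphisms β and β', composed with the identification of the dual of a tensor product. -/
theorem IsFrobenius.tensor {R' : Type*} [Ring R'] [Algebra k R'] [Module.Finite k R']
    (h : IsFrobenius k R) (h' : IsFrobenius k R') : IsFrobenius k (R ⊗[k] R') := by
  obtain ⟨l, β, -, hβ, -⟩ := h.exists_equiv
  obtain ⟨l', β', -, hβ', -⟩ := h'.exists_equiv
  let E := (TensorProduct.congr β β').trans (TensorProduct.dualDistribEquiv k R R')
  let L : R ⊗[k] R' →ₗ[k] k := LinearMap.mul' k k ∘ₗ TensorProduct.map l l'
  have hE : (LinearMap.mul k (R ⊗[k] R')).compr₂ L = E.toLinearMap := by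
    ext a a' b b'
    change L ((a ⊗ₜ a') * (b ⊗ₜ b')) = β a b * β' a' b'
    rw [hβ, hβ', Algebra.TensorProduct.tmul_mul_tmul]
    rfl
  exact ⟨L, fun a ha => E.injective ((LinearMap.congr_fun hE a).symm.trans
    ((LinearMap.ext ha).trans (map_zero E).symm))⟩

/-- Composition with l identifies R-linear maps into R with k-linear forms. The extension problem
therefore reduces to extending the form l ∘ f along d over the field, and g(y) is the element
determined by l(b g(y)) = γ(b y) for all b. -/
theorem IsFrobenius.exists_factor (h : IsFrobenius k R) {L L' : Type*} [AddCommGroup L]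
    [Module R L] [AddCommGroup L'] [Module R L'] (d : L →ₗ[R] L') (f : L →ₗ[R] R)
    (hf : ∀ x, d x = 0 → f x = 0) : ∃ g : L' →ₗ[R] R, g ∘ₗ d = f := by
  let _ : Module k L := Module.compHom L (algebraMap k R)
  let _ : Module k L' := Module.compHom L' (algebraMap k R)
  have _ : IsScalarTower k R L := IsScalarTower.of_algebraMap_smul fun _ _ => rfl
  have _ : IsScalarTower k R L' := IsScalarTower.of_algebraMap_smul fun _ _ => rfl
  obtain ⟨l, -, β, -, hβ⟩ := h.exists_equiv
  obtain ⟨s, hs⟩ := exists_generalized_inverse (d.restrictScalars k)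
  let γ : L' →ₗ[k] k := l ∘ₗ f.restrictScalars k ∘ₗ s
  have hγ (x : L) : γ (d x) = l (f x) := by
    have h1 : d (s (d x) - x) = 0 := by
      rw [map_sub, sub_eq_zero]
      exact LinearMap.congr_fun hs x
    have h2 := hf _ h1
    rw [map_sub, sub_eq_zero] at h2
    exact congrArg l h2
  let g : L' →ₗ[k] R :=
    β.symm.toLinearMap ∘ₗ ((Algebra.lsmul k k L').toLinearMap.compr₂ γ).flip
  have hg (b : R) (y : L') : l (b * g y) = γ (b • y) := by
    rw [← hβ]
    exact LinearMap.congr_fun (β.apply_symm_apply _) b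
  have ext (r r' : R) (h : ∀ b, l (b * r) = l (b * r')) : r = r' :=
    β.injective (LinearMap.ext fun b => by rw [hβ, hβ, h])
  refine ⟨{ g with map_smul' := fun r y => ext _ _ fun b => ?_ }, LinearMap.ext fun x =>
    ext _ _ fun b => ?_⟩
  · change l (b * g (r • y)) = l (b * (r * g y))
    rw [hg, ← mul_assoc, hg, mul_smul]
  · change l (b * g (d x)) = l (b * f x)
    rw [hg, ← map_smul, hγ, map_smul, smul_eq_mul]

/-- A Frobenius algebra is self-injective. -/
theorem IsFrobenius.homExact (h : IsFrobenius k R) (C : ExactComplex.{w} R) {Q : Type*}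
    [AddCommGroup Q] [Module R Q] (hQ : FinRetract R R Q) : HomExact C Q := by
  refine HomExact.of_finRetract (fun a b c hab hbc f hf => ?_) hQ
  refine h.exists_factor _ f fun x hx => ?_
  obtain ⟨y, rfl⟩ := (C.exact a b c hab hbc x).1 hx
  exact LinearMap.congr_fun hf y

/-- The same correspondence turns the coordinates of a k-basis of M into R-linear maps M → R. Their
common kernel is zero because l(g i y) is the i-th coordinate of y. -/
theorem IsFrobenius.exists_embedding (h : IsFrobenius k R) (M : Type*) [AddCommGroup M]
    [Module R M] [Module.Finite R M] :
    ∃ (n : ℕ) (f : M →ₗ[R] (Fin n → R)), Function.Injective f := by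
  let _ : Module k M := Module.compHom M (algebraMap k R)
  have _ : IsScalarTower k R M := IsScalarTower.of_algebraMap_smul fun _ _ => rfl
  have _ : Module.Finite k M := Module.Finite.trans R M
  obtain ⟨l, -, β, -, hβ⟩ := h.exists_equiv
  let γ := (Module.finBasis k M).coord
  let g (i) : M →ₗ[k] R :=
    β.symm.toLinearMap ∘ₗ ((Algebra.lsmul k k M).toLinearMap.compr₂ (γ i)).flip
  have hg (i) (b : R) (y : M) : l (b * g i y) = γ i (b • y) := by
    rw [← hβ]
    exact LinearMap.congr_fun (β.apply_symm_apply _) b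
  have ext (r r' : R) (h : ∀ b, l (b * r) = l (b * r')) : r = r' :=
    β.injective (LinearMap.ext fun b => by rw [hβ, hβ, h])
  refine ⟨_, LinearMap.pi fun i => { g i with map_smul' := fun r y => ext _ _ fun b => ?_ }, ?_⟩
  · change l (b * g i (r • y)) = l (b * (r * g i y))
    rw [hg, ← mul_assoc, hg, mul_smul]
  · rw [injective_iff_map_eq_zero]
    intro y hy
    refine (Module.finBasis k M).ext_elem fun i => ?_
    have h1 : g i y = 0 := congrFun hy i
    have h2 := hg i 1 y
    rw [h1, mul_zero, map_zero, one_smul] at h2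
    rw [map_zero, Finsupp.zero_apply]
    exact h2.symm

end Frobenius

/-! ## Integrals and the Frobenius property of Hopf algebras -/

section Hopf

variable {k A : Type*} [Field k] [Ring A] [HopfAlgebra k A]

open Coalgebra HopfAlgebra

/-- The common pattern of the antipode identities below: move the coproduct to the left by
coassociativity, collapse it with f, and cancel the remaining counit. -/
theorem rTensor_assoc_symm_comul (f : A ⊗[k] A →ₗ[k] A)
    (hf : ∀ x, f (comul x) = algebraMap k A (counit x)) (a : A) :
    f.rTensor A ((TensorProduct.assoc k A A A).symm (comul.lTensor A (comul (R := k) a))) =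
      1 ⊗ₜ[k] a := by
  rw [Coalgebra.coassoc_symm_apply, ← LinearMap.comp_apply, ← LinearMap.rTensor_comp]
  have : f ∘ₗ comul = Algebra.linearMap k A ∘ₗ counit := LinearMap.ext hf
  rw [this, LinearMap.rTensor_comp, LinearMap.comp_apply, Coalgebra.rTensor_counit_comul]
  simp

theorem lTensor_assoc_comul (f : A ⊗[k] A →ₗ[k] A)
    (hf : ∀ x, f (comul x) = algebraMap k A (counit x)) (a : A) :
    f.lTensor A (TensorProduct.assoc k A A A (comul.rTensor A (comul (R := k) a))) =
      a ⊗ₜ[k] 1 := by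
  rw [Coalgebra.coassoc_apply, ← LinearMap.comp_apply, ← LinearMap.lTensor_comp]
  have : f ∘ₗ comul = Algebra.linearMap k A ∘ₗ counit := LinearMap.ext hf
  rw [this, LinearMap.lTensor_comp, LinearMap.comp_apply, Coalgebra.lTensor_counit_comul]
  simp

/-- `∑ S(a₁) a₂ ⊗ a₃ = 1 ⊗ a`. -/
theorem sum_antipode_mul_comul {ι : Type*} {a : A} (r : Repr k a ι) :
    ∑ i ∈ r.index, (antipode k (r.left i) ⊗ₜ[k] 1) * comul (r.right i) = (1 : A) ⊗ₜ[k] a := by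
  rw [← rTensor_assoc_symm_comul (LinearMap.mul' k A ∘ₗ (antipode k).rTensor A)
    (fun x => HopfAlgebra.mul_antipode_rTensor_comul_apply x), ← r.eq]
  simp only [map_sum, LinearMap.lTensor_tmul]
  refine Finset.sum_congr rfl fun i _ => ?_
  induction comul (R := k) (r.right i) using TensorProduct.induction_on with
  | zero => simp
  | tmul x y => simp
  | add x y hx hy => simp only [mul_add, TensorProduct.tmul_add, map_add, hx, hy]

/-- `∑ a₁ ⊗ a₂ S(a₃) = a ⊗ 1`. -/
theorem sum_comul_mul_antipode {ι : Type*} {a : A} (r : Repr k a ι) :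
    ∑ i ∈ r.index, comul (r.left i) * (1 ⊗ₜ[k] antipode k (r.right i)) = a ⊗ₜ[k] (1 : A) := by
  rw [← lTensor_assoc_comul (LinearMap.mul' k A ∘ₗ (antipode k).lTensor A)
    (fun x => HopfAlgebra.mul_antipode_lTensor_comul_apply x), ← r.eq]
  simp only [map_sum, LinearMap.rTensor_tmul]
  refine Finset.sum_congr rfl fun i _ => ?_
  induction comul (R := k) (r.left i) using TensorProduct.induction_on with
  | zero => simp
  | tmul x y => simp
  | add x y hx hy => simp only [add_mul, TensorProduct.add_tmul, map_add, hx, hy]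

/-- `∑ a₂ S⁻¹(a₁) ⊗ a₃ = 1 ⊗ a`. -/
theorem sum_comul_mul_antipode_inv {ι : Type*} {a : A} (r : Repr k a ι) (S' : A →ₗ[k] A)
    (hS' : ∀ x, antipode k (S' x) = x) (hS : Function.Injective (antipode k (A := A))) :
    ∑ i ∈ r.index, comul (r.right i) * (S' (r.left i) ⊗ₜ[k] 1) = (1 : A) ⊗ₜ[k] a := by
  rw [← rTensor_assoc_symm_comul (LinearMap.mul' k A ∘ₗ (TensorProduct.comm k A A).toLinearMap ∘ₗ
    S'.rTensor A) ?_, ← r.eq]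
  · simp only [map_sum, LinearMap.lTensor_tmul]
    refine Finset.sum_congr rfl fun i _ => ?_
    induction comul (R := k) (r.right i) using TensorProduct.induction_on with
    | zero => simp
    | tmul x y => simp
    | add x y hx hy => simp only [add_mul, TensorProduct.tmul_add, map_add, hx, hy]
  · intro x
    -- It suffices to compare after the antipode: S(x₂ S⁻¹(x₁)) = x₁ S(x₂), whose sum is the counit.
    apply hS
    have h1 : antipode k (algebraMap k A (counit x)) = algebraMap k A (counit x) :=
      MulOpposite.op_injective ((antipodeAlgHomOp k A).commutes (counit x))
    rw [h1, ← HopfAlgebra.mul_antipode_lTensor_comul_apply]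
    induction comul (R := k) x using TensorProduct.induction_on with
    | zero => simp
    | tmul y z =>
      simp [HopfAlgebra.antipode_mul_antidistrib, hS']
    | add y z hy hz => simp only [map_add, hy, hz]

/-- The dual space of `A` as a left `A`-module: `(a • f)(x) = f(S(a) x)`. -/
def HopfDual (k A : Type*) [Field k] [Ring A] [HopfAlgebra k A] : Type _ := Module.Dual k A

namespace HopfDual

instance : AddCommGroup (HopfDual k A) := inferInstanceAs (AddCommGroup (Module.Dual k A))
instance : Module k (HopfDual k A) := inferInstanceAs (Module k (Module.Dual k A))
instance [Module.Finite k A] : Module.Finite k (HopfDual k A) :=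
  inferInstanceAs (Module.Finite k (Module.Dual k A))

/-- The identity map onto the dual module. -/
def of : Module.Dual k A ≃ₗ[k] HopfDual k A := LinearEquiv.refl k _

instance : Module A (HopfDual k A) where
  smul a f := of (of.symm f ∘ₗ LinearMap.mulLeft k (antipode k a))
  one_smul f := LinearMap.ext fun x => by
    change of.symm f (antipode k 1 * x) = of.symm f x
    rw [antipode_one, one_mul]
  mul_smul a b f := LinearMap.ext fun x => by
    change of.symm f (antipode k (a * b) * x) = of.symm f (antipode k b * (antipode k a * x))
    rw [antipode_mul_antidistrib, mul_assoc]
  smul_zero a := LinearMap.ext fun x => rfl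
  smul_add a f g := LinearMap.ext fun x => rfl
  add_smul a b f := LinearMap.ext fun x => by
    change of.symm f (antipode k (a + b) * x) =
      of.symm f (antipode k a * x) + of.symm f (antipode k b * x)
    rw [map_add, add_mul, map_add]
  zero_smul f := LinearMap.ext fun x => by
    change of.symm f (antipode k 0 * x) = 0
    rw [map_zero, zero_mul, map_zero]

instance : IsScalarTower k A (HopfDual k A) where
  smul_assoc c a f := LinearMap.ext fun x => by
    change of.symm f (antipode k (c • a) * x) = c • of.symm f (antipode k a * x)
    rw [map_smul, smul_mul_assoc, map_smul]

end HopfDual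

/-! ### Freeness of diagonal tensor products with A -/

section Diagonal

variable {M N : Type*} [AddCommGroup M] [Module k M] [Module A M] [IsScalarTower k A M]
  [AddCommGroup N] [Module k N] [Module A N] [IsScalarTower k A N]

/-- Written as the image of Δ(a) under two orbit maps, the diagonal action lets identities in A ⊗ A
be transferred directly to modules. -/
theorem DiagTensor.smul_of_tmul (a : A) (m : M) (n : N) :
    a • DiagTensor.of k A M N (m ⊗ₜ[k] n) =
      DiagTensor.of k A M N (TensorProduct.map (orbitMap k A m) (orbitMap k A n) (comul a)) := by
  rw [DiagTensor.smul_of_tmul_eq_sum k A M N (Repr.arbitrary k a)]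
  conv_rhs => rw [← (Repr.arbitrary k a).eq]
  simp only [map_sum, TensorProduct.map_tmul, orbitMap_apply]

theorem map_orbitMap_mul (t : A ⊗[k] A) (x y : A) (m : M) (n : N) :
    TensorProduct.map (orbitMap k A m) (orbitMap k A n) (t * (x ⊗ₜ[k] y)) =
      TensorProduct.map (orbitMap k A (x • m)) (orbitMap k A (y • n)) t := by
  induction t using TensorProduct.induction_on with
  | zero => simp
  | tmul u v => simp [mul_smul]
  | add u v hu hv => rw [add_mul, map_add, map_add, hu, hv]

instance [Module.Finite k M] [Module.Finite k N] : Module.Finite k (DiagTensor k A M N) :=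
  inferInstanceAs (Module.Finite k (M ⊗[k] N))

variable (k A N) in
/-- The map `n ↦ 1 ⊗ n`. -/
def DiagTensor.inr : N →ₗ[k] DiagTensor k A A N :=
  (DiagTensor.of k A A N).toLinearMap ∘ₗ TensorProduct.mk k A N 1

variable (k A N) in
/-- The map `n ↦ n ⊗ 1`. -/
def DiagTensor.inl : N →ₗ[k] DiagTensor k A N A :=
  (DiagTensor.of k A N A).toLinearMap ∘ₗ (TensorProduct.mk k N A).flip 1

/-- The classical untwisting of A ⊗ N: c ⊗ n = ∑ c₁ • (1 ⊗ S(c₂) n). By dimension, A ⊗ N with the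
diagonal action is the free module on the space N. -/
theorem DiagTensor.extendScalars_inr_surjective :
    Function.Surjective (extendScalars (R := A) (DiagTensor.inr k A N)) := by
  rw [← LinearMap.range_eq_top, ← top_le_iff]
  rintro z -
  induction z using TensorProduct.induction_on with
  | zero => exact zero_mem _
  | tmul c n =>
    let r := Repr.arbitrary k c
    refine ⟨∑ i ∈ r.index, r.left i ⊗ₜ (antipode k (r.right i) • n), ?_⟩
    have h := congrArg ((DiagTensor.of k A A N).toLinearMap ∘ₗ
      TensorProduct.map (orbitMap k A (1 : A)) (orbitMap k A n)) (sum_comul_mul_antipode r)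
    simp only [map_sum, extendScalars_tmul, LinearMap.comp_apply, map_orbitMap_mul, one_smul] at h ⊢
    refine Eq.trans (Finset.sum_congr rfl fun i _ => ?_) (h.trans ?_)
    · exact DiagTensor.smul_of_tmul _ _ _
    · change DiagTensor.of k A A N ((c • 1) ⊗ₜ ((1 : A) • n)) = _
      rw [smul_eq_mul, mul_one, one_smul]
      rfl
  | add x y hx hy => exact add_mem hx hy

/-- On this side the inverse antipode is needed: n ⊗ c = ∑ c₂ • (S⁻¹(c₁) n ⊗ 1). -/
theorem DiagTensor.extendScalars_inl_surjective (S' : A →ₗ[k] A)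
    (hS' : ∀ x, antipode k (S' x) = x) (hS : Function.Injective (antipode k (A := A))) :
    Function.Surjective (extendScalars (R := A) (DiagTensor.inl k A N)) := by
  rw [← LinearMap.range_eq_top, ← top_le_iff]
  rintro z -
  induction z using TensorProduct.induction_on with
  | zero => exact zero_mem _
  | tmul n c =>
    let r := Repr.arbitrary k c
    refine ⟨∑ i ∈ r.index, r.right i ⊗ₜ (S' (r.left i) • n), ?_⟩
    have h := congrArg ((DiagTensor.of k A N A).toLinearMap ∘ₗ
      TensorProduct.map (orbitMap k A n) (orbitMap k A (1 : A))) (sum_comul_mul_antipode_inv r S' hS' hS)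
    simp only [map_sum, extendScalars_tmul, LinearMap.comp_apply, map_orbitMap_mul, one_smul] at h ⊢
    refine Eq.trans (Finset.sum_congr rfl fun i _ => ?_) (h.trans ?_)
    · exact DiagTensor.smul_of_tmul _ _ _
    · change DiagTensor.of k A N A (((1 : A) • n) ⊗ₜ (c • 1)) = _
      rw [smul_eq_mul, mul_one, one_smul]
      rfl
  | add x y hx hy => exact add_mem hx hy

variable (k A) [Module.Finite k A]

theorem DiagTensor.finrank_left [Module.Finite k N] :
    Module.finrank k (DiagTensor k A A N) = Module.finrank k A * Module.finrank k N :=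
  Module.finrank_tensorProduct

theorem DiagTensor.finrank_right [Module.Finite k N] :
    Module.finrank k (DiagTensor k A N A) = Module.finrank k A * Module.finrank k N :=
  Module.finrank_tensorProduct.trans (mul_comm _ _)

theorem DiagTensor.finRetract [Module.Finite k N] : FinRetract A A (DiagTensor k A A N) :=
  FinRetract.of_surjective (DiagTensor.inr k A N) (DiagTensor.finrank_left k A)
    DiagTensor.extendScalars_inr_surjective

end Diagonal

/-! ### Integrals, injectivity of the antipode and Frobenius forms -/

variable (k A)

variable [Module.Finite k A]

theorem one_ne_zero_of_hopf (k A : Type*) [Field k] [Ring A] [HopfAlgebra k A] : (1 : A) ≠ 0 := fun h =>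
  one_ne_zero ((Bialgebra.counit_one (R := k) (A := A)).symm.trans (by rw [h, map_zero]))

/-- A finite dimensional Hopf algebra has a nonzero left integral. -/
theorem exists_integral : ∃ t : A, t ≠ 0 ∧ ∀ a : A, a * t = counit (R := k) a • t := by
  -- Under A ⊗ A* ≅ End(A), an element a acts by φ ↦ ∑ a₁ φ(S(a₂) ·). Hence the identity, which
  -- corresponds to z, is invariant: ∑ a₁ S(a₂) x = ε(a) x.
  let E : A ⊗[k] Module.Dual k A ≃ₗ[k] (A →ₗ[k] A) :=
    (TensorProduct.comm k A _).trans (dualTensorHomEquiv k A A)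
  have hE (a : A) (f : Module.Dual k A) (x : A) : E (a ⊗ₜ f) x = f x • a := by
    simp [E]
  let z : DiagTensor k A A (HopfDual k A) := DiagTensor.of k A A (HopfDual k A) (E.symm LinearMap.id)
  have hz : z ≠ 0 := fun h => by
    have h1 : E.symm LinearMap.id = 0 := h
    have h2 := LinearMap.congr_fun ((LinearEquiv.map_eq_zero_iff _).1 h1) (1 : A)
    exact one_ne_zero_of_hopf k A h2
  have key (a : A) (t : A ⊗[k] Module.Dual k A) (x : A) :
      E (show A ⊗[k] Module.Dual k A from a • DiagTensor.of k A A (HopfDual k A) t) x =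
        ∑ i ∈ (Repr.arbitrary k a).index, (Repr.arbitrary k a).left i *
          E t (antipode k ((Repr.arbitrary k a).right i) * x) := by
    induction t using TensorProduct.induction_on with
    | zero =>
      simp only [map_zero, LinearMap.zero_apply, mul_zero, Finset.sum_const_zero]
      exact LinearMap.congr_fun
        ((congrArg E (smul_zero (A := DiagTensor k A A (HopfDual k A)) a)).trans (map_zero E)) x
    | tmul b f =>
      have h := DiagTensor.smul_of_tmul_eq_sum k A A (HopfDual k A) (Repr.arbitrary k a) b f
      refine (LinearMap.congr_fun (congrArg E h) x).trans ?_
      refine (LinearMap.congr_fun (map_sum E _ _) x).trans ?_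
      rw [LinearMap.sum_apply]
      refine Finset.sum_congr rfl fun i _ => ?_
      refine (hE _ _ x).trans ?_
      rw [hE, mul_smul_comm]
      rfl
    | add s t hs ht =>
      simp only [map_add, LinearMap.add_apply, mul_add, Finset.sum_add_distrib, ← hs, ← ht]
      exact LinearMap.congr_fun ((congrArg E (smul_add (A := DiagTensor k A A (HopfDual k A)) a
        _ _)).trans (map_add E _ _)) x
  have hinv (a : A) : a • z = counit (R := k) a • z := by
    refine E.injective (LinearMap.ext fun x => ?_)
    refine (key a (E.symm LinearMap.id) x).trans ?_
    rw [E.apply_symm_apply]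
    simp only [LinearMap.id_apply, ← mul_assoc, ← Finset.sum_mul]
    rw [HopfAlgebra.sum_mul_antipode_eq_algebraMap_counit, ← Algebra.smul_def]
    have h2 : E (counit (R := k) a • E.symm LinearMap.id) x = counit (R := k) a • x := by
      rw [map_smul, E.apply_symm_apply]
      rfl
    exact h2.symm
  -- The module containing z is a retract of a power of A, so some linear coordinate of z in A is
  -- nonzero. It inherits invariance, hence is a left integral.
  obtain ⟨s, _, i, r, h⟩ := DiagTensor.finRetract k A (N := HopfDual k A)
  have : ∃ y, i y z ≠ 0 := by
    by_contra! h0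
    apply hz
    have := LinearMap.congr_fun h z
    simpa [h0] using this.symm
  obtain ⟨y, hy⟩ := this
  refine ⟨i y z, hy, fun a => ?_⟩
  rw [← smul_eq_mul, ← map_smul, hinv, ← IsScalarTower.algebraMap_smul A, map_smul,
    IsScalarTower.algebraMap_smul]

variable {k A} in
/-- For a left integral `t`, `∑ t₁ ⊗ a t₂ = ∑ S(a) t₁ ⊗ t₂`. -/
theorem tmul_mul_comul_integral {t : A} (ht : ∀ a : A, a * t = counit (R := k) a • t) (a : A) :
    ((1 : A) ⊗ₜ[k] a) * comul t = (antipode k a ⊗ₜ[k] 1) * comul t := by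
  let r := Repr.arbitrary k a
  -- After 1 ⊗ a is replaced by ∑ S(a₁) a₂ ⊗ a₃, the factor Δ(a₂) Δ(t) equals ε(a₂) Δ(t), and the
  -- counit is absorbed into S(a₁).
  rw [← sum_antipode_mul_comul r, Finset.sum_mul]
  have h := congrArg (TensorProduct.rid k A) (Coalgebra.sum_tmul_counit_eq r)
  simp only [map_sum, TensorProduct.rid_tmul, one_smul] at h
  rw [← congrArg (antipode k) h, map_sum, TensorProduct.sum_tmul, Finset.sum_mul]
  refine Finset.sum_congr rfl fun i _ => ?_
  rw [mul_assoc, ← Bialgebra.comul_mul, ht, map_smul, map_smul, mul_smul_comm,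
    ← TensorProduct.smul_tmul', smul_mul_assoc]

/-- Everything follows from injectivity of ψ(f) = ∑ t₁ f(t₂) for a nonzero left integral t, together
with ψ(f(a ·)) = S(a) ψ(f). If S(a) = 0, then f(a ·) = 0 for all f, so a = 0. By dimension ψ is
onto, and a form l with ψ(l) = 1 is Frobenius: l(a ·) = 0 gives S(a) = 0. -/
theorem frobenius_aux : Function.Injective (antipode k (A := A)) ∧ IsFrobenius k A := by
  obtain ⟨t, ht0, ht⟩ := exists_integral k A
  let c (f : Module.Dual k A) : A ⊗[k] A →ₗ[k] A :=
    (TensorProduct.rid k A).toLinearMap ∘ₗ f.lTensor A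
  let ψ : Module.Dual k A →ₗ[k] A :=
    { toFun := fun f => c f (comul t)
      map_add' := fun f g => by simp [c, LinearMap.lTensor_add]
      map_smul' := fun r f => by simp [c, LinearMap.lTensor_smul] }
  have hψL (f : Module.Dual k A) (a : A) :
      ψ (f ∘ₗ LinearMap.mulLeft k a) = antipode k a * ψ f := by
    have h1 : c (f ∘ₗ LinearMap.mulLeft k a) (comul t) = c f ((1 ⊗ₜ a) * comul t) := by
      induction comul (R := k) t using TensorProduct.induction_on with
      | zero => simp
      | tmul x y => simp [c]
      | add x y hx hy => rw [map_add, mul_add, map_add, hx, hy]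
    change c (f ∘ₗ LinearMap.mulLeft k a) (comul t) = antipode k a * c f (comul t)
    rw [h1, tmul_mul_comul_integral ht]
    induction comul (R := k) t using TensorProduct.induction_on with
    | zero => simp
    | tmul x y => simp [c]
    | add x y hx hy => rw [mul_add, map_add, map_add, mul_add, hx, hy]
  let conv (g f : Module.Dual k A) : Module.Dual k A :=
    LinearMap.mul' k k ∘ₗ TensorProduct.map g f ∘ₗ comul
  have hconv (g f : Module.Dual k A) : ψ (conv g f) = c g (comul (ψ f)) := by
    let W : A ⊗[k] (A ⊗[k] A) →ₗ[k] A := (TensorProduct.rid k A).toLinearMap ∘ₗ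
      (LinearMap.mul' k k ∘ₗ TensorProduct.map g f).lTensor A
    have h1 : ψ (conv g f) = W (comul.lTensor A (comul t)) := by
      change c (conv g f) (comul t) = _
      induction comul (R := k) t using TensorProduct.induction_on with
      | zero => simp
      | tmul x y => simp [c, W, conv]
      | add x y hx hy => simp only [map_add, hx, hy]
    rw [h1, ← Coalgebra.coassoc_apply]
    change _ = c g (comul (c f (comul t)))
    induction comul (R := k) t using TensorProduct.induction_on with
    | zero => simp
    | tmul x y =>
      have h2 : c f (x ⊗ₜ y) = f y • x := by simp [c]
      rw [h2, map_smul, map_smul, LinearMap.rTensor_tmul]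
      induction comul (R := k) x using TensorProduct.induction_on with
      | zero => simp
      | tmul u v => simp [c, W, mul_smul, smul_comm (f y)]
      | add x y hx hy => simp only [TensorProduct.add_tmul, map_add, hx, hy, smul_add]
    | add x y hx hy => simp only [map_add, hx, hy]
  let b := Module.finBasis k A
  -- At x, the left side is ∑ f(S(x₁) x₂), with x₁ expanded in the basis b. Applying ψ expresses
  -- f(1) t through the elements S(S(bᵢ)) ψ(f), so ψ(f) = 0 forces f(1) = 0.
  have hsum (f : Module.Dual k A) :
      ∑ i, conv (b.coord i) (f ∘ₗ LinearMap.mulLeft k (antipode k (b i))) =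
        f 1 • (counit : A →ₗ[k] k) := by
    refine LinearMap.ext fun x => ?_
    have h1 : f (LinearMap.mul' k A ((antipode k).rTensor A (comul x))) = f 1 * counit x := by
      rw [HopfAlgebra.mul_antipode_rTensor_comul_apply, Algebra.algebraMap_eq_smul_one, map_smul,
        smul_eq_mul, mul_comm]
    rw [LinearMap.smul_apply, smul_eq_mul, ← h1, LinearMap.sum_apply]
    simp only [conv, LinearMap.comp_apply]
    induction comul (R := k) x using TensorProduct.induction_on with
    | zero => simp
    | tmul u v =>
      simp only [TensorProduct.map_tmul, LinearMap.mul'_apply, LinearMap.comp_apply,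
        LinearMap.mulLeft_apply, LinearMap.rTensor_tmul]
      conv_rhs => rw [← b.sum_repr u]
      simp only [map_sum, map_smul, Finset.sum_mul, smul_mul_assoc]
      rfl
    | add u v hu hv => simp only [map_add, Finset.sum_add_distrib, hu, hv]
  have hK1 (f : Module.Dual k A) (hf : ψ f = 0) : f 1 = 0 := by
    have h1 := congrArg ψ (hsum f)
    simp only [map_sum, hconv, hψL, hf, mul_zero, map_zero, Finset.sum_const_zero] at h1
    rw [map_smul] at h1
    have h2 : ψ counit = t := by
      change c counit (comul t) = t
      simp [c]
    rw [h2] at h1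
    exact (smul_eq_zero.1 h1.symm).resolve_right ht0
  -- The kernel of ψ is stable under f ↦ f(a ·), so vanishing at 1 becomes vanishing everywhere.
  have hK (f : Module.Dual k A) (hf : ψ f = 0) : f = 0 := LinearMap.ext fun a => by
    have := hK1 (f ∘ₗ LinearMap.mulLeft k a) (by rw [hψL, hf, mul_zero])
    simpa using this
  have hinj : Function.Injective ψ := (injective_iff_map_eq_zero ψ).2 hK
  have hS (a : A) (ha : antipode k a = 0) : a = 0 := by
    rw [← Module.forall_dual_apply_eq_zero_iff k]
    intro f
    have h1 := hK (f ∘ₗ LinearMap.mulLeft k a) (by rw [hψL, ha, zero_mul])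
    simpa using LinearMap.congr_fun h1 1
  have hsurj := (LinearMap.injective_iff_surjective_of_finrank_eq_finrank (f := ψ)
    Subspace.dual_finrank_eq).1 hinj
  obtain ⟨l, hl⟩ := hsurj 1
  refine ⟨(injective_iff_map_eq_zero _).2 hS, l, fun a ha => hS a ?_⟩
  have h1 : l ∘ₗ LinearMap.mulLeft k a = 0 := LinearMap.ext ha
  rw [← mul_one (antipode k a), ← hl, ← hψL, h1, map_zero]

/-- The antipode of a finite dimensional Hopf algebra is injective. -/
theorem antipode_injective : Function.Injective (antipode k (A := A)) := (frobenius_aux k A).1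

/-- A finite dimensional Hopf algebra is a Frobenius algebra. -/
theorem isFrobenius_hopf : IsFrobenius k A := (frobenius_aux k A).2

theorem exists_antipode_inv : ∃ S' : A →ₗ[k] A, ∀ x, antipode k (S' x) = x := by
  let e := LinearEquiv.ofInjectiveEndo (antipode k (A := A)) (antipode_injective k A)
  exact ⟨e.symm.toLinearMap, e.apply_symm_apply⟩

instance : Module.Finite k (Env k A) := inferInstanceAs (Module.Finite k (A ⊗[k] Aᵐᵒᵖ))

theorem isFrobenius_env : IsFrobenius k (Env k A) :=
  (isFrobenius_hopf k A).tensor (isFrobenius_hopf k A).mulOpposite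

end Hopf
end
end TateHopf

namespace TateHopf
noncomputable section

/-! ## Existence of complete resolutions -/

section Existence

/-- A homomorphism between finite free modules. -/
structure FreeHom (R : Type*) [Ring R] where
  src : ℕ
  tgt : ℕ
  map : (Fin src → R) →ₗ[R] (Fin tgt → R)

variable {R : Type v} [Ring R]

/-- The identification of free modules of equal rank. -/
def finCastHom {m n : ℕ} (h : m = n) : (Fin m → R) →ₗ[R] (Fin n → R) :=
  LinearMap.funLeft R R (Fin.cast h.symm)

theorem finCastHom_bijective {m n : ℕ} (h : m = n) :
    Function.Bijective (finCastHom (R := R) h) := by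
  subst h
  exact Function.bijective_id

/-- The object in position i is the differential leaving degree i, so its source is the term of
degree i. Consecutive ranks agree only propositionally, hence `finCastHom`. Of the initial map only
the kernel is recorded, which is all that the augmentation requires. -/
theorem exists_free_complex (s₀ : FreeHom R)
    (up : ∀ s : FreeHom R, ∃ t : FreeHom R, ∃ h : t.tgt = s.src,
      Function.Exact (finCastHom h ∘ₗ t.map) s.map)
    (down : ∀ t : FreeHom R, ∃ s : FreeHom R, ∃ h : t.tgt = s.src,
      Function.Exact (finCastHom h ∘ₗ t.map) s.map) :
    ∃ (m : ℤ → ℕ) (d : ∀ i j, (Fin (m i) → R) →ₗ[R] (Fin (m j) → R)) (h : s₀.src = m 0),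
      (∀ i j, j + 1 ≠ i → d i j = 0) ∧
      (∀ a b c, b + 1 = a → c + 1 = b → Function.Exact (d a b) (d b c)) ∧
      ∀ x, d 0 (-1) (finCastHom h x) = 0 ↔ s₀.map x = 0 := by
  obtain ⟨f, rfl, hf⟩ := exists_int_sequence (S := fun _ => FreeHom R)
    (fun _ s t => ∃ h : t.tgt = s.src, Function.Exact (finCastHom h ∘ₗ t.map) s.map)
    (fun _ => up) (fun _ => down) s₀
  choose h hf using hf
  let D (i : ℤ) : (Fin (f (i + 1)).src → R) →ₗ[R] (Fin (f i).src → R) :=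
    finCastHom (h i) ∘ₗ (f (i + 1)).map
  let d (i j : ℤ) : (Fin (f i).src → R) →ₗ[R] (Fin (f j).src → R) :=
    if h : j + 1 = i then D j ∘ₗ finCastHom (by rw [h]) else 0
  have hd (j : ℤ) (x) : d (j + 1) j x = D j x := by
    simp only [d, dif_pos]
    rfl
  have hD (j : ℤ) (x) : D j x = 0 ↔ (f (j + 1)).map x = 0 :=
    (map_eq_zero_iff _ (finCastHom_bijective (h j)).1)
  refine ⟨fun i => (f i).src, d, rfl, fun i j hij => dif_neg hij, ?_, fun x => ?_⟩
  · rintro a b c rfl rfl x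
    rw [hd, hD, hf (c + 1) x]
    refine exists_congr fun y => ?_
    rw [hd]
  · have key : ∀ i j (_ : j + 1 = i) x, d i j x = 0 ↔ (f i).map x = 0 := by
      rintro i j rfl x
      rw [hd, hD]
    exact key 0 (-1) rfl x

/-- A finitely generated module over a Frobenius algebra has a complete resolution. -/
theorem IsFrobenius.nonempty_completeResolution {k : Type*} [Field k] [Algebra k R]
    [Module.Finite k R] (hR : IsFrobenius k R) (M : Type*) [AddCommGroup M] [Module R M]
    [Module.Finite R M] : Nonempty (CompleteResolution.{v} k R M) := by
  have : IsNoetherianRing R := isNoetherian_of_tower k inferInstance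
  obtain ⟨m, ε, hε⟩ := Module.Finite.exists_fin' R M
  obtain ⟨n, η, hη⟩ := hR.exists_embedding M
  -- The differential from degree 0 is built on a free cover of M followed by an embedding of M into
  -- a free module. Its kernel is that of the cover, so the cover serves as augmentation.
  obtain ⟨r, d, h, hd, hex, h₀⟩ := exists_free_complex (⟨m, n, η ∘ₗ ε⟩ : FreeHom R)
    (fun s => by
      obtain ⟨l, f, hf⟩ := Module.Finite.exists_fin' R (LinearMap.ker s.map)
      refine ⟨⟨l, s.src, (LinearMap.ker s.map).subtype ∘ₗ f⟩, rfl, fun x => ?_⟩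
      refine ⟨fun hx => ?_, ?_⟩
      · obtain ⟨y, hy⟩ := hf ⟨x, hx⟩
        exact ⟨y, congrArg Subtype.val hy⟩
      · rintro ⟨y, rfl⟩
        exact (f y).2)
    (fun t => by
      obtain ⟨l, f, hf⟩ := hR.exists_embedding ((Fin t.tgt → R) ⧸ LinearMap.range t.map)
      refine ⟨⟨t.tgt, l, f ∘ₗ (LinearMap.range t.map).mkQ⟩, rfl, fun x => ?_⟩
      refine Iff.trans (map_eq_zero_iff f hf) ?_
      exact Submodule.Quotient.mk_eq_zero _)
  let C : ExactComplex.{v} R := { X := fun i => Fin (r i) → R, d := d, exact := hex }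
  let e := LinearEquiv.ofBijective _ (finCastHom_bijective (R := R) h)
  refine ⟨{ X := C.X, d := d, shape := hd
            moduleBase := fun i => inferInstanceAs (Module k (Fin (r i) → R))
            isScalarTower := fun i => inferInstanceAs (IsScalarTower k R (Fin (r i) → R))
            finite := fun i => inferInstanceAs (Module.Finite R (Fin (r i) → R))
            projective := fun i => inferInstanceAs (Module.Projective R (Fin (r i) → R))
            exact := fun i => hex _ _ _ rfl (sub_add_cancel i 1)
            dual_exact := fun i f hf => hR.homExact C
              (FinRetract.of_linearEquiv (LinearEquiv.refl R R)) _ _ _ rfl (sub_add_cancel i 1) f hf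
            ε := ε ∘ₗ e.symm.toLinearMap
            ε_surjective := hε.comp e.symm.surjective
            ε_exact := fun x => ?_ }⟩
  obtain ⟨x, rfl⟩ := e.surjective x
  refine Iff.trans ?_ (hex 1 0 (-1) rfl rfl (e x))
  refine Iff.trans ?_ (h₀ x).symm
  refine Iff.trans ?_ (map_eq_zero_iff η hη).symm
  simp

variable (k : Type u) (A : Type v) [Field k] [Ring A] [HopfAlgebra k A] [Module.Finite k A]

theorem nonempty_completeResolution_trivial :
    Nonempty (CompleteResolution.{v} k A (TrivialModule k A)) := by
  have : Module.Finite k (TrivialModule k A) := inferInstanceAs (Module.Finite k k)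
  have : Module.Finite A (TrivialModule k A) := Module.Finite.of_restrictScalars_finite k A _
  exact (isFrobenius_hopf k A).nonempty_completeResolution _

theorem nonempty_completeResolution_regular :
    Nonempty (CompleteResolution.{v} k (Env k A) (RegularBimodule k A)) := by
  have : Module.Finite k (RegularBimodule k A) := inferInstanceAs (Module.Finite k A)
  have : Module.Finite (Env k A) (RegularBimodule k A) :=
    Module.Finite.of_restrictScalars_finite k (Env k A) _
  exact (isFrobenius_env k A).nonempty_completeResolution _

end Existence
end
end TateHopf

namespace TateHopf
noncomputable section

/-! ## Contractions of induced complexes -/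

section Contractions

variable {k R : Type*} [Field k] [Ring R] [Algebra k R]

/-- A contraction of the complex `(V, d)`. -/
def IsContraction {V : ℤ → Type*} [∀ i, AddCommGroup (V i)] (d s : ∀ i j, V i → V j) : Prop :=
  ∀ a b c, b + 1 = a → c + 1 = b → ∀ x, d a b (s b a x) + s c b (d b c x) = x

/-- The complex of `R`-modules `R ⊗ V` induced from a contractible complex is contractible. -/
theorem exists_contraction_of_induced {V : ℤ → Type*} [∀ i, AddCommGroup (V i)]
    [∀ i, Module k (V i)] (d h : ∀ i j, V i →ₗ[k] V j)
    (hh : IsContraction (fun i j => d i j) (fun i j => h i j)) {G : ℤ → Type*}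
    [∀ i, AddCommGroup (G i)] [∀ i, Module k (G i)] [∀ i, Module R (G i)]
    [∀ i, IsScalarTower k R (G i)] (j : ∀ i, V i →ₗ[k] G i) (D : ∀ i j, G i →ₗ[R] G j)
    (hj : ∀ a b x, D a b (j a x) = j b (d a b x))
    (hb : ∀ i, Function.Bijective (extendScalars (R := R) (j i))) :
    ∃ s : ∀ i j, G i →ₗ[R] G j, IsContraction (fun i j => D i j) (fun i j => s i j) := by
  let κ (i : ℤ) := LinearEquiv.ofBijective _ (hb i)
  have hκ (i : ℤ) (r : R) (v : V i) : (κ i).symm (r • j i v) = r ⊗ₜ v :=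
    (κ i).symm_apply_eq.2 rfl
  refine ⟨fun a b => extendScalars (j b ∘ₗ h a b) ∘ₗ (κ a).symm.toLinearMap, ?_⟩
  intro a b c hab hbc x
  obtain ⟨y, rfl⟩ := (hb b).2 x
  induction y using TensorProduct.induction_on with
  | zero => simp
  | tmul r v =>
    have h1 := congrArg (fun v => r • j b v) (hh a b c hab hbc v)
    simp only [map_add, smul_add, ← hj] at h1
    simp only [LinearMap.comp_apply, LinearEquiv.coe_coe, extendScalars_tmul]
    rw [hκ, map_smul (D b c), hj, hκ, extendScalars_tmul, extendScalars_tmul, map_smul]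
    exact h1
  | add x y hx hy =>
    simp only [map_add] at hx hy ⊢
    rw [add_add_add_comm, hx, hy]

theorem exists_contraction_of_retract {G G' : ℤ → Type*} [∀ i, AddCommGroup (G i)]
    [∀ i, Module R (G i)] [∀ i, AddCommGroup (G' i)] [∀ i, Module R (G' i)]
    (D s : ∀ i j, G i →ₗ[R] G j) (hs : IsContraction (fun i j => D i j) (fun i j => s i j))
    (D' : ∀ i j, G' i →ₗ[R] G' j) {σ : Type*} [Fintype σ] (i : σ → ∀ n, G' n →ₗ[R] G n)
    (r : σ → ∀ n, G n →ₗ[R] G' n) (hi : ∀ t a b x, D a b (i t a x) = i t b (D' a b x))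
    (hr : ∀ t a b x, D' a b (r t a x) = r t b (D a b x)) (h : ∀ n x, ∑ t, r t n (i t n x) = x) :
    ∃ s : ∀ i j, G' i →ₗ[R] G' j, IsContraction (fun i j => D' i j) (fun i j => s i j) := by
  refine ⟨fun a b => ∑ t, r t b ∘ₗ s a b ∘ₗ i t a, ?_⟩
  intro a b c hab hbc x
  conv_rhs => rw [← h b x]
  simp only [LinearMap.sum_apply, LinearMap.comp_apply, map_sum, hr, ← hi,
    ← Finset.sum_add_distrib, ← map_add]
  exact Finset.sum_congr rfl fun t _ => congrArg _ (hs a b c hab hbc _)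

/-- Linear contractibility makes Hom(M, -) exact for arbitrary M. This is what the zigzag in
`DoubleComplex.exists_chainMap_tot` uses, with M the trivial module or the regular bimodule. -/
theorem IsContraction.exists_lift {G : ℤ → Type*} [∀ i, AddCommGroup (G i)]
    [∀ i, Module R (G i)] {D s : ∀ i j, G i →ₗ[R] G j}
    (hs : IsContraction (fun i j => D i j) (fun i j => s i j)) {M : Type*} [AddCommGroup M]
    [Module R M] {a b c : ℤ} (hab : b + 1 = a) (hbc : c + 1 = b) (z : M →ₗ[R] G b)
    (hz : D b c ∘ₗ z = 0) : ∃ z' : M →ₗ[R] G a, D a b ∘ₗ z' = z := by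
  refine ⟨s b a ∘ₗ z, LinearMap.ext fun m => ?_⟩
  have h1 := hs a b c hab hbc (z m)
  have h2 : D b c (z m) = 0 := LinearMap.congr_fun hz m
  simp only [h2, map_zero, add_zero] at h1
  exact h1

namespace CompleteResolution

variable {M : Type*} [AddCommGroup M] [Module R M] (P : CompleteResolution.{w} k R M)

theorem exists_contraction : ∃ h : ∀ i j, P.X i →ₗ[k] P.X j,
    IsContraction (fun i j => P.d i j) (fun i j => h i j) :=
  ExactComplex.exists_contraction (R := k)
    { X := P.X, d := fun i j => (P.d i j).restrictScalars k, exact := P.toExactComplex.exact }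
    fun a b _ => exists_generalized_inverse ((P.d a b).restrictScalars k)

/-- The inclusion of `M` into the term of degree `-1`. -/
theorem exists_coaugmentation : ∃ η : M →ₗ[R] P.X (-1), Function.Injective η ∧
    ∀ x, η (P.ε x) = P.d 0 (-1) x := by
  have h (x : P.X 0) : P.ε x = 0 ↔ P.d 0 (-1) x = 0 :=
    (P.ε_exact x).trans (P.toExactComplex.exact 1 0 (-1) rfl rfl x).symm
  let e := P.ε.quotKerEquivOfSurjective P.ε_surjective
  let q := (LinearMap.ker P.ε).liftQ (P.d 0 (-1)) fun x hx => (h x).1 hx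
  have hq (x : P.X 0) : q (e.symm (P.ε x)) = P.d 0 (-1) x := by
    have : e.symm (P.ε x) = Submodule.Quotient.mk x := e.symm_apply_eq.2 rfl
    rw [this]
    rfl
  refine ⟨q ∘ₗ e.symm.toLinearMap, ?_, hq⟩
  rw [injective_iff_map_eq_zero]
  intro m hm
  obtain ⟨x, rfl⟩ := P.ε_surjective m
  exact (h x).2 ((hq x).symm.trans hm)

theorem ε_comp_d : P.ε ∘ₗ P.d 1 0 = 0 :=
  LinearMap.ext fun x => P.ε_exact.apply_apply_eq_zero x

theorem finRetract (i : ℤ) : FinRetract R R (P.X i) := FinRetract.of_projective _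

theorem finite_base [Module.Finite k R] (i : ℤ) : Module.Finite k (P.X i) :=
  Module.Finite.trans R _

end CompleteResolution

end Contractions

/-! ## Existence of diagonal approximations -/

section DiagonalTensor

open Coalgebra

variable {k A : Type*} [Field k] [Ring A] [HopfAlgebra k A]
variable {M N L : Type*} [AddCommGroup M] [Module k M] [Module A M] [IsScalarTower k A M]
  [AddCommGroup N] [Module k N] [Module A N] [IsScalarTower k A N]
  [AddCommGroup L] [Module k L] [Module A L] [IsScalarTower k A L]

namespace DiagTensor

theorem induction_on {p : DiagTensor k A M N → Prop} (x : DiagTensor k A M N) (zero : p 0)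
    (tmul : ∀ m n, p (DiagTensor.of k A M N (m ⊗ₜ n))) (add : ∀ x y, p x → p y → p (x + y)) :
    p x :=
  TensorProduct.induction_on (motive := fun t => p (DiagTensor.of k A M N t)) x zero tmul
    fun _ _ => add _ _

theorem hom_ext {Q : Type*} [AddCommGroup Q] [Module A Q] {φ ψ : DiagTensor k A M N →ₗ[A] Q}
    (h : ∀ m n, φ (DiagTensor.of k A M N (m ⊗ₜ n)) = ψ (DiagTensor.of k A M N (m ⊗ₜ n))) :
    φ = ψ := by
  refine LinearMap.ext fun x => induction_on (p := fun x => φ x = ψ x) x ?_ h fun x y hx hy => ?_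
  · rw [map_zero, map_zero]
  · rw [map_add, map_add, hx, hy]

/-- The `A`-linear map out of `M ⊗ N` given by a bilinear map `f` with
`∑ f(a₁ m, a₂ n) = a f(m, n)`. -/
def lift (f : M →ₗ[k] N →ₗ[k] L)
    (hf : ∀ (a : A) m n, ∑ i ∈ (Repr.arbitrary k a).index,
      f ((Repr.arbitrary k a).left i • m) ((Repr.arbitrary k a).right i • n) = a • f m n) :
    DiagTensor k A M N →ₗ[A] L where
  toFun t := TensorProduct.lift f ((DiagTensor.of k A M N).symm t)
  map_add' x y := by rw [map_add, map_add]
  map_smul' a x := by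
    induction x using DiagTensor.induction_on with
    | zero => rw [smul_zero, map_zero, map_zero, smul_zero]
    | tmul m n =>
      rw [DiagTensor.smul_of_tmul_eq_sum k A M N (Repr.arbitrary k a),
        LinearEquiv.symm_apply_apply, LinearEquiv.symm_apply_apply, map_sum]
      exact hf a m n
    | add x y hx hy =>
      simp only [smul_add, map_add, hx, hy]

variable (k A N) in
/-- The isomorphism `k ⊗ N ≅ N` as a homomorphism of `A`-modules. -/
def lid : DiagTensor k A (TrivialModule k A) N →ₗ[A] N :=
  lift (LinearMap.lsmul k N ∘ₗ (TrivialModule.of k A).symm.toLinearMap) (by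
    intro a r n
    have h := congrArg (fun x => (TrivialModule.of k A).symm r • orbitMap k A n x)
      (Coalgebra.sum_counit_smul (Repr.arbitrary k a))
    simp only [map_sum, map_smul, orbitMap_apply, Finset.smul_sum] at h
    refine Eq.trans (Finset.sum_congr rfl fun i _ => ?_) (h.trans ?_)
    · exact (mul_smul _ _ _).trans (smul_comm _ _ _)
    · exact smul_comm _ _ _)

theorem lid_of_tmul (r : TrivialModule k A) (n : N) :
    lid k A N (DiagTensor.of k A _ N (r ⊗ₜ n)) = (TrivialModule.of k A).symm r • n := rfl

variable (N) in
theorem sum_map_left {Q B : Type*} [AddCommGroup Q] [Module k Q] [Module A Q]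
    [IsScalarTower k A Q] [AddCommGroup B] [Module k B] [Module A B] [IsScalarTower k A B]
    {s : Type*} [Fintype s] {i : s → Q →ₗ[A] B} {r : s → B →ₗ[A] Q}
    (h : ∑ x, r x ∘ₗ i x = LinearMap.id) (z : DiagTensor k A Q N) :
    ∑ x, DiagTensor.map (r x) (LinearMap.id (M := N))
      (DiagTensor.map (i x) (LinearMap.id (M := N)) z) = z := by
  induction z using DiagTensor.induction_on with
  | zero => simp
  | tmul m n =>
    simp only [DiagTensor.map_of_tmul, LinearMap.id_apply, ← map_sum, ← TensorProduct.sum_tmul]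
    have := LinearMap.congr_fun h m
    simp only [LinearMap.sum_apply, LinearMap.comp_apply, LinearMap.id_apply] at this
    rw [this]
  | add x y hx hy => simp only [map_add, Finset.sum_add_distrib, hx, hy]

variable (N) in
theorem sum_map_right {Q B : Type*} [AddCommGroup Q] [Module k Q] [Module A Q]
    [IsScalarTower k A Q] [AddCommGroup B] [Module k B] [Module A B] [IsScalarTower k A B]
    {s : Type*} [Fintype s] {i : s → Q →ₗ[A] B} {r : s → B →ₗ[A] Q}
    (h : ∑ x, r x ∘ₗ i x = LinearMap.id) (z : DiagTensor k A N Q) :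
    ∑ x, DiagTensor.map (LinearMap.id (M := N)) (r x)
      (DiagTensor.map (LinearMap.id (M := N)) (i x) z) = z := by
  induction z using DiagTensor.induction_on with
  | zero => simp
  | tmul m n =>
    simp only [DiagTensor.map_of_tmul, LinearMap.id_apply, ← map_sum, ← TensorProduct.tmul_sum]
    have := LinearMap.congr_fun h n
    simp only [LinearMap.sum_apply, LinearMap.comp_apply, LinearMap.id_apply] at this
    rw [this]
  | add x y hx hy => simp only [map_add, Finset.sum_add_distrib, hx, hy]

variable (k N) in
-- Tensoring with N preserves retracts, so the case Q = A, where the tensor product is free,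
-- suffices.
theorem finRetract_left [Module.Finite k A] [Module.Finite k N] {Q : Type*} [AddCommGroup Q]
    [Module k Q] [Module A Q] [IsScalarTower k A Q] (h : FinRetract A A Q) :
    FinRetract A A (DiagTensor k A Q N) := by
  refine (DiagTensor.finRetract k A).trans (Q := DiagTensor k A A N) ?_
  obtain ⟨s, _, i, r, h⟩ := h
  refine ⟨s, inferInstance, fun x => DiagTensor.map (i x) LinearMap.id,
    fun x => DiagTensor.map (r x) LinearMap.id, LinearMap.ext fun z => ?_⟩
  simpa using sum_map_left N h z

end DiagTensor

variable [Module.Finite k A] (P : CompleteResolution.{w} k A (TrivialModule k A))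

/-- The double complex `P ⊗ P`. -/
@[reducible] def diagDoubleComplex : DoubleComplex.{w} A where
  X i j := DiagTensor k A (P.X i) (P.X j)
  d₁ i i' j := DiagTensor.map (P.d i i') LinearMap.id
  d₂ i j j' := DiagTensor.map LinearMap.id (P.d j j')
  comm i i' j j' x := by
    induction x using DiagTensor.induction_on with
    | zero => simp
    | tmul m n => rfl
    | add x y hx hy => simp only [map_add, hx, hy]
  d₁_d₁ a b c j _ _ x := by
    rw [← LinearMap.comp_apply, DiagTensor.map_comp_map, P.d_comp_d, DiagTensor.map_zero_left]
    rfl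
  d₂_d₂ i a b c _ _ x := by
    rw [← LinearMap.comp_apply, DiagTensor.map_comp_map, P.d_comp_d, DiagTensor.map_zero_right]
    rfl

/-- The complex A ⊗ P is induced from P as a complex of vector spaces, which splits. The general
first factor is a retract of a power of A. -/
theorem exists_contraction_diag_right (i : ℤ) :
    ∃ s : ∀ j j', DiagTensor k A (P.X i) (P.X j) →ₗ[A] DiagTensor k A (P.X i) (P.X j'),
      IsContraction (fun j j' => (diagDoubleComplex P).d₂ i j j') (fun j j' => s j j') := by
  have := P.finite_base
  obtain ⟨h, hh⟩ := P.exists_contraction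
  obtain ⟨s, hs⟩ := exists_contraction_of_induced (R := A)
    (fun i j => (P.d i j).restrictScalars k) h hh
    (G := fun j => DiagTensor k A A (P.X j)) (fun j => DiagTensor.inr k A (P.X j))
    (fun j j' => DiagTensor.map LinearMap.id (P.d j j')) (fun _ _ _ => rfl)
    (fun j => extendScalars_bijective _ (DiagTensor.finrank_left k A)
      DiagTensor.extendScalars_inr_surjective)
  obtain ⟨σ, _, ι, r, h⟩ := P.finRetract i
  refine exists_contraction_of_retract _ s hs _ (fun t n => DiagTensor.map (ι t) LinearMap.id)
    (fun t n => DiagTensor.map (r t) LinearMap.id) ?_ ?_ (fun n x => DiagTensor.sum_map_left _ h x)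
  all_goals
    intro t a b x
    rw [← LinearMap.comp_apply, ← LinearMap.comp_apply, DiagTensor.map_comp_map,
      DiagTensor.map_comp_map]
    rfl

/-- Here the free factor A stands on the right, so untwisting goes through the inverse of the
antipode. -/
theorem exists_contraction_diag_left (j : ℤ) :
    ∃ s : ∀ i i', DiagTensor k A (P.X i) (P.X j) →ₗ[A] DiagTensor k A (P.X i') (P.X j),
      IsContraction (fun i i' => (diagDoubleComplex P).d₁ i i' j) (fun i i' => s i i') := by
  have := P.finite_base
  obtain ⟨h, hh⟩ := P.exists_contraction
  obtain ⟨S', hS'⟩ := exists_antipode_inv k A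
  obtain ⟨s, hs⟩ := exists_contraction_of_induced (R := A)
    (fun i j => (P.d i j).restrictScalars k) h hh
    (G := fun i => DiagTensor k A (P.X i) A) (fun i => DiagTensor.inl k A (P.X i))
    (fun i i' => DiagTensor.map (P.d i i') LinearMap.id) (fun _ _ _ => rfl)
    (fun i => extendScalars_bijective _ (DiagTensor.finrank_right k A)
      (DiagTensor.extendScalars_inl_surjective S' hS' (antipode_injective k A)))
  obtain ⟨σ, _, ι, r, h⟩ := P.finRetract j
  refine exists_contraction_of_retract _ s hs _ (fun t n => DiagTensor.map LinearMap.id (ι t))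
    (fun t n => DiagTensor.map LinearMap.id (r t)) ?_ ?_
    (fun n x => DiagTensor.sum_map_right _ h x)
  all_goals
    intro t a b x
    rw [← LinearMap.comp_apply, ← LinearMap.comp_apply, DiagTensor.map_comp_map,
      DiagTensor.map_comp_map]
    rfl

/-- The map `P_0 ⊗ P_j → P_j` induced by the augmentation. -/
def diagAugLeft (j : ℤ) : DiagTensor k A (P.X 0) (P.X j) →ₗ[A] P.X j :=
  DiagTensor.lid k A (P.X j) ∘ₗ DiagTensor.map P.ε LinearMap.id

variable {P}

theorem diagAugLeft_of_tmul {j : ℤ} (x : P.X 0) (y : P.X j) :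
    diagAugLeft P j (DiagTensor.of k A _ _ (x ⊗ₜ y)) = (TrivialModule.of k A).symm (P.ε x) • y :=
  rfl

theorem diagAugLeft_map (j j' : ℤ) (t : DiagTensor k A (P.X 0) (P.X j)) :
    diagAugLeft P j' (DiagTensor.map LinearMap.id (P.d j j') t) = P.d j j' (diagAugLeft P j t) := by
  induction t using DiagTensor.induction_on with
  | zero => simp only [map_zero]
  | tmul x y =>
    rw [diagAugLeft_of_tmul, DiagTensor.map_of_tmul, diagAugLeft_of_tmul,
      LinearMap.map_smul_of_tower]
    rfl
  | add x y hx hy => simp only [map_add, hx, hy]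

theorem diagAugLeft_comp_d (j : ℤ) :
    diagAugLeft P j ∘ₗ DiagTensor.map (P.d 1 0) LinearMap.id = 0 := by
  rw [diagAugLeft, LinearMap.comp_assoc, DiagTensor.map_comp_map, P.ε_comp_d,
    DiagTensor.map_zero_left, LinearMap.comp_zero]

theorem trivialMul_map (t : DiagTensor k A (P.X 0) (P.X 0)) :
    trivialMul k A (DiagTensor.map P.ε P.ε t) = P.ε (diagAugLeft P 0 t) := by
  induction t using DiagTensor.induction_on with
  | zero => simp only [map_zero]
  | tmul x y =>
    rw [diagAugLeft_of_tmul, LinearMap.map_smul_of_tower]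
    rfl
  | add x y hx hy => simp only [map_add, hx, hy]

/-- Since d = η ∘ ε in degree 0, the map d ⊗ 1 factors through the left augmentation. In particular
it kills whatever the left augmentation kills. -/
theorem diagMap_d_eq_tmul {η : TrivialModule k A →ₗ[A] P.X (-1)}
    (hη : ∀ x, η (P.ε x) = P.d 0 (-1) x) (j : ℤ) (t : DiagTensor k A (P.X 0) (P.X j)) :
    DiagTensor.map (P.d 0 (-1)) LinearMap.id t =
      DiagTensor.of k A _ _ (η (TrivialModule.of k A 1) ⊗ₜ diagAugLeft P j t) := by
  induction t using DiagTensor.induction_on with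
  | zero => simp only [map_zero, TensorProduct.tmul_zero]
  | tmul x y =>
    have h1 : P.d 0 (-1) x =
        (TrivialModule.of k A).symm (P.ε x) • η (TrivialModule.of k A 1) := by
      rw [← hη, ← LinearMap.map_smul_of_tower, ← map_smul (TrivialModule.of k A), smul_eq_mul,
        mul_one, LinearEquiv.apply_symm_apply]
    rw [diagAugLeft_of_tmul, DiagTensor.map_of_tmul, h1, LinearMap.id_apply,
      TensorProduct.smul_tmul]
  | add x y hx hy => simp only [map_add, TensorProduct.tmul_add, hx, hy]

variable (P)

/-- Every complete resolution of the trivial module admits a complete diagonal approximation. -/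
theorem nonempty_diagonalApprox : Nonempty (DiagonalApprox P) := by
  have := P.finite_base
  obtain ⟨h, hh⟩ := P.exists_contraction
  obtain ⟨η, hη, hηε⟩ := P.exists_coaugmentation
  obtain ⟨x₀, hx₀⟩ := P.ε_surjective (TrivialModule.of k A 1)
  -- The seed of the zigzag is s ∘ η, for a section s of the left augmentation P₀ ⊗ P₋₁ → P₋₁. The
  -- left augmentation of (1 ⊗ d) s η is d η = 0, so d ⊗ 1 kills it, as the zigzag requires.
  obtain ⟨s, hs⟩ := Module.projective_lifting_property (diagAugLeft P (-1)) LinearMap.id fun y =>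
    ⟨DiagTensor.of k A _ _ (x₀ ⊗ₜ y), by rw [diagAugLeft_of_tmul, hx₀, LinearEquiv.symm_apply_apply, one_smul]⟩
  have hs' (y : P.X (-1)) : diagAugLeft P (-1) (s y) = y := LinearMap.congr_fun hs y
  have hdd (x : P.X 0) : P.d (-1) (-2) (P.d 0 (-1) x) = 0 :=
    LinearMap.congr_fun (P.d_comp_d 0 (-1) (-2)) x
  -- The contraction h ⊗ 1 commutes with 1 ⊗ d but need not be A-linear. Exactness of the total
  -- complex only needs an additive contraction.
  obtain ⟨H, hH⟩ : ∃ H : ∀ i i' j, DiagTensor k A (P.X i) (P.X j) →+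
      DiagTensor k A (P.X i') (P.X j), ∀ i i' j (x : P.X i) (y : P.X j),
        H i i' j (DiagTensor.of k A _ _ (x ⊗ₜ y)) = DiagTensor.of k A _ _ (h i i' x ⊗ₜ y) :=
    ⟨fun i i' j => ((DiagTensor.of k A _ _).toLinearMap ∘ₗ
      TensorProduct.map (h i i') LinearMap.id ∘ₗ
        (DiagTensor.of k A _ _).symm.toLinearMap).toAddMonoidHom, fun _ _ _ _ _ => rfl⟩
  have hH₁ (a b c j : ℤ) (hab : b + 1 = a) (hbc : c + 1 = b)
      (x : DiagTensor k A (P.X b) (P.X j)) :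
      DiagTensor.map (P.d a b) LinearMap.id (H b a j x) +
        H c b j (DiagTensor.map (P.d b c) LinearMap.id x) = x := by
    induction x using DiagTensor.induction_on with
    | zero => simp only [map_zero, add_zero]
    | tmul x y =>
      have h1 := congrArg (fun z => DiagTensor.of k A _ _ (z ⊗ₜ[k] y)) (hh a b c hab hbc x)
      simp only [TensorProduct.add_tmul, map_add] at h1
      simp only [hH, DiagTensor.map_of_tmul]
      exact h1
    | add x y hx hy =>
      simp only [map_add] at hx hy ⊢
      rw [add_add_add_comm, hx, hy]
  have hH₂ (i i' j j' : ℤ) (x : DiagTensor k A (P.X i) (P.X j)) :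
      H i i' j' (DiagTensor.map LinearMap.id (P.d j j') x) =
        DiagTensor.map LinearMap.id (P.d j j') (H i i' j x) := by
    induction x using DiagTensor.induction_on with
    | zero => simp only [map_zero]
    | tmul x y => simp only [hH, DiagTensor.map_of_tmul, LinearMap.id_apply]
    | add x y hx hy => simp only [map_add, hx, hy]
  obtain ⟨Γ, hΓ, hΓ₀⟩ := (diagDoubleComplex P).exists_chainMap_tot (C := P.toExactComplex)
    (fun i j => P.homExact (DiagTensor.finRetract_left k _ (P.finRetract i)))
    H hH₁ (fun i i' j j' x => (hH₂ i i' j j' x).symm)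
    (fun a b c j hab hbc z hz => (exists_contraction_diag_left P j).choose_spec.exists_lift
      hab hbc z hz)
    (fun i a b c hab hbc z hz => (exists_contraction_diag_right P i).choose_spec.exists_lift
      hab hbc z hz)
    P.ε P.ε_comp_d (s ∘ₗ η) (fun m => by
      obtain ⟨x, rfl⟩ := P.ε_surjective m
      have h1 : diagAugLeft P (-2) (DiagTensor.map LinearMap.id (P.d (-1) (-2))
          (s (η (P.ε x)))) = 0 := by rw [diagAugLeft_map, hs', hηε, hdd]
      refine (diagMap_d_eq_tmul hηε (-2) _).trans ?_
      refine (congrArg (fun y => DiagTensor.of k A _ _ (η (TrivialModule.of k A 1) ⊗ₜ y)) h1).trans ?_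
      rw [TensorProduct.tmul_zero, map_zero])
  -- The normalisation may be tested after the injection η. Left augmentation of the (0, -1)
  -- component kills the d ⊗ 1 term and leaves d of the augmented Γ₀, which equals η ε.
  refine ⟨⟨Γ, hΓ, fun x => hη ?_⟩⟩
  have h2 (t : DiagTensor k A (P.X 1) (P.X (-1))) :
      diagAugLeft P (-1) (DiagTensor.map (P.d 1 0) LinearMap.id t) = 0 :=
    LinearMap.congr_fun (diagAugLeft_comp_d (-1)) t
  have h1 : diagAugLeft P (-1) (DiagTensor.map (P.d 1 0) LinearMap.id (Γ 0 x ⟨(1, -1), rfl⟩) +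
      DiagTensor.map LinearMap.id (P.d 0 (-1)) (Γ 0 x ⟨(0, 0), rfl⟩)) =
      diagAugLeft P (-1) (s (η (P.ε x))) := congrArg (diagAugLeft P (-1)) (hΓ₀ x)
  rw [hs', map_add, h2, zero_add, diagAugLeft_map, ← hηε] at h1
  rw [trivialMul_map]
  exact h1

end DiagonalTensor
end
end TateHopf

namespace TateHopf
noncomputable section

/-! ## Restriction of scalars -/

section Restriction

variable {k B R : Type*} [Field k] [Ring B] [Algebra k B] [Ring R] [Algebra k R] (φ : B →ₐ[k] R)

/-- An `R`-module as a `B`-module through `φ : B → R`. -/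
def Res (_φ : B →ₐ[k] R) (M : Type*) : Type _ := M

namespace Res

variable (M N : Type*) [AddCommGroup M] [Module k M] [Module R M] [IsScalarTower k R M]
  [AddCommGroup N] [Module k N] [Module R N] [IsScalarTower k R N]

instance : AddCommGroup (Res φ M) := inferInstanceAs (AddCommGroup M)
instance : Module k (Res φ M) := inferInstanceAs (Module k M)
instance : Module B (Res φ M) := Module.compHom M φ.toRingHom
instance [Module.Finite k M] : Module.Finite k (Res φ M) := inferInstanceAs (Module.Finite k M)

/-- The identity map onto the restricted module. -/
def of : M ≃ₗ[k] Res φ M := LinearEquiv.refl k M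

variable {M N}

theorem smul_of (b : B) (m : M) : b • of φ M m = of φ M (φ b • m) := rfl

instance : IsScalarTower k B (Res φ M) where
  smul_assoc c b m := by
    have h : φ (c • b) • (show M from m) = c • φ b • (show M from m) := by
      rw [map_smul, smul_assoc]
    exact h

/-- An `R`-linear map as a `B`-linear map. -/
def map (f : M →ₗ[R] N) : Res φ M →ₗ[B] Res φ N where
  toFun := f
  map_add' := map_add f
  map_smul' b := map_smul f (φ b)

theorem map_of (f : M →ₗ[R] N) (m : M) : map φ f (of φ M m) = of φ N (f m) := rfl

theorem finRetract (h : FinRetract B B (Res φ R)) {Q : Type*} [AddCommGroup Q] [Module k Q]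
    [Module R Q] [IsScalarTower k R Q] (hQ : FinRetract R R Q) : FinRetract B B (Res φ Q) := by
  refine h.trans ?_
  obtain ⟨s, _, i, r, h⟩ := hQ
  refine ⟨s, inferInstance, fun x => map φ (i x), fun x => map φ (r x), LinearMap.ext fun q => ?_⟩
  have := LinearMap.congr_fun h ((of φ Q).symm q)
  rw [LinearMap.sum_apply] at this
  exact (LinearMap.sum_apply _ _ _).trans this

end Res

/-- A complex of `R`-modules as a complex of `B`-modules. -/
@[reducible] def CompleteResolution.res {M : Type*} [AddCommGroup M] [Module R M]
    (P : CompleteResolution.{w} k R M) : ExactComplex.{w} B where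
  X n := Res φ (P.X n)
  d i j := Res.map φ (P.d i j)
  exact := P.toExactComplex.exact

/-- A complete resolution is contractible over a Frobenius subalgebra over which its augmentation
splits. -/
theorem CompleteResolution.exists_res_contraction [Module.Finite k B] (hB : IsFrobenius k B)
    (hR : FinRetract B B (Res φ R)) {M : Type*} [AddCommGroup M] [Module k M] [Module R M]
    [IsScalarTower k R M] (P : CompleteResolution.{w} k R M)
    (σ : Res φ M →ₗ[B] Res φ (P.X 0)) (hσ : ∀ m, Res.map φ P.ε (σ m) = m) :
    ∃ h : ∀ i j, P.X i →ₗ[k] P.X j, (∀ i j b x, h i j (φ b • x) = φ b • h i j x) ∧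
      IsContraction (fun i j => P.d i j) (fun i j => h i j) := by
  have hP (n : ℤ) : FinRetract B B (Res φ (P.X n)) := Res.finRetract φ hR (P.finRetract n)
  have := fun n => (hP n).projective
  have hC (n : ℤ) : HomExact (P.res φ) (Res φ (P.X n)) := hB.homExact _ (hP n)
  -- Self-injectivity of B extends σ ε, which vanishes on boundaries, through d to degree -1. The
  -- extension s splits d : P₀ → P₋₁ because σ ε x - x lies in the kernel of ε, which is the kernel
  -- of d.
  obtain ⟨s, hs⟩ := hC 0 1 0 (-1) rfl rfl (σ ∘ₗ (Res.map φ P.ε : Res φ (P.X 0) →ₗ[B] Res φ M)) (LinearMap.ext fun x =>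
    (congrArg σ (LinearMap.congr_fun P.ε_comp_d x)).trans (map_zero σ))
  obtain ⟨h, hh⟩ := ExactComplex.exists_contraction_of_degree hC (j := 0) (j' := -1) rfl s (by
    rw [hs]
    refine LinearMap.ext fun x => ?_
    have h1 : Res.map φ P.ε (σ (Res.map φ P.ε x) - x) = 0 := by rw [map_sub, hσ, sub_self]
    have h2 : Res.map φ (P.d 0 (-1)) (σ (Res.map φ P.ε x) - x) = 0 :=
      ((P.toExactComplex.exact 1 0 (-1) rfl rfl _).trans (P.ε_exact _).symm).2 h1
    rw [map_sub, sub_eq_zero] at h2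
    exact h2)
  exact ⟨fun i j => (h i j).restrictScalars k, fun i j b x => (h i j).map_smul b x, hh⟩

end Restriction

/-! ## Tensor products of bimodules -/

section Bimodules

variable {k A : Type*} [Field k] [Ring A] [HopfAlgebra k A]

/-! ### Freeness of the enveloping algebra along three algebra maps -/

namespace Env

theorem tmul_mul_tmul (a b c d : A) :
    (tmul a b * tmul c d : Env k A) = tmul (a * c) (d * b) :=
  (map_mul (Env.of k A) _ _).symm.trans
    (congrArg (Env.of k A) (Algebra.TensorProduct.tmul_mul_tmul _ _ _ _))

theorem tmul_one_one : (tmul 1 1 : Env k A) = 1 := rfl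

theorem tmul_one_mul_one_tmul (a b : A) : (tmul a 1 * tmul 1 b : Env k A) = tmul a b := by
  rw [tmul_mul_tmul, mul_one, mul_one]

variable (k A) in
/-- The map `a ↦ a ⊗ 1`. -/
def left : A →ₐ[k] Env k A := (Env.of k A).toAlgHom.comp Algebra.TensorProduct.includeLeft

variable (k A) in
/-- The map `b ↦ 1 ⊗ b`. -/
def right : Aᵐᵒᵖ →ₐ[k] Env k A := (Env.of k A).toAlgHom.comp Algebra.TensorProduct.includeRight

variable (k A) in
/-- The bilinear map `(a, b) ↦ a ⊗ b`. -/
def tmulBilin : A →ₗ[k] A →ₗ[k] Env k A :=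
  (TensorProduct.mk k A Aᵐᵒᵖ).compl₂ (MulOpposite.opLinearEquiv k).toLinearMap

variable (k A) in
theorem finrank : Module.finrank k (Env k A) = Module.finrank k A * Module.finrank k A := by
  refine (Module.finrank_tensorProduct (R := k) (S := k) (M := A) (M' := Aᵐᵒᵖ)).trans ?_
  rw [(MulOpposite.opLinearEquiv k : A ≃ₗ[k] Aᵐᵒᵖ).finrank_eq]

variable (k A) [Module.Finite k A]

theorem finRetract_left : FinRetract A A (Res (left k A) (Env k A)) := by
  refine FinRetract.of_surjective ((Res.of _ _).toLinearMap ∘ₗ tmulBilin k A 1) (finrank k A) ?_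
  intro e
  induction e using Env.induction_on with
  | zero => exact ⟨0, map_zero _⟩
  | tmul a b =>
    exact ⟨a ⊗ₜ b, tmul_one_mul_one_tmul a b⟩
  | add x y hx hy =>
    obtain ⟨x', rfl⟩ := hx
    obtain ⟨y', rfl⟩ := hy
    exact ⟨x' + y', map_add _ _ _⟩

theorem finRetract_right : FinRetract Aᵐᵒᵖ Aᵐᵒᵖ (Res (right k A) (Env k A)) := by
  refine FinRetract.of_surjective ((Res.of _ _).toLinearMap ∘ₗ (tmulBilin k A).flip 1) ?_ ?_
  · rw [← (MulOpposite.opLinearEquiv k : A ≃ₗ[k] Aᵐᵒᵖ).finrank_eq]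
    exact finrank k A
  intro e
  induction e using Env.induction_on with
  | zero => exact ⟨0, map_zero _⟩
  | tmul a b =>
    refine ⟨MulOpposite.op b ⊗ₜ a, ?_⟩
    refine (tmul_mul_tmul 1 b a 1).trans ?_
    rw [one_mul, one_mul]
  | add x y hx hy =>
    obtain ⟨x', rfl⟩ := hx
    obtain ⟨y', rfl⟩ := hy
    exact ⟨x' + y', map_add _ _ _⟩

/-- Generation over A along σ by the elements 1 ⊗ b comes from a ⊗ b = ∑ σ(a₁) (1 ⊗ b S²(a₂)): the
second factors combine to b S(a₂ S(a₃)). Consequently restriction along σ preserves finitely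
generated projectives. -/
theorem finRetract_sigma : FinRetract A A (Res (sigma k A) (Env k A)) := by
  refine FinRetract.of_surjective ((Res.of _ _).toLinearMap ∘ₗ tmulBilin k A 1) (finrank k A) ?_
  intro e
  induction e using Env.induction_on with
  | zero => exact ⟨0, map_zero _⟩
  | tmul a b =>
    let r := Coalgebra.Repr.arbitrary k a
    let S := HopfAlgebra.antipode k (A := A)
    refine ⟨∑ i ∈ r.index, r.left i ⊗ₜ (b * S (S (r.right i))), ?_⟩
    rw [map_sum]
    let W : A ⊗[k] A →ₗ[k] Env k A :=
      TensorProduct.lift ((tmulBilin k A).compl₂ (LinearMap.mulLeft k b ∘ₗ S))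
    have h := congrArg W (sum_comul_mul_antipode r)
    rw [map_sum] at h
    refine Eq.trans (Finset.sum_congr rfl fun i _ => ?_) (h.trans ?_)
    · change sigma k A (r.left i) * tmul 1 (b * S (S (r.right i))) = _
      rw [sigma_eq_sum k A (Coalgebra.Repr.arbitrary k (r.left i)),
        ← (Coalgebra.Repr.arbitrary k (r.left i)).eq, Finset.sum_mul, Finset.sum_mul, map_sum]
      refine Finset.sum_congr rfl fun x _ => ?_
      rw [tmul_mul_tmul, mul_one, Algebra.TensorProduct.tmul_mul_tmul, mul_one]
      change _ = tmul _ (b * S (_ * _))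
      rw [HopfAlgebra.antipode_mul_antidistrib, mul_assoc]
    · change tmul a (b * S 1) = tmul a b
      rw [HopfAlgebra.antipode_one, mul_one]
  | add x y hx hy =>
    obtain ⟨x', rfl⟩ := hx
    obtain ⟨y', rfl⟩ := hy
    exact ⟨x' + y', map_add _ _ _⟩

end Env

variable {M N L : Type*} [AddCommGroup M] [Module k M] [Module (Env k A) M]
  [IsScalarTower k (Env k A) M] [AddCommGroup N] [Module k N] [Module (Env k A) N]
  [IsScalarTower k (Env k A) N] [AddCommGroup L] [Module k L]

/-! ### Universal property and projectivity of tensor products over A -/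

namespace BimodTensor

theorem env_smul_tmul (a b : A) (m : M) (n : N) :
    (Env.tmul a b : Env k A) • tmul k A M N m n =
      tmul k A M N ((Env.tmul a 1 : Env k A) • m) ((Env.tmul 1 b : Env k A) • n) := rfl

variable (k A M N) in
/-- The bilinear map `(m, n) ↦ m ⊗ n`. -/
def tmulBilin : M →ₗ[k] N →ₗ[k] BimodTensor k A M N :=
  LinearMap.mk₂ k (tmul k A M N) add_tmul smul_tmul tmul_add tmul_smul

/-- The linear map on `M ⊗_A N` given by a balanced bilinear map. -/
def lift (f : M →ₗ[k] N →ₗ[k] L)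
    (hf : ∀ a m n, f ((Env.tmul 1 a : Env k A) • m) n = f m ((Env.tmul a 1 : Env k A) • n)) :
    BimodTensor k A M N →ₗ[k] L :=
  ((balancedRelations k A M N).restrictScalars k).liftQ
      (TensorProduct.lift f ∘ₗ (OuterTensor.of k A M N).symm.toLinearMap) (by
    intro t ht
    rw [Submodule.restrictScalars_mem] at ht
    rw [LinearMap.mem_ker]
    -- The relations are spanned over the enveloping algebra while f is only k-linear. Proving that
    -- all translates e • t are killed makes the induction survive scalar multiplication.
    have key : ∀ e : Env k A, TensorProduct.lift f ((OuterTensor.of k A M N).symm (e • t)) = 0 := by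
      induction ht using Submodule.span_induction with
      | mem t ht =>
        obtain ⟨a, m, n, rfl⟩ := ht
        intro e
        induction e using Env.induction_on with
        | zero => rw [zero_smul, map_zero, map_zero]
        | tmul c d =>
          rw [map_sub, smul_sub, OuterTensor.tmul_smul_of_tmul, OuterTensor.tmul_smul_of_tmul,
            map_sub, map_sub, LinearEquiv.symm_apply_apply, LinearEquiv.symm_apply_apply,
            TensorProduct.lift.tmul, TensorProduct.lift.tmul, sub_eq_zero, ← mul_smul, ← mul_smul,
            Env.tmul_mul_tmul, Env.tmul_mul_tmul, one_mul, one_mul, mul_one,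
            ← Env.tmul_one_mul_one_tmul a d, mul_smul, ← hf, ← mul_smul, Env.tmul_mul_tmul, one_mul,
            mul_one, one_mul]
        | add x y hx hy => rw [add_smul, map_add, map_add, hx, hy, add_zero]
      | zero => intro e; rw [smul_zero, map_zero, map_zero]
      | add x y _ _ hx hy => intro e; rw [smul_add, map_add, map_add, hx, hy, add_zero]
      | smul c x _ hx => intro e; rw [← mul_smul]; exact hx _
    simpa using key 1) ∘ₗ
    (Submodule.Quotient.restrictScalarsEquiv k (balancedRelations k A M N)).symm.toLinearMap

theorem lift_tmul (f : M →ₗ[k] N →ₗ[k] L) (hf) (m : M) (n : N) :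
    lift (A := A) f hf (tmul k A M N m n) = f m n := rfl

/-- The homomorphism of bimodules on `M ⊗_A N` given by a balanced bilinear map. -/
def liftEnv [Module (Env k A) L] (f : M →ₗ[k] N →ₗ[k] L)
    (hf : ∀ a m n, f ((Env.tmul 1 a : Env k A) • m) n = f m ((Env.tmul a 1 : Env k A) • n))
    (hE : ∀ a b m n, f ((Env.tmul a 1 : Env k A) • m) ((Env.tmul 1 b : Env k A) • n) =
      (Env.tmul a b : Env k A) • f m n) : BimodTensor k A M N →ₗ[Env k A] L where
  toFun := lift f hf
  map_add' := map_add _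
  map_smul' e x := by
    rw [RingHom.id_apply]
    induction x using BimodTensor.induction_on with
    | zero => rw [smul_zero, map_zero, smul_zero]
    | tmul m n =>
      induction e using Env.induction_on with
      | zero => rw [zero_smul, map_zero, zero_smul]
      | tmul a b => rw [env_smul_tmul, lift_tmul, lift_tmul, hE]
      | add x y hx hy => rw [add_smul, map_add, hx, hy, add_smul]
    | add x y hx hy => rw [smul_add, map_add, hx, hy, map_add, smul_add]

variable (k A N) in
/-- The isomorphism `A ⊗_A N ≅ N`, `a ⊗ n ↦ a n`. -/
def lid : BimodTensor k A (RegularBimodule k A) N →ₗ[Env k A] N :=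
  liftEnv ((Algebra.lsmul k k N).toLinearMap ∘ₗ (Env.left k A).toLinearMap ∘ₗ
      (RegularBimodule.of k A).symm.toLinearMap)
    (fun a m n => by
      obtain ⟨x, rfl⟩ := (RegularBimodule.of k A).surjective m
      rw [RegularBimodule.tmul_smul_of, one_mul]
      change (Env.tmul (x * a) 1 : Env k A) • n = (Env.tmul x 1 : Env k A) • _
      rw [← mul_smul, Env.tmul_mul_tmul, one_mul])
    (fun a b m n => by
      obtain ⟨x, rfl⟩ := (RegularBimodule.of k A).surjective m
      rw [RegularBimodule.tmul_smul_of, mul_one]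
      change (Env.tmul (a * x) 1 : Env k A) • _ = _ • (Env.tmul x 1 : Env k A) • n
      rw [← mul_smul, ← mul_smul, Env.tmul_mul_tmul, Env.tmul_mul_tmul]
      simp only [mul_one, one_mul])

theorem lid_tmul (a : A) (n : N) :
    lid k A N (tmul k A _ N (RegularBimodule.of k A a) n) = (Env.tmul a 1 : Env k A) • n := rfl

variable (k A M) in
/-- The isomorphism `M ⊗_A A ≅ M`, `m ⊗ a ↦ m a`. -/
def rid : BimodTensor k A M (RegularBimodule k A) →ₗ[Env k A] M :=
  liftEnv ((Algebra.lsmul k k M).toLinearMap ∘ₗ (Env.tmulBilin k A 1) ∘ₗ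
      (RegularBimodule.of k A).symm.toLinearMap).flip
    (fun a m n => by
      obtain ⟨x, rfl⟩ := (RegularBimodule.of k A).surjective n
      rw [RegularBimodule.tmul_smul_of, mul_one]
      change (Env.tmul 1 x : Env k A) • (Env.tmul 1 a : Env k A) • m =
        (Env.tmul 1 (a * x) : Env k A) • m
      rw [← mul_smul, Env.tmul_mul_tmul, one_mul])
    (fun a b m n => by
      obtain ⟨x, rfl⟩ := (RegularBimodule.of k A).surjective n
      rw [RegularBimodule.tmul_smul_of, one_mul]
      change (Env.tmul 1 (x * b) : Env k A) • _ = _ • (Env.tmul 1 x : Env k A) • m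
      rw [← mul_smul, ← mul_smul, Env.tmul_mul_tmul, Env.tmul_mul_tmul]
      simp only [mul_one, one_mul])

theorem rid_tmul (m : M) (a : A) :
    rid k A M (tmul k A M _ m (RegularBimodule.of k A a)) = (Env.tmul 1 a : Env k A) • m := rfl

/-- A product of two maps into A can be evaluated one factor at a time. This turns a cup product
into a composition; the companion statement peels off the other factor. -/
theorem regularMul_map (f : M →ₗ[Env k A] RegularBimodule k A)
    (g : N →ₗ[Env k A] RegularBimodule k A) :
    regularMul k A ∘ₗ map f g = f ∘ₗ rid k A M ∘ₗ map LinearMap.id g := by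
  refine hom_ext fun m n => ?_
  simp only [LinearMap.comp_apply, map_tmul, LinearMap.id_apply]
  obtain ⟨y, hy⟩ := (RegularBimodule.of k A).surjective (g n)
  obtain ⟨x, hx⟩ := (RegularBimodule.of k A).surjective (f m)
  rw [← hy, rid_tmul, map_smul, ← hx, regularMul_tmul, RegularBimodule.tmul_smul_of, one_mul]

theorem regularMul_map' (f : M →ₗ[Env k A] RegularBimodule k A)
    (g : N →ₗ[Env k A] RegularBimodule k A) :
    regularMul k A ∘ₗ map f g = g ∘ₗ lid k A N ∘ₗ map f LinearMap.id := by
  refine hom_ext fun m n => ?_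
  simp only [LinearMap.comp_apply, map_tmul, LinearMap.id_apply]
  obtain ⟨y, hy⟩ := (RegularBimodule.of k A).surjective (g n)
  obtain ⟨x, hx⟩ := (RegularBimodule.of k A).surjective (f m)
  rw [← hx, lid_tmul, map_smul, ← hy, regularMul_tmul, RegularBimodule.tmul_smul_of, mul_one]

/-- The two inner factors merge, so the tensor product is A ⊗ A ⊗ A with outer action, free on the
elements 1 ⊗ (bₓ ⊗ 1). The coordinate F x sends (p ⊗ q, r ⊗ s) to bₓ*(q r) p ⊗ s. -/
theorem finRetract_env [Module.Finite k A] :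
    FinRetract (Env k A) (Env k A) (BimodTensor k A (Env k A) (Env k A)) := by
  let b := Module.finBasis k A
  obtain ⟨F, hF⟩ : ∃ F : Fin (Module.finrank k A) → Env k A →ₗ[k] Env k A →ₗ[k] Env k A,
      ∀ x p q r s, F x (Env.tmul p q) (Env.tmul r s) = b.coord x (q * r) • Env.tmul p s :=
    ⟨fun x => ((TensorProduct.map₂ (TensorProduct.mk k A Aᵐᵒᵖ)
      (((LinearMap.mul k A).compr₂ (b.coord x)) ∘ₗ
        (MulOpposite.opLinearEquiv k).symm.toLinearMap)).compl₂
          (TensorProduct.comm k A Aᵐᵒᵖ).toLinearMap).compr₂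
            (TensorProduct.rid k (A ⊗[k] Aᵐᵒᵖ)).toLinearMap, fun _ _ _ _ _ => rfl⟩
  let I (x) : BimodTensor k A (Env k A) (Env k A) →ₗ[Env k A] Env k A :=
    liftEnv (F x)
      (fun a m n => by
        induction m using Env.induction_on with
        | zero => simp only [smul_zero, map_zero, LinearMap.zero_apply]
        | tmul p q =>
          induction n using Env.induction_on with
          | zero => simp only [smul_zero, map_zero]
          | tmul r s =>
            rw [smul_eq_mul, smul_eq_mul, Env.tmul_mul_tmul, Env.tmul_mul_tmul, hF, hF, one_mul,
              mul_one, mul_assoc]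
          | add x y hx hy => rw [smul_add, map_add, map_add, hx, hy]
        | add x y hx hy =>
          rw [smul_add, map_add, map_add, LinearMap.add_apply, LinearMap.add_apply, hx, hy])
      (fun c d m n => by
        induction m using Env.induction_on with
        | zero => simp only [smul_zero, map_zero, LinearMap.zero_apply]
        | tmul p q =>
          induction n using Env.induction_on with
          | zero => simp only [smul_zero, map_zero]
          | tmul r s =>
            rw [smul_eq_mul, smul_eq_mul, smul_eq_mul, Env.tmul_mul_tmul, Env.tmul_mul_tmul, hF,
              hF, one_mul, mul_one, mul_smul_comm, Env.tmul_mul_tmul]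
          | add x y hx hy => rw [smul_add, map_add, map_add, hx, hy, smul_add]
        | add x y hx hy =>
          rw [smul_add, map_add, map_add, LinearMap.add_apply, LinearMap.add_apply, hx, hy,
            smul_add])
  refine ⟨_, inferInstance, I, fun x => LinearMap.toSpanSingleton _ _
    (tmul k A _ _ 1 (Env.tmul (b x) 1)), hom_ext ?_⟩
  intro m n
  rw [LinearMap.sum_apply, LinearMap.id_apply]
  change ∑ x, F x m n • tmul k A (Env k A) (Env k A) 1 (Env.tmul (b x) 1) = _
  induction m using Env.induction_on with
  | zero => simp only [map_zero, LinearMap.zero_apply, zero_smul, zero_tmul, Finset.sum_const_zero]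
  | tmul p q =>
    induction n using Env.induction_on with
    | zero => simp only [map_zero, zero_smul, tmul_zero, Finset.sum_const_zero]
    | tmul r s =>
      have h1 (x) : F x (Env.tmul p q) (Env.tmul r s) • tmul k A (Env k A) (Env k A) 1
          (Env.tmul (b x) 1) = tmulBilin k A (Env k A) (Env k A) (Env.tmul p 1)
            ((Env.tmulBilin k A).flip s (b.repr (q * r) x • b x)) := by
        rw [hF, smul_assoc, env_smul_tmul, smul_eq_mul, smul_eq_mul, mul_one, Env.tmul_mul_tmul,
          one_mul, one_mul, map_smul, map_smul]
        rfl
      have h2 : (Env.tmul (q * r) s : Env k A) = (Env.tmul q 1 : Env k A) • Env.tmul r s := by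
        rw [smul_eq_mul, Env.tmul_mul_tmul, mul_one]
      rw [Finset.sum_congr rfl fun x _ => h1 x, ← map_sum, ← map_sum, b.sum_repr]
      change tmul k A (Env k A) (Env k A) (Env.tmul p 1) (Env.tmul (q * r) s) = _
      rw [h2, ← balanced, smul_eq_mul, Env.tmul_mul_tmul, one_mul, one_mul]
    | add x y hx hy => simp only [map_add, add_smul, tmul_add, Finset.sum_add_distrib, hx, hy]
  | add x y hx hy =>
    simp only [map_add, LinearMap.add_apply, add_smul, add_tmul, Finset.sum_add_distrib, hx, hy]

theorem finRetract [Module.Finite k A] (hM : FinRetract (Env k A) (Env k A) M)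
    (hN : FinRetract (Env k A) (Env k A) N) :
    FinRetract (Env k A) (Env k A) (BimodTensor k A M N) := by
  refine (finRetract_env.trans (Q := BimodTensor k A (Env k A) (Env k A)) ?_).trans
    (Q := BimodTensor k A M (Env k A)) ?_
  · obtain ⟨s, _, i, r, h⟩ := hM
    refine ⟨s, inferInstance, fun x => map (i x) LinearMap.id, fun x => map (r x) LinearMap.id,
      hom_ext fun m n => ?_⟩
    have h1 := congrArg ((tmulBilin k A M (Env k A)).flip n) (LinearMap.congr_fun h m)
    rw [LinearMap.sum_apply, map_sum] at h1
    rw [LinearMap.sum_apply]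
    exact h1
  · obtain ⟨s, _, i, r, h⟩ := hN
    refine ⟨s, inferInstance, fun x => map LinearMap.id (i x), fun x => map LinearMap.id (r x),
      hom_ext fun m n => ?_⟩
    have h1 := congrArg (tmulBilin k A M N m) (LinearMap.congr_fun h n)
    rw [LinearMap.sum_apply, map_sum] at h1
    rw [LinearMap.sum_apply]
    exact h1

end BimodTensor
end Bimodules
end
end TateHopf

namespace TateHopf
noncomputable section

/-! ## Existence of diagonal approximations of bimodule resolutions -/

/-- With t a section of f and p an extension of f along d, one has d t p d = d t f = d, as t f x - x
is in the kernel of f. So d splits in degree 0, hence everywhere. In the applications f is the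
augmentation of one tensor factor. -/
theorem ExactComplex.exists_contraction_of_factor {R : Type*} [Ring R] {C : ExactComplex.{w} R}
    [∀ n, Module.Projective R (C.X n)] (hC : ∀ n, HomExact C (C.X n)) {Q : Type*}
    [AddCommGroup Q] [Module R Q] [Module.Projective R Q] (hQ : HomExact C Q) (f : C.X 0 →ₗ[R] Q)
    (hf : Function.Surjective f) (hfd : f ∘ₗ C.d 1 0 = 0)
    (hdf : ∀ x, f x = 0 → C.d 0 (-1) x = 0) :
    ∃ h : ∀ i j, C.X i →ₗ[R] C.X j, IsContraction (fun i j => C.d i j) (fun i j => h i j) := by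
  obtain ⟨t, ht⟩ := Module.projective_lifting_property f LinearMap.id hf
  obtain ⟨p, hp⟩ := hQ 1 0 (-1) rfl rfl f hfd
  refine exists_contraction_of_degree hC (j := 0) (j' := -1) rfl (t ∘ₗ p)
    (LinearMap.ext fun x => ?_)
  have h1 : f (t (f x)) = f x := LinearMap.congr_fun ht (f x)
  have h2 := hdf (t (f x) - x) (by rw [map_sub, h1, sub_self])
  rw [map_sub, sub_eq_zero, ← LinearMap.congr_fun hp x] at h2
  exact h2

section Bimodules

variable {k A : Type*} [Field k] [Ring A] [HopfAlgebra k A] [Module.Finite k A]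
variable (P : CompleteResolution.{w} k (Env k A) (RegularBimodule k A))

/-- As a right module A is free on 1, so 1 ↦ x₀ splits the augmentation over Aᵒᵖ. Linearity on the
right is exactly what h ⊗ 1 needs in order to descend to the tensor product over A. -/
theorem exists_right_linear_contraction : ∃ h : ∀ i j, P.X i →ₗ[k] P.X j,
    (∀ i j a x, h i j ((Env.tmul 1 a : Env k A) • x) = (Env.tmul 1 a : Env k A) • h i j x) ∧
      IsContraction (fun i j => P.d i j) (fun i j => h i j) := by
  obtain ⟨x₀, hx₀⟩ := P.ε_surjective (RegularBimodule.of k A 1)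
  obtain ⟨h, hh, hc⟩ := P.exists_res_contraction (Env.right k A)
    (isFrobenius_hopf k A).mulOpposite (Env.finRetract_right k A)
    { toFun := fun m => (Env.tmul 1 ((RegularBimodule.of k A).symm m) : Env k A) • x₀
      map_add' := fun a b => by
        exact (congrArg (· • x₀) (map_add (Env.tmulBilin k A 1) ((RegularBimodule.of k A).symm a)
          ((RegularBimodule.of k A).symm b))).trans (add_smul _ _ _)
      map_smul' := fun b m => by
        obtain ⟨a, rfl⟩ := (RegularBimodule.of k A).surjective m
        change (Env.tmul 1 ((RegularBimodule.of k A).symm ((Env.tmul 1 b.unop : Env k A) •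
          RegularBimodule.of k A a)) : Env k A) • x₀ =
          (Env.tmul 1 b.unop : Env k A) • (Env.tmul 1 a : Env k A) • x₀
        rw [RegularBimodule.tmul_smul_of, LinearEquiv.symm_apply_apply, ← mul_smul,
          Env.tmul_mul_tmul, one_mul, one_mul] }
    (fun m => by
      obtain ⟨a, rfl⟩ := (RegularBimodule.of k A).surjective m
      refine (map_smul P.ε _ _).trans ?_
      rw [hx₀, RegularBimodule.tmul_smul_of, one_mul, one_mul]
      rfl)
  exact ⟨h, fun i j a x => hh i j (MulOpposite.op a) x, hc⟩

theorem exists_left_linear_contraction : ∃ h : ∀ i j, P.X i →ₗ[k] P.X j,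
    (∀ i j a x, h i j ((Env.tmul a 1 : Env k A) • x) = (Env.tmul a 1 : Env k A) • h i j x) ∧
      IsContraction (fun i j => P.d i j) (fun i j => h i j) := by
  obtain ⟨x₀, hx₀⟩ := P.ε_surjective (RegularBimodule.of k A 1)
  obtain ⟨h, hh, hc⟩ := P.exists_res_contraction (Env.left k A)
    (isFrobenius_hopf k A) (Env.finRetract_left k A)
    { toFun := fun m => (Env.tmul ((RegularBimodule.of k A).symm m) 1 : Env k A) • x₀
      map_add' := fun a b => by
        exact (congrArg (· • x₀) (map_add ((Env.tmulBilin k A).flip 1)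
          ((RegularBimodule.of k A).symm a) ((RegularBimodule.of k A).symm b))).trans
            (add_smul _ _ _)
      map_smul' := fun b m => by
        obtain ⟨a, rfl⟩ := (RegularBimodule.of k A).surjective m
        change (Env.tmul ((RegularBimodule.of k A).symm ((Env.tmul b 1 : Env k A) •
          RegularBimodule.of k A a)) 1 : Env k A) • x₀ =
          (Env.tmul b 1 : Env k A) • (Env.tmul a 1 : Env k A) • x₀
        rw [RegularBimodule.tmul_smul_of, LinearEquiv.symm_apply_apply, ← mul_smul,
          Env.tmul_mul_tmul, mul_one, mul_one] }
    (fun m => by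
      obtain ⟨a, rfl⟩ := (RegularBimodule.of k A).surjective m
      refine (map_smul P.ε _ _).trans ?_
      rw [hx₀, RegularBimodule.tmul_smul_of, mul_one, mul_one]
      rfl)
  exact ⟨h, fun i j a x => hh i j a x, hc⟩

/-- The double complex `P ⊗_A P`. -/
@[reducible] def bimodDoubleComplex : DoubleComplex.{w} (Env k A) where
  X i j := BimodTensor k A (P.X i) (P.X j)
  d₁ i i' j := BimodTensor.map (P.d i i') LinearMap.id
  d₂ i j j' := BimodTensor.map LinearMap.id (P.d j j')
  comm i i' j j' x := by
    induction x using BimodTensor.induction_on with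
    | zero => simp
    | tmul m n => rfl
    | add x y hx hy => simp only [map_add, hx, hy]
  d₁_d₁ a b c j _ _ x := by
    rw [← LinearMap.comp_apply, BimodTensor.map_comp_map, P.d_comp_d, BimodTensor.map_zero_left]
    rfl
  d₂_d₂ i a b c _ _ x := by
    rw [← LinearMap.comp_apply, BimodTensor.map_comp_map, P.d_comp_d, BimodTensor.map_zero_right]
    rfl

theorem bimod_finRetract (i j : ℤ) :
    FinRetract (Env k A) (Env k A) (BimodTensor k A (P.X i) (P.X j)) :=
  BimodTensor.finRetract (P.finRetract i) (P.finRetract j)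

/-- The map h ⊗ 1 is balanced by right linearity of h and commutes with 1 ⊗ d. It is not claimed to
be a bimodule map; the bimodule contraction is obtained separately. -/
theorem exists_additive_contraction_left :
    ∃ H : ∀ i i' j, BimodTensor k A (P.X i) (P.X j) →ₗ[k] BimodTensor k A (P.X i') (P.X j),
      (∀ a b c j, b + 1 = a → c + 1 = b → ∀ x,
        BimodTensor.map (P.d a b) LinearMap.id (H b a j x) +
          H c b j (BimodTensor.map (P.d b c) LinearMap.id x) = x) ∧
      ∀ i i' j j' x, H i i' j' (BimodTensor.map LinearMap.id (P.d j j') x) =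
        BimodTensor.map LinearMap.id (P.d j j') (H i i' j x) := by
  obtain ⟨h, hr, hh⟩ := exists_right_linear_contraction P
  obtain ⟨H, hH⟩ : ∃ H : ∀ i i' j, BimodTensor k A (P.X i) (P.X j) →ₗ[k]
      BimodTensor k A (P.X i') (P.X j), ∀ i i' j (x : P.X i) (y : P.X j),
        H i i' j (BimodTensor.tmul k A _ _ x y) = BimodTensor.tmul k A _ _ (h i i' x) y :=
    ⟨fun i i' j => BimodTensor.lift (BimodTensor.tmulBilin k A _ _ ∘ₗ h i i') (fun a m n => by
      rw [LinearMap.comp_apply, hr]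
      exact BimodTensor.balanced k A _ _ a (h i i' m) n), fun _ _ _ _ _ => rfl⟩
  refine ⟨H, fun a b c j hab hbc x => ?_, fun i i' j j' x => ?_⟩
  · induction x using BimodTensor.induction_on with
    | zero => simp only [map_zero, add_zero]
    | tmul x y =>
      have h1 := congrArg (fun z => BimodTensor.tmul k A _ _ z y) (hh a b c hab hbc x)
      simp only [BimodTensor.add_tmul] at h1
      simp only [hH, BimodTensor.map_tmul]
      exact h1
    | add x y hx hy =>
      simp only [map_add] at hx hy ⊢
      rw [add_add_add_comm, hx, hy]
  · induction x using BimodTensor.induction_on with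
    | zero => simp only [map_zero]
    | tmul x y => simp only [hH, BimodTensor.map_tmul, LinearMap.id_apply]
    | add x y hx hy => simp only [map_add, hx, hy]

theorem exists_additive_contraction_right :
    ∃ H : ∀ i j j', BimodTensor k A (P.X i) (P.X j) →ₗ[k] BimodTensor k A (P.X i) (P.X j'),
      ∀ i a b c, b + 1 = a → c + 1 = b → ∀ x,
        BimodTensor.map LinearMap.id (P.d a b) (H i b a x) +
          H i c b (BimodTensor.map LinearMap.id (P.d b c) x) = x := by
  obtain ⟨h, hl, hh⟩ := exists_left_linear_contraction P
  obtain ⟨H, hH⟩ : ∃ H : ∀ i j j', BimodTensor k A (P.X i) (P.X j) →ₗ[k]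
      BimodTensor k A (P.X i) (P.X j'), ∀ i j j' (x : P.X i) (y : P.X j),
        H i j j' (BimodTensor.tmul k A _ _ x y) = BimodTensor.tmul k A _ _ x (h j j' y) :=
    ⟨fun i j j' => BimodTensor.lift ((BimodTensor.tmulBilin k A _ _).compl₂ (h j j'))
      (fun a m n => by
        rw [LinearMap.compl₂_apply, LinearMap.compl₂_apply, hl]
        exact BimodTensor.balanced k A _ _ a m (h j j' n)), fun _ _ _ _ _ => rfl⟩
  refine ⟨H, fun i a b c hab hbc x => ?_⟩
  induction x using BimodTensor.induction_on with
  | zero => simp only [map_zero, add_zero]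
  | tmul x y =>
    have h1 := congrArg (fun z => BimodTensor.tmul k A _ _ x z) (hh a b c hab hbc y)
    simp only [BimodTensor.tmul_add] at h1
    simp only [hH, BimodTensor.map_tmul]
    exact h1
  | add x y hx hy =>
    simp only [map_add] at hx hy ⊢
    rw [add_add_add_comm, hx, hy]

variable {P}

theorem smul_coaugmentation {η : RegularBimodule k A →ₗ[Env k A] P.X (-1)} (a : A) :
    η (RegularBimodule.of k A a) =
      (Env.tmul 1 a : Env k A) • η (RegularBimodule.of k A 1) := by
  rw [← map_smul, RegularBimodule.tmul_smul_of, one_mul, one_mul]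

theorem smul_coaugmentation' {η : RegularBimodule k A →ₗ[Env k A] P.X (-1)} (a : A) :
    η (RegularBimodule.of k A a) =
      (Env.tmul a 1 : Env k A) • η (RegularBimodule.of k A 1) := by
  rw [← map_smul, RegularBimodule.tmul_smul_of, mul_one, mul_one]

variable (P) in
/-- The map `P_0 ⊗_A P_j → P_j` induced by the augmentation. -/
def augLeft (j : ℤ) : BimodTensor k A (P.X 0) (P.X j) →ₗ[Env k A] P.X j :=
  BimodTensor.lid k A (P.X j) ∘ₗ BimodTensor.map P.ε LinearMap.id

variable (P) in
/-- The map `P_i ⊗_A P_0 → P_i` induced by the augmentation. -/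
def augRight (i : ℤ) : BimodTensor k A (P.X i) (P.X 0) →ₗ[Env k A] P.X i :=
  BimodTensor.rid k A (P.X i) ∘ₗ BimodTensor.map LinearMap.id P.ε

theorem augLeft_tmul {j : ℤ} {x : P.X 0} {a : A} (hx : P.ε x = RegularBimodule.of k A a)
    (y : P.X j) : augLeft P j (BimodTensor.tmul k A _ _ x y) = (Env.tmul a 1 : Env k A) • y := by
  rw [augLeft, LinearMap.comp_apply, BimodTensor.map_tmul, hx, BimodTensor.lid_tmul]
  rfl

theorem augRight_tmul {i : ℤ} {y : P.X 0} {a : A} (hy : P.ε y = RegularBimodule.of k A a)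
    (x : P.X i) : augRight P i (BimodTensor.tmul k A _ _ x y) = (Env.tmul 1 a : Env k A) • x := by
  rw [augRight, LinearMap.comp_apply, BimodTensor.map_tmul, hy, BimodTensor.rid_tmul]
  rfl

theorem augLeft_surjective (j : ℤ) : Function.Surjective (augLeft P j) := fun y => by
  obtain ⟨x₀, hx₀⟩ := P.ε_surjective (RegularBimodule.of k A 1)
  exact ⟨BimodTensor.tmul k A _ _ x₀ y, by rw [augLeft_tmul hx₀, Env.tmul_one_one, one_smul]⟩

theorem augRight_surjective (i : ℤ) : Function.Surjective (augRight P i) := fun x => by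
  obtain ⟨x₀, hx₀⟩ := P.ε_surjective (RegularBimodule.of k A 1)
  exact ⟨BimodTensor.tmul k A _ _ x x₀, by rw [augRight_tmul hx₀, Env.tmul_one_one, one_smul]⟩

theorem augLeft_comp_d (j : ℤ) :
    augLeft P j ∘ₗ BimodTensor.map (P.d 1 0) LinearMap.id = 0 := by
  rw [augLeft, LinearMap.comp_assoc, BimodTensor.map_comp_map, P.ε_comp_d,
    BimodTensor.map_zero_left, LinearMap.comp_zero]

theorem augRight_comp_d (i : ℤ) :
    augRight P i ∘ₗ BimodTensor.map LinearMap.id (P.d 1 0) = 0 := by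
  rw [augRight, LinearMap.comp_assoc, BimodTensor.map_comp_map, P.ε_comp_d,
    BimodTensor.map_zero_right, LinearMap.comp_zero]

theorem augLeft_map (j j' : ℤ) (t : BimodTensor k A (P.X 0) (P.X j)) :
    augLeft P j' (BimodTensor.map LinearMap.id (P.d j j') t) = P.d j j' (augLeft P j t) := by
  induction t using BimodTensor.induction_on with
  | zero => simp only [map_zero]
  | tmul x y =>
    obtain ⟨a, ha⟩ := (RegularBimodule.of k A).surjective (P.ε x)
    rw [BimodTensor.map_tmul, LinearMap.id_apply, augLeft_tmul ha.symm, augLeft_tmul ha.symm,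
      map_smul]
  | add x y hx hy => simp only [map_add, hx, hy]

/-- As over the Hopf algebra, d = η ∘ ε factors the differential through the left augmentation; here
the scalar ε(x) ∈ A is moved across the tensor sign. -/
theorem map_d_eq_tmul_augLeft {η : RegularBimodule k A →ₗ[Env k A] P.X (-1)}
    (hη : ∀ x, η (P.ε x) = P.d 0 (-1) x) (j : ℤ) (t : BimodTensor k A (P.X 0) (P.X j)) :
    BimodTensor.map (P.d 0 (-1)) LinearMap.id t =
      BimodTensor.tmul k A _ _ (η (RegularBimodule.of k A 1)) (augLeft P j t) := by
  induction t using BimodTensor.induction_on with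
  | zero => rw [map_zero, map_zero, BimodTensor.tmul_zero]
  | tmul x y =>
    obtain ⟨a, ha⟩ := (RegularBimodule.of k A).surjective (P.ε x)
    rw [BimodTensor.map_tmul, LinearMap.id_apply, augLeft_tmul ha.symm, ← hη, ← ha,
      smul_coaugmentation, BimodTensor.balanced]
  | add x y hx hy => simp only [map_add, BimodTensor.tmul_add, hx, hy]

theorem map_d_eq_augRight_tmul {η : RegularBimodule k A →ₗ[Env k A] P.X (-1)}
    (hη : ∀ x, η (P.ε x) = P.d 0 (-1) x) (i : ℤ) (t : BimodTensor k A (P.X i) (P.X 0)) :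
    BimodTensor.map LinearMap.id (P.d 0 (-1)) t =
      BimodTensor.tmul k A _ _ (augRight P i t) (η (RegularBimodule.of k A 1)) := by
  induction t using BimodTensor.induction_on with
  | zero => rw [map_zero, map_zero, BimodTensor.zero_tmul]
  | tmul x y =>
    obtain ⟨a, ha⟩ := (RegularBimodule.of k A).surjective (P.ε y)
    rw [BimodTensor.map_tmul, LinearMap.id_apply, augRight_tmul ha.symm, ← hη, ← ha,
      smul_coaugmentation', BimodTensor.balanced]
  | add x y hx hy => simp only [map_add, BimodTensor.add_tmul, hx, hy]

variable (P)

/-- The additive contraction gives exactness, and the terms are projective over a Frobenius algebra.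
The differential leaving P₀ ⊗_A P_j factors through the augmentation onto the projective P_j, so the
complex splits over bimodules. -/
theorem exists_contraction_bimod_left (j : ℤ) :
    ∃ s : ∀ i i', BimodTensor k A (P.X i) (P.X j) →ₗ[Env k A] BimodTensor k A (P.X i') (P.X j),
      IsContraction (fun i i' => (bimodDoubleComplex P).d₁ i i' j) (fun i i' => s i i') := by
  obtain ⟨H, hH, -⟩ := exists_additive_contraction_left P
  obtain ⟨η, -, hη⟩ := P.exists_coaugmentation
  let C : ExactComplex.{w} (Env k A) :=
    { X := fun i => BimodTensor k A (P.X i) (P.X j)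
      d := fun i i' => BimodTensor.map (P.d i i') LinearMap.id
      exact := fun a b c hab hbc z => by
        refine ⟨fun hz => ⟨H b a j z, ?_⟩, ?_⟩
        · have h1 := hH a b c j hab hbc z
          rwa [hz, map_zero, add_zero] at h1
        · rintro ⟨z, rfl⟩
          exact (bimodDoubleComplex P).d₁_d₁ a b c j hab hbc z }
  have hC (n : ℤ) : FinRetract (Env k A) (Env k A) (C.X n) := bimod_finRetract P n j
  have := fun n => (hC n).projective
  refine C.exists_contraction_of_factor (fun n => (isFrobenius_env k A).homExact C (hC n))
    ((isFrobenius_env k A).homExact C (P.finRetract j)) (augLeft P j) (augLeft_surjective j)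
    (augLeft_comp_d j) fun x hx => ?_
  refine (map_d_eq_tmul_augLeft hη j x).trans ?_
  rw [hx, BimodTensor.tmul_zero]

theorem exists_contraction_bimod_right (i : ℤ) :
    ∃ s : ∀ j j', BimodTensor k A (P.X i) (P.X j) →ₗ[Env k A] BimodTensor k A (P.X i) (P.X j'),
      IsContraction (fun j j' => (bimodDoubleComplex P).d₂ i j j') (fun j j' => s j j') := by
  obtain ⟨H, hH⟩ := exists_additive_contraction_right P
  obtain ⟨η, -, hη⟩ := P.exists_coaugmentation
  let C : ExactComplex.{w} (Env k A) :=
    { X := fun j => BimodTensor k A (P.X i) (P.X j)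
      d := fun j j' => BimodTensor.map LinearMap.id (P.d j j')
      exact := fun a b c hab hbc z => by
        refine ⟨fun hz => ⟨H i b a z, ?_⟩, ?_⟩
        · have h1 := hH i a b c hab hbc z
          rwa [hz, map_zero, add_zero] at h1
        · rintro ⟨z, rfl⟩
          exact (bimodDoubleComplex P).d₂_d₂ i a b c hab hbc z }
  have hC (n : ℤ) : FinRetract (Env k A) (Env k A) (C.X n) := bimod_finRetract P i n
  have := fun n => (hC n).projective
  refine C.exists_contraction_of_factor (fun n => (isFrobenius_env k A).homExact C (hC n))
    ((isFrobenius_env k A).homExact C (P.finRetract i)) (augRight P i) (augRight_surjective i)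
    (augRight_comp_d i) fun x hx => ?_
  refine (map_d_eq_augRight_tmul hη i x).trans ?_
  rw [hx, BimodTensor.zero_tmul]

/-- Every complete resolution of the regular bimodule admits a complete diagonal approximation. -/
theorem nonempty_bimodDiagonalApprox : Nonempty (BimodDiagonalApprox P) := by
  obtain ⟨H, hH₁, hH₂⟩ := exists_additive_contraction_left P
  obtain ⟨η, hη, hηε⟩ := P.exists_coaugmentation
  obtain ⟨s, hs⟩ := Module.projective_lifting_property (augLeft P (-1)) LinearMap.id
    (augLeft_surjective (-1))
  have hs' (y : P.X (-1)) : augLeft P (-1) (s y) = y := LinearMap.congr_fun hs y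
  have hdd (x : P.X 0) : P.d (-1) (-2) (P.d 0 (-1) x) = 0 :=
    LinearMap.congr_fun (P.d_comp_d 0 (-1) (-2)) x
  obtain ⟨Γ, hΓ, hΓ₀⟩ := (bimodDoubleComplex P).exists_chainMap_tot (C := P.toExactComplex)
    (fun i j => P.homExact (bimod_finRetract P i j))
    (fun i i' j => (H i i' j).toAddMonoidHom) hH₁ (fun i i' j j' x => (hH₂ i i' j j' x).symm)
    (fun a b c j hab hbc z hz => (exists_contraction_bimod_left P j).choose_spec.exists_lift
      hab hbc z hz)
    (fun i a b c hab hbc z hz => (exists_contraction_bimod_right P i).choose_spec.exists_lift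
      hab hbc z hz)
    P.ε P.ε_comp_d (s ∘ₗ η) (fun m => by
      obtain ⟨x, rfl⟩ := P.ε_surjective m
      have h1 : augLeft P (-2) (BimodTensor.map LinearMap.id (P.d (-1) (-2))
          (s (η (P.ε x)))) = 0 := by rw [augLeft_map, hs', hηε, hdd]
      exact (map_d_eq_tmul_augLeft hηε (-2) _).trans
        ((congrArg _ h1).trans (BimodTensor.tmul_zero _)))
  refine ⟨⟨Γ, hΓ, fun x => hη ?_⟩⟩
  have h2 (t : BimodTensor k A (P.X 1) (P.X (-1))) :
      augLeft P (-1) (BimodTensor.map (P.d 1 0) LinearMap.id t) = 0 :=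
    LinearMap.congr_fun (augLeft_comp_d (-1)) t
  have h1 : augLeft P (-1) (BimodTensor.map (P.d 1 0) LinearMap.id (Γ 0 x ⟨(1, -1), rfl⟩) +
      BimodTensor.map LinearMap.id (P.d 0 (-1)) (Γ 0 x ⟨(0, 0), rfl⟩)) =
      augLeft P (-1) (s (η (P.ε x))) := congrArg (augLeft P (-1)) (hΓ₀ x)
  rw [hs', map_add, h2, zero_add, augLeft_map, ← hηε] at h1
  exact (congrArg η (LinearMap.congr_fun (BimodTensor.regularMul_map' P.ε P.ε) _)).trans h1

end Bimodules
end
end TateHopf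

namespace TateHopf
noncomputable section

/-! ## The graded algebra structure on Tate-Hochschild cohomology -/

/-- The variant of `ExactComplex.exists_coboundary` for chain maps of degree `-j`. -/
theorem ExactComplex.exists_coboundary_of_degree {R : Type*} [Ring R] {C : ExactComplex.{w₁} R}
    {D : ExactComplex.{w₂} R} [∀ n, Module.Projective R (C.X n)]
    (hD : ∀ n, HomExact C (D.X n)) {j j' : ℤ} (hj : j' + 1 = j)
    (φ ψ : ∀ n m, m + j = n → (C.X n →ₗ[R] D.X m))
    (hφ : ∀ n n' m m' h h', n' + 1 = n → D.d m m' ∘ₗ φ n m h = φ n' m' h' ∘ₗ C.d n n')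
    (hψ : ∀ n n' m m' h h', n' + 1 = n → D.d m m' ∘ₗ ψ n m h = ψ n' m' h' ∘ₗ C.d n n')
    {N : Type*} [AddCommGroup N] [Module R N] (e : D.X 0 →ₗ[R] N) (he : Function.Surjective e)
    (hed : Function.Exact (D.d 1 0) e) (c : C.X j' →ₗ[R] N)
    (hc : e ∘ₗ φ j 0 (zero_add j) - e ∘ₗ ψ j 0 (zero_add j) = c ∘ₗ C.d j j')
    {L : Type*} [AddCommGroup L] [Module R L] {n n' m m₁ : ℤ} (hn : n' + 1 = n) (h : m + j = n)
    (hm : m + 1 = m₁) (F : D.X m →ₗ[R] L) (hF : F ∘ₗ D.d m₁ m = 0) :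
    ∃ b : C.X n' →ₗ[R] L, b ∘ₗ C.d n n' = F ∘ₗ φ n m h - F ∘ₗ ψ n m h := by
  -- In the shifted complex the augmented term carries the index j - j instead of 0, so the
  -- augmentation data are transported along that equality.
  have key : ∀ z z₁ (hz : z = 0) (_ : z₁ = 1), ∃ e' : D.X z →ₗ[R] N, Function.Surjective e' ∧
      Function.Exact (D.d z₁ z) e' ∧
      e' ∘ₗ φ j z (by omega) - e' ∘ₗ ψ j z (by omega) = c ∘ₗ C.d j j' := by
    rintro _ _ rfl rfl
    exact ⟨e, he, hed, hc⟩
  obtain ⟨e', he', hed', hc'⟩ := key (j - j) (j + 1 - j) (by omega) (by omega)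
  obtain rfl : m = n - j := by omega
  obtain rfl : m₁ = n + 1 - j := by omega
  exact exists_coboundary (D := D.shift j) (fun n => hD (n - j)) (fun n => φ n (n - j) (by omega))
    (fun n => ψ n (n - j) (by omega)) (fun a b hab => hφ _ _ _ _ _ _ hab)
    (fun a b hab => hψ _ _ _ _ _ _ hab) rfl hj e' he' hed' c hc' rfl hn F hF

theorem negOnePow_smul_comp {R M N L : Type*} [Ring R] [AddCommGroup M] [Module R M]
    [AddCommGroup N] [Module R N] [AddCommGroup L] [Module R L] (u : ℤˣ) (f : N →ₗ[R] L)
    (g : M →ₗ[R] N) : f ∘ₗ (u • g) = u • (f ∘ₗ g) :=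
  LinearMap.ext fun x => by simp [Units.smul_def]

theorem TateExt.mk_eq_mk {k R M N : Type*} [Field k] [Ring R] [Algebra k R] [AddCommGroup M]
    [Module R M] {P : CompleteResolution.{w} k R M} [AddCommGroup N] [Module R N] [Module k N]
    [IsScalarTower k R N] {n n' : ℤ} (hn : n' + 1 = n) {f g : cocycles P N n}
    (b : P.X n' →ₗ[R] N) (hb : b ∘ₗ P.d n n' = f.1 - g.1) :
    (Submodule.Quotient.mk f : TateExt P N n) = Submodule.Quotient.mk g := by
  obtain rfl : n' = n - 1 := by omega
  exact (Submodule.Quotient.eq _).2 ((mem_coboundaries P).2 ⟨b, hb⟩)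

theorem BimodTensor.rid_map {k A M M' : Type*} [Field k] [Ring A] [HopfAlgebra k A]
    [AddCommGroup M] [Module k M] [Module (Env k A) M] [IsScalarTower k (Env k A) M]
    [AddCommGroup M'] [Module k M'] [Module (Env k A) M'] [IsScalarTower k (Env k A) M']
    (f : M →ₗ[Env k A] M') :
    rid k A M' ∘ₗ map f LinearMap.id = f ∘ₗ rid k A M := by
  refine hom_ext fun m n => ?_
  obtain ⟨a, rfl⟩ := (RegularBimodule.of k A).surjective n
  rw [LinearMap.comp_apply, LinearMap.comp_apply, map_tmul, LinearMap.id_apply, rid_tmul, rid_tmul,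
    map_smul]

section Hochschild

variable {k A : Type*} [Field k] [Ring A] [HopfAlgebra k A]
variable {P : CompleteResolution.{w} k (Env k A) (RegularBimodule k A)} (Θ : BimodDiagonalApprox P)

/-- The endomorphism of degree `-j` of `P` given by the diagonal approximation and a cochain
`g` of degree `j`. -/
def slant {j : ℤ} (g : P.X j →ₗ[Env k A] RegularBimodule k A) (n m : ℤ) (h : m + j = n) :
    P.X n →ₗ[Env k A] P.X m :=
  BimodTensor.rid k A (P.X m) ∘ₗ BimodTensor.map LinearMap.id g ∘ₗ Θ.comp m j n h

/-- Of the two terms of the differential of Θ, the one with 1 ⊗ d is killed because g is a cocycle;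
the other has no sign. -/
theorem slant_comm {j : ℤ} {g : P.X j →ₗ[Env k A] RegularBimodule k A}
    (hg : g ∘ₗ P.d (j + 1) j = 0) (n n' m m' : ℤ) (h : m + j = n) (h' : m' + j = n')
    (hn : n' + 1 = n) : P.d m m' ∘ₗ slant Θ g n m h = slant Θ g n' m' h' ∘ₗ P.d n n' := by
  simp only [slant, LinearMap.comp_assoc]
  rw [Θ.comp_d m' j m (j + 1) n n' (by omega) rfl hn h', LinearMap.comp_add, negOnePow_smul_comp,
    ← LinearMap.comp_assoc _ _ (BimodTensor.map LinearMap.id g),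
    ← LinearMap.comp_assoc _ _ (BimodTensor.map LinearMap.id g), BimodTensor.map_comp_map,
    BimodTensor.map_comp_map, hg, LinearMap.id_comp, LinearMap.comp_id,
    BimodTensor.map_zero_right, LinearMap.zero_comp, smul_zero, add_zero,
    ← LinearMap.comp_assoc, ← BimodTensor.rid_map, LinearMap.comp_assoc,
    ← LinearMap.comp_assoc _ _ (BimodTensor.map (P.d m m') _), BimodTensor.map_comp_map,
    LinearMap.comp_id, LinearMap.id_comp]

/-- On representatives the product is a signed composition with a slant, the form in which all ring
axioms are verified. -/
theorem hochschildMul_mk {i j n : ℤ} (h : i + j = n)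
    (f : cocycles P (RegularBimodule k A) i) (g : cocycles P (RegularBimodule k A) j) :
    ∃ c : cocycles P (RegularBimodule k A) n,
      hochschildMul Θ i j n h (Submodule.Quotient.mk f) (Submodule.Quotient.mk g) =
        Submodule.Quotient.mk c ∧
      c.1 = (i * j).negOnePow • (f.1 ∘ₗ slant Θ g.1 n i h) := by
  refine ⟨_, rfl, ?_⟩
  refine (negOnePow_smul_comp _ _ _).trans (congrArg _ ?_)
  rw [← LinearMap.comp_assoc, BimodTensor.regularMul_map, slant]
  simp only [LinearMap.comp_assoc]

variable [Module.Finite k A]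

/-- Left augmentation of Θ is a chain endomorphism lifting the identity of A, so composing it with g
gives a cocycle cohomologous to g. That composite is also ε ∘ `slant Θ g`, since in ε ⊗ g either
factor may be evaluated last. -/
theorem exists_aug_comp_slant {j j' : ℤ} (hj : j' + 1 = j)
    (g : P.X j →ₗ[Env k A] RegularBimodule k A) (hg : g ∘ₗ P.d (j + 1) j = 0) :
    ∃ b : P.X j' →ₗ[Env k A] RegularBimodule k A,
      b ∘ₗ P.d j j' = P.ε ∘ₗ slant Θ g j 0 (zero_add j) - g := by
  obtain ⟨b, hb⟩ := ExactComplex.exists_coboundary (C := P.toExactComplex) (D := P.toExactComplex)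
    (fun n => P.homExact (P.finRetract n))
    (fun n => augLeft P n ∘ₗ Θ.comp 0 n n (zero_add n)) (fun n => LinearMap.id)
    (fun a b hab => by
      rw [LinearMap.comp_assoc, Θ.comp_d 0 b 1 a a b rfl hab hab (zero_add b), LinearMap.comp_add,
        ← LinearMap.comp_assoc _ _ (augLeft P b), augLeft_comp_d, LinearMap.zero_comp, zero_add, Int.negOnePow_zero,
        one_smul]
      exact LinearMap.ext fun x => (augLeft_map _ _ _).symm)
    (fun a b hab => rfl) (j := 0) (j₁ := 1) (j' := -1) rfl rfl P.ε P.ε_surjective P.ε_exact 0 (by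
      rw [LinearMap.zero_comp, sub_eq_zero]
      refine LinearMap.ext fun x => ?_
      exact (LinearMap.congr_fun (BimodTensor.regularMul_map' P.ε P.ε) _).symm.trans (Θ.aug x))
    (n := j) rfl hj g hg
  refine ⟨b, hb.trans ?_⟩
  congr 1
  exact congrArg (· ∘ₗ Θ.comp 0 j j (zero_add j)) ((BimodTensor.regularMul_map' P.ε g).symm.trans
    (BimodTensor.regularMul_map P.ε g))

theorem isGradedAlgebra_hochschild :
    IsGradedAlgebra k (TateExt P (RegularBimodule k A)) (hochschildMul Θ) (hochschildOne P) where
  one_mul n x := by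
    obtain ⟨f, rfl⟩ := Submodule.Quotient.mk_surjective _ x
    obtain ⟨c, hc, hc'⟩ := hochschildMul_mk Θ (zero_add n) ⟨P.ε, P.ε_comp_d⟩ f
    obtain ⟨b, hb⟩ := exists_aug_comp_slant Θ (sub_add_cancel n 1) f.1 ((mem_cocycles P).1 f.2)
    refine hc.trans (TateExt.mk_eq_mk (sub_add_cancel n 1) b ?_)
    rw [hb, hc', zero_mul, Int.negOnePow_zero, one_smul]
  mul_one n x := by
    obtain ⟨f, rfl⟩ := Submodule.Quotient.mk_surjective _ x
    obtain ⟨c, hc, hc'⟩ := hochschildMul_mk Θ (add_zero n) f ⟨P.ε, P.ε_comp_d⟩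
    obtain ⟨b₀, hb₀⟩ := exists_aug_comp_slant Θ (j := 0) (j' := -1) rfl P.ε P.ε_comp_d
    -- The slant by ε has augmentation cohomologous to ε itself, so f composed with it is
    -- cohomologous to f.
    obtain ⟨b, hb⟩ := ExactComplex.exists_coboundary (C := P.toExactComplex)
      (D := P.toExactComplex) (fun n => P.homExact (P.finRetract n))
      (fun n => slant Θ P.ε n n (add_zero n)) (fun n => LinearMap.id)
      (fun a b hab => slant_comm Θ P.ε_comp_d _ _ _ _ _ _ hab) (fun a b hab => rfl)
      (j := 0) (j₁ := 1) (j' := -1) rfl rfl P.ε P.ε_surjective P.ε_exact b₀ hb₀.symm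
      (n := n) rfl (sub_add_cancel n 1) f.1 ((mem_cocycles P).1 f.2)
    refine hc.trans (TateExt.mk_eq_mk (sub_add_cancel n 1) b (hb.trans ?_))
    rw [hc', mul_zero, Int.negOnePow_zero, one_smul]
    rfl
  mul_assoc i j l a b n hij hal hjl hib x y z := by
    obtain ⟨f, rfl⟩ := Submodule.Quotient.mk_surjective _ x
    obtain ⟨g, rfl⟩ := Submodule.Quotient.mk_surjective _ y
    obtain ⟨h, rfl⟩ := Submodule.Quotient.mk_surjective _ z
    have hf := (mem_cocycles P).1 f.2
    have hg := (mem_cocycles P).1 g.2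
    have hh := (mem_cocycles P).1 h.2
    obtain ⟨fg, e₁, e₁'⟩ := hochschildMul_mk Θ hij f g
    obtain ⟨r, e₂, e₂'⟩ := hochschildMul_mk Θ hal fg h
    obtain ⟨gh, e₃, e₃'⟩ := hochschildMul_mk Θ hjl g h
    obtain ⟨s, e₄, e₄'⟩ := hochschildMul_mk Θ hib f gh
    have hgh := (mem_cocycles P).1 gh.2
    rw [e₁, e₂, e₃, e₄]
    obtain ⟨c₁, hc₁⟩ := exists_aug_comp_slant Θ (sub_add_cancel j 1) g.1 hg
    obtain ⟨c₂, hc₂⟩ := exists_aug_comp_slant Θ (sub_add_cancel b 1) gh.1 hgh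
    -- Associativity compares the iterated slant by h and g with the signed slant by g ⌣ h. After
    -- augmentation both are cohomologous to g ∘ `slant Θ h`, so they agree up to a coboundary after
    -- the cocycle f.
    obtain ⟨t, ht⟩ := ExactComplex.exists_coboundary_of_degree (C := P.toExactComplex)
      (D := P.toExactComplex) (fun n => P.homExact (P.finRetract n)) (sub_add_cancel b 1)
      (fun n m hm => slant Θ g.1 (m + j) m rfl ∘ₗ slant Θ h.1 n (m + j) (by omega))
      (fun n m hm => (j * l).negOnePow • slant Θ gh.1 n m hm)
      (fun n n' m m' hm hm' hn => by
        rw [← LinearMap.comp_assoc, slant_comm Θ hg _ (m' + j) _ m' _ rfl (by omega),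
          LinearMap.comp_assoc, slant_comm Θ hh _ n' _ _ _ (by omega) hn, LinearMap.comp_assoc])
      (fun n n' m m' hm hm' hn => by
        rw [negOnePow_smul_comp, slant_comm Θ hgh _ _ _ _ _ _ hn, LinearMap.smul_comp])
      P.ε P.ε_surjective P.ε_exact
      (c₁ ∘ₗ slant Θ h.1 (b - 1) (j - 1) (by omega) - (j * l).negOnePow • c₂) (by
        have key : ∀ z (hz : z = j) (hz' : 0 + j = z) (hb : z + l = b),
            P.ε ∘ₗ slant Θ g.1 z 0 hz' ∘ₗ slant Θ h.1 b z hb -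
              g.1 ∘ₗ slant Θ h.1 b j hjl =
              c₁ ∘ₗ slant Θ h.1 (b - 1) (j - 1) (by omega) ∘ₗ P.d b (b - 1) := by
          rintro _ rfl hz' hb
          rw [← slant_comm Θ hh b (b - 1) _ _ hjl _ (by omega), ← LinearMap.comp_assoc,
            ← LinearMap.comp_assoc, hc₁, LinearMap.sub_comp, LinearMap.comp_assoc]
        have h1 := key (0 + j) (zero_add j) rfl (by omega)
        have h2 : g.1 ∘ₗ slant Θ h.1 b j hjl = (j * l).negOnePow • gh.1 := by
          rw [e₃', smul_smul, Int.units_mul_self, one_smul]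
        have h3 : P.ε ∘ₗ slant Θ gh.1 b 0 (zero_add b) = gh.1 + c₂ ∘ₗ P.d b (b - 1) := by
          rw [hc₂, add_sub_cancel]
        rw [sub_eq_iff_eq_add] at h1
        rw [h1, negOnePow_smul_comp, h3, h2, LinearMap.sub_comp, LinearMap.smul_comp, smul_add,
          LinearMap.comp_assoc]
        abel)
      (n := n) (n' := n - 1) (m := i) (sub_add_cancel n 1) hib rfl f.1 hf
    refine TateExt.mk_eq_mk (sub_add_cancel n 1) ((a * l).negOnePow • (i * j).negOnePow • t) ?_
    -- Modulo 2, (i + j) l + i j + j l is i (j + l).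
    have hsign : (a * l).negOnePow * (i * j).negOnePow * (j * l).negOnePow =
        (i * b).negOnePow := by
      rw [← Int.negOnePow_add, ← Int.negOnePow_add, Int.negOnePow_eq_iff, ← hij, ← hjl]
      exact ⟨j * l, by ring⟩
    rw [LinearMap.smul_comp, LinearMap.smul_comp, ht, e₂', e₁', e₄', smul_sub, smul_sub,
      negOnePow_smul_comp, smul_smul, smul_smul, smul_smul, hsign, LinearMap.smul_comp,
      smul_smul]
    subst hij
    rfl

end Hochschild
end
end TateHopf

namespace TateHopf
noncomputable section

/-! ## Induction from a Hopf algebra to its enveloping algebra -/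

section Twist

open Coalgebra HopfAlgebra

variable {k A : Type*} [Field k] [Ring A] [HopfAlgebra k A]

/-- `∑ (1 ⊗ a₂ z) σ(a₁) = a ⊗ z`. -/
theorem sum_tmul_mul_sigma {ι : Type*} {a : A} (r : Repr k a ι) (z : A) :
    ∑ i ∈ r.index, (Env.tmul 1 (r.right i * z) : Env k A) * sigma k A (r.left i) =
      Env.tmul a z := by
  let U : A ⊗[k] A →ₗ[k] Env k A :=
    TensorProduct.lift ((Env.tmulBilin k A).compl₂ (LinearMap.mulRight k z))
  have h := congrArg U (lTensor_assoc_comul (LinearMap.mul' k A ∘ₗ (antipode k).rTensor A)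
    (fun x => HopfAlgebra.mul_antipode_rTensor_comul_apply x) a)
  rw [← r.eq] at h
  simp only [map_sum] at h
  refine Eq.trans (Finset.sum_congr rfl fun i _ => ?_) (h.trans ?_)
  · rw [sigma_eq_sum k A (Repr.arbitrary k (r.left i)), LinearMap.rTensor_tmul,
      ← (Repr.arbitrary k (r.left i)).eq, Finset.mul_sum, TensorProduct.sum_tmul]
    simp only [map_sum]
    refine Finset.sum_congr rfl fun x _ => ?_
    rw [Env.tmul_mul_tmul, one_mul, ← mul_assoc]
    rfl
  · change Env.tmul a (1 * z) = _
    rw [one_mul]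

variable (k A)

theorem commute_diagAction (M : Type*) [AddCommGroup M] [Module k M] [Module A M]
    [IsScalarTower k A M] (a : A) (b : Aᵐᵒᵖ) : Commute (diagAction k A M A a)
      ((Module.End.lTensorAlgHom k A M).comp (Algebra.lsmul k k A : Aᵐᵒᵖ →ₐ[k] Module.End k A)
        b) := by
  refine TensorProduct.ext' fun m x => ?_
  change diagAction k A M A a (m ⊗ₜ (x * b.unop)) =
    (LinearMap.mulRight k b.unop).lTensor M (diagAction k A M A a (m ⊗ₜ x))
  have h (y : A) := DiagTensor.smul_of_tmul (k := k) a m y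
  refine (h _).trans ((?_ : _ = _).trans
    (congrArg ((LinearMap.mulRight k b.unop).lTensor M) (h x)).symm)
  change TensorProduct.map (orbitMap k A m) (orbitMap k A (x * b.unop)) (comul a) =
    (LinearMap.mulRight k b.unop).lTensor M
      (TensorProduct.map (orbitMap k A m) (orbitMap k A x) (comul a))
  induction comul (R := k) a using TensorProduct.induction_on with
  | zero => simp
  | tmul u v => simp [mul_assoc]
  | add u v hu hv => simp only [map_add, hu, hv]

/-- The action of `A ⊗ Aᵒᵖ` on `M ⊗ A`: `(a ⊗ b) • (m ⊗ x) = ∑ a₁ m ⊗ a₂ x b`. -/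
def twistAction (M : Type*) [AddCommGroup M] [Module k M] [Module A M] [IsScalarTower k A M] :
    Env k A →ₐ[k] Module.End k (M ⊗[k] A) :=
  (Algebra.TensorProduct.lift (diagAction k A M A)
    ((Module.End.lTensorAlgHom k A M).comp (Algebra.lsmul k k A : Aᵐᵒᵖ →ₐ[k] Module.End k A))
    (commute_diagAction k A M)).comp (Env.of k A).symm.toAlgHom

theorem twistAction_tmul (M : Type*) [AddCommGroup M] [Module k M] [Module A M]
    [IsScalarTower k A M] (a b : A) : twistAction k A M (Env.tmul a b) =
      diagAction k A M A a * Module.End.lTensorAlgHom k A M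
        (Algebra.lsmul k k A (MulOpposite.op b)) :=
  Algebra.TensorProduct.lift_tmul _ _ (commute_diagAction k A M) a (MulOpposite.op b)

/-- The `A ⊗ Aᵒᵖ`-module `M ⊗ A` induced from the `A`-module `M` along `σ`. -/
def Twist (k A M : Type*) [Field k] [Ring A] [HopfAlgebra k A] [AddCommGroup M] [Module k M] :
    Type _ := M ⊗[k] A

namespace Twist

variable (M : Type*) [AddCommGroup M] [Module k M] [Module A M] [IsScalarTower k A M]

instance : AddCommGroup (Twist k A M) := inferInstanceAs (AddCommGroup (M ⊗[k] A))
instance : Module k (Twist k A M) := inferInstanceAs (Module k (M ⊗[k] A))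
instance : Module (Env k A) (Twist k A M) :=
  Module.compHom (M ⊗[k] A) (twistAction k A M).toRingHom
instance [Module.Finite k M] [Module.Finite k A] : Module.Finite k (Twist k A M) :=
  inferInstanceAs (Module.Finite k (M ⊗[k] A))

/-- The identity map onto the induced module. -/
def of : M ⊗[k] A ≃ₗ[k] Twist k A M := LinearEquiv.refl k _

variable {k A M}

theorem smul_of_tmul (a b : A) (m : M) (x : A) :
    (Env.tmul a b : Env k A) • of k A M (m ⊗ₜ x) =
      of k A M (TensorProduct.map (orbitMap k A m) (orbitMap k A (x * b)) (comul a)) :=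
  (congrArg (of k A M) (LinearMap.congr_fun (twistAction_tmul k A M a b) (m ⊗ₜ[k] x))).trans
    (DiagTensor.smul_of_tmul (k := k) a m (x * b))

instance : IsScalarTower k (Env k A) (Twist k A M) where
  smul_assoc c e x := LinearMap.congr_fun (map_smul (twistAction k A M) c e) x

theorem induction_on {p : Twist k A M → Prop} (x : Twist k A M) (zero : p 0)
    (tmul : ∀ m n, p (of k A M (m ⊗ₜ n))) (add : ∀ x y, p x → p y → p (x + y)) : p x :=
  TensorProduct.induction_on (motive := fun t => p (of k A M t)) x zero tmul fun _ _ => add _ _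

theorem hom_ext {Q : Type*} [AddCommGroup Q] [Module (Env k A) Q]
    {φ ψ : Twist k A M →ₗ[Env k A] Q}
    (h : ∀ m x, φ (of k A M (m ⊗ₜ x)) = ψ (of k A M (m ⊗ₜ x))) : φ = ψ := by
  refine LinearMap.ext fun x => induction_on (p := fun x => φ x = ψ x) x ?_ h fun x y hx hy => ?_
  · rw [map_zero, map_zero]
  · rw [map_add, map_add, hx, hy]

variable {N : Type*} [AddCommGroup N] [Module k N] [Module (Env k A) N]
  [IsScalarTower k (Env k A) N]

/-- The homomorphism on the induced module that corresponds to an `A`-linear map. -/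
def lift (f : M →ₗ[A] Res (sigma k A) N) : Twist k A M →ₗ[Env k A] N where
  toFun t := TensorProduct.lift (((Algebra.lsmul k k N).toLinearMap ∘ₗ Env.tmulBilin k A 1).flip ∘ₗ
    (Res.of (sigma k A) N).symm.toLinearMap ∘ₗ f.restrictScalars k) ((of k A M).symm t)
  map_add' x y := by rw [map_add, map_add]
  map_smul' e t := by
    rw [RingHom.id_apply]
    induction t using Twist.induction_on with
    | zero => rw [smul_zero, map_zero, map_zero, smul_zero]
    | tmul m x =>
      induction e using Env.induction_on with
      | zero => rw [zero_smul, map_zero, map_zero, zero_smul]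
      | tmul a b =>
        let r := Repr.arbitrary k a
        rw [smul_of_tmul, LinearEquiv.symm_apply_apply, LinearEquiv.symm_apply_apply, ← r.eq]
        simp only [map_sum, TensorProduct.map_tmul, TensorProduct.lift.tmul, orbitMap_apply]
        have h := congrArg (fun e => e • (Res.of (sigma k A) N).symm (f m))
          (sum_tmul_mul_sigma r (x * b))
        simp only [Finset.sum_smul] at h
        refine Eq.trans (Finset.sum_congr rfl fun i _ => ?_) (h.trans ?_)
        · have h1 : f (r.left i • m) = r.left i • f m := map_smul f _ _
          rw [mul_smul]
          exact congrArg (fun y => (Env.tmul 1 (r.right i * (x * b)) : Env k A) •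
            (Res.of (sigma k A) N).symm y) h1
        · have h2 : (Env.tmul a (x * b) : Env k A) = Env.tmul a b * Env.tmul 1 x := by
            rw [Env.tmul_mul_tmul, mul_one]
          rw [h2, mul_smul]
          rfl
      | add e e' he he' => rw [add_smul, map_add, map_add, he, he', add_smul]
    | add x y hx hy => rw [smul_add, map_add, map_add, hx, hy, map_add, map_add, smul_add]

theorem lift_of_tmul (f : M →ₗ[A] Res (sigma k A) N) (m : M) (x : A) :
    lift f (of k A M (m ⊗ₜ x)) =
      (Env.tmul 1 x : Env k A) • (Res.of (sigma k A) N).symm (f m) := rfl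

variable (k A M) in
/-- The map `m ↦ m ⊗ 1`. -/
def unit : M →ₗ[A] Res (sigma k A) (Twist k A M) where
  toFun m := Res.of _ _ (of k A M (m ⊗ₜ 1))
  map_add' m m' := by rw [TensorProduct.add_tmul, map_add, map_add]
  map_smul' a m := by
    let r := Repr.arbitrary k a
    rw [RingHom.id_apply, Res.smul_of, sigma_eq_sum k A r, Finset.sum_smul]
    congr 1
    have h := congrArg (TensorProduct.map (orbitMap k A m) (orbitMap k A (1 : A)))
      (sum_comul_mul_antipode r)
    simp only [map_sum, map_orbitMap_mul, one_smul] at h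
    simp only [smul_of_tmul, one_mul, smul_eq_mul, mul_one] at h ⊢
    rw [← map_sum, h, TensorProduct.map_tmul, orbitMap_apply, orbitMap_apply, one_smul]

theorem lift_unit (f : M →ₗ[A] Res (sigma k A) N) (m : M) :
    lift f ((Res.of _ _).symm (unit k A M m)) = (Res.of (sigma k A) N).symm (f m) :=
  one_smul (Env k A) ((Res.of (sigma k A) N).symm (f m))

/-- The functoriality of the induced module. -/
def map {M' : Type*} [AddCommGroup M'] [Module k M'] [Module A M'] [IsScalarTower k A M']
    (f : M →ₗ[A] M') : Twist k A M →ₗ[Env k A] Twist k A M' := lift (unit k A M' ∘ₗ f)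

theorem map_of_tmul {M' : Type*} [AddCommGroup M'] [Module k M'] [Module A M']
    [IsScalarTower k A M'] (f : M →ₗ[A] M') (m : M) (x : A) :
    map f (of k A M (m ⊗ₜ x)) = of k A M' (f m ⊗ₜ x) := by
  rw [map, lift_of_tmul]
  refine (smul_of_tmul 1 x (f m) 1).trans ?_
  rw [Bialgebra.comul_one, one_mul, Algebra.TensorProduct.one_def, TensorProduct.map_tmul,
    orbitMap_apply, orbitMap_apply, one_smul, one_smul]

theorem map_apply {M' : Type*} [AddCommGroup M'] [Module k M'] [Module A M']
    [IsScalarTower k A M'] (f : M →ₗ[A] M') (t : Twist k A M) :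
    map f t = of k A M' ((f.restrictScalars k).rTensor A ((of k A M).symm t)) := by
  induction t using Twist.induction_on with
  | zero => simp only [map_zero]
  | tmul m x => exact map_of_tmul f m x
  | add x y hx hy => simp only [map_add, hx, hy]

theorem lift_comp_map {M' : Type*} [AddCommGroup M'] [Module k M'] [Module A M']
    [IsScalarTower k A M'] (f : M →ₗ[A] M') (g : M' →ₗ[A] Res (sigma k A) N) :
    lift g ∘ₗ map f = lift (g ∘ₗ f) := by
  refine hom_ext fun m x => ?_
  rw [LinearMap.comp_apply, map_of_tmul, lift_of_tmul, lift_of_tmul]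
  rfl

theorem comp_lift {N' : Type*} [AddCommGroup N'] [Module k N'] [Module (Env k A) N']
    [IsScalarTower k (Env k A) N'] (f : M →ₗ[A] Res (sigma k A) N) (g : N →ₗ[Env k A] N') :
    g ∘ₗ lift f = lift (Res.map (sigma k A) g ∘ₗ f) := by
  refine hom_ext fun m x => ?_
  rw [LinearMap.comp_apply, lift_of_tmul, lift_of_tmul, map_smul]
  rfl

variable (k A) in
-- The induced module of A is free of rank one on 1 ⊗ 1, because c ⊗ x = ∑ (c₁ ⊗ S(c₂) x) • (1 ⊗ 1).
theorem finRetract_self [Module.Finite k A] : FinRetract (Env k A) (Env k A) (Twist k A A) := by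
  refine FinRetract.of_surjective (V := k) (LinearMap.toSpanSingleton k _ (of k A A (1 ⊗ₜ 1))) ?_ ?_
  · rw [Env.finrank, Module.finrank_self, mul_one]
    exact Module.finrank_tensorProduct
  intro t
  induction t using Twist.induction_on with
  | zero => exact ⟨0, map_zero _⟩
  | tmul c x =>
    let r := Repr.arbitrary k c
    refine ⟨∑ i ∈ r.index, Env.tmul (r.left i) (antipode k (r.right i) * x) ⊗ₜ 1, ?_⟩
    simp only [map_sum, extendScalars_tmul, LinearMap.toSpanSingleton_apply, one_smul]
    have h := congrArg (TensorProduct.map (orbitMap k A (1 : A)) (orbitMap k A x))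
      (sum_comul_mul_antipode r)
    simp only [map_sum, map_orbitMap_mul, one_smul] at h
    simp only [smul_of_tmul, one_mul, smul_eq_mul] at h ⊢
    rw [← map_sum, h, TensorProduct.map_tmul, orbitMap_apply, orbitMap_apply, one_smul,
      smul_eq_mul, mul_one]
  | add x y hx hy =>
    obtain ⟨x', rfl⟩ := hx
    obtain ⟨y', rfl⟩ := hy
    exact ⟨x' + y', map_add _ _ _⟩

theorem finRetract [Module.Finite k A] (h : FinRetract A A M) :
    FinRetract (Env k A) (Env k A) (Twist k A M) := by
  refine (finRetract_self k A).trans ?_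
  obtain ⟨s, _, i, r, h⟩ := h
  refine ⟨s, inferInstance, fun x => map (i x), fun x => map (r x), hom_ext fun m x => ?_⟩
  have h1 := congrArg (fun m => of k A M (m ⊗ₜ x)) (LinearMap.congr_fun h m)
  simp only [LinearMap.sum_apply, LinearMap.comp_apply, TensorProduct.sum_tmul, map_sum] at h1
  simp only [LinearMap.sum_apply, LinearMap.comp_apply, map_of_tmul]
  exact h1

variable (k A M) in
/-- The restriction of the induced module `M ⊗ A` to `A` is `M ⊗ A^ad`. -/
def ofDiag : DiagTensor k A M (AdjointModule k A) →ₗ[A] Res (sigma k A) (Twist k A M) :=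
  DiagTensor.lift (((TensorProduct.mk k M A).compl₂ (AdjointModule.of k A).symm.toLinearMap).compr₂
    ((Res.of (sigma k A) _).toLinearMap ∘ₗ (of k A M).toLinearMap)) (fun a m y => by
      obtain ⟨y, rfl⟩ := (AdjointModule.of k A).surjective y
      let r := Repr.arbitrary k a
      let g : A ⊗[k] A →ₗ[k] A :=
        LinearMap.mul' k A ∘ₗ TensorProduct.map LinearMap.id (LinearMap.mulLeft k y ∘ₗ antipode k)
      -- Both actions send m ⊗ y to ∑ a₁ m ⊗ a₂ y S(a₃); they differ only in the bracketing of the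
      -- iterated coproduct.
      have h := congrArg (TensorProduct.map (orbitMap k A m) g) (Coalgebra.coassoc_apply a)
      rw [← r.eq] at h
      simp only [map_sum, LinearMap.lTensor_tmul, LinearMap.rTensor_tmul] at h
      have hL (i) : (AdjointModule.of k A).symm (r.right i • AdjointModule.of k A y) =
          g (comul (r.right i)) := by
        rw [AdjointModule.smul_of_eq_sum k A (Repr.arbitrary k (r.right i)),
          LinearEquiv.symm_apply_apply, ← (Repr.arbitrary k (r.right i)).eq, map_sum]
        exact Finset.sum_congr rfl fun x _ => mul_assoc _ _ _
      have hR (i) : TensorProduct.map (orbitMap k A m) g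
          (TensorProduct.assoc k A A A (comul (r.left i) ⊗ₜ r.right i)) =
          TensorProduct.map (orbitMap k A m) (orbitMap k A (y * antipode k (r.right i)))
            (comul (r.left i)) := by
        induction comul (R := k) (r.left i) using TensorProduct.induction_on with
        | zero => rw [TensorProduct.zero_tmul, map_zero, map_zero, map_zero]
        | tmul p q => rfl
        | add p q hp hq => rw [TensorProduct.add_tmul, map_add, map_add, map_add, hp, hq]
      change ∑ i ∈ r.index, Res.of (sigma k A) _ (of k A M ((r.left i • m) ⊗ₜ
        (AdjointModule.of k A).symm (r.right i • AdjointModule.of k A y))) =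
          sigma k A a • of k A M (m ⊗ₜ y)
      rw [sigma_eq_sum k A r, Finset.sum_smul]
      simp only [smul_of_tmul, hL]
      simp only [hR] at h
      rw [← map_sum, ← map_sum, ← map_sum, h]
      rfl)

end Twist

/-- The adjoint module is the restriction of the regular bimodule along `σ`. -/
def adjointEquiv : AdjointModule k A ≃ₗ[A] Res (sigma k A) (RegularBimodule k A) where
  toFun x := Res.of _ _ (RegularBimodule.of k A ((AdjointModule.of k A).symm x))
  invFun x := AdjointModule.of k A ((RegularBimodule.of k A).symm ((Res.of _ _).symm x))
  map_add' _ _ := rfl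
  map_smul' _ _ := rfl
  left_inv _ := rfl
  right_inv _ := rfl

end Twist
end
end TateHopf

namespace TateHopf
noncomputable section

/-! ## Comparison of the two cohomology algebras -/

section Comparison

variable {k A : Type*} [Field k] [Ring A] [HopfAlgebra k A]

section Cup

variable {P : CompleteResolution.{w} k A (TrivialModule k A)} (Γ : DiagonalApprox P)

theorem tateMul_mk {i j n : ℤ} (h : i + j = n)
    (f : cocycles P (AdjointModule k A) i) (g : cocycles P (AdjointModule k A) j) :
    ∃ c : cocycles P (AdjointModule k A) n,
      tateMul Γ i j n h (Submodule.Quotient.mk f) (Submodule.Quotient.mk g) =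
        Submodule.Quotient.mk c ∧
      c.1 = (i * j).negOnePow • (adjointMul k A ∘ₗ DiagTensor.map f.1 g.1 ∘ₗ Γ.comp i j n h) :=
  ⟨_, rfl, negOnePow_smul_comp _ _ _⟩

/-- The left augmentation of Γ lifts the identity of k, hence does not change the class of a
cocycle. -/
theorem exists_aug_comp_diagonal [Module.Finite k A] {L : Type*} [AddCommGroup L] [Module A L] {j j' : ℤ}
    (hj : j' + 1 = j) (F : P.X j →ₗ[A] L) (hF : F ∘ₗ P.d (j + 1) j = 0) :
    ∃ b : P.X j' →ₗ[A] L,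
      b ∘ₗ P.d j j' = F ∘ₗ diagAugLeft P j ∘ₗ Γ.comp 0 j j (zero_add j) - F := by
  obtain ⟨b, hb⟩ := ExactComplex.exists_coboundary (C := P.toExactComplex) (D := P.toExactComplex)
    (fun n => P.homExact (P.finRetract n))
    (fun n => diagAugLeft P n ∘ₗ Γ.comp 0 n n (zero_add n)) (fun n => LinearMap.id)
    (fun a b hab => by
      rw [LinearMap.comp_assoc, Γ.comp_d 0 b 1 a a b rfl hab hab (zero_add b), LinearMap.comp_add,
        ← LinearMap.comp_assoc _ _ (diagAugLeft P b), diagAugLeft_comp_d, LinearMap.zero_comp,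
        zero_add, Int.negOnePow_zero, one_smul]
      exact LinearMap.ext fun x => (diagAugLeft_map _ _ _).symm)
    (fun a b hab => rfl) (j := 0) (j₁ := 1) (j' := -1) rfl rfl P.ε P.ε_surjective P.ε_exact 0 (by
      rw [LinearMap.zero_comp, sub_eq_zero]
      exact LinearMap.ext fun x => (trivialMul_map _).symm.trans (Γ.aug x))
    (n := j) rfl hj F hF
  exact ⟨b, hb⟩

end Cup

section Coefficients

variable {M N N' : Type*} [AddCommGroup M] [Module k M] [Module A M] [IsScalarTower k A M]
  [AddCommGroup N] [Module k N] [Module (Env k A) N] [IsScalarTower k (Env k A) N]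
  [AddCommGroup N'] [Module k N'] [Module (Env k A) N'] [IsScalarTower k (Env k A) N']

variable (k A N) in
/-- The right action of `A` on a bimodule `N` as a homomorphism `N ⊗ A^ad → N` of `A`-modules. -/
def adjointAct : DiagTensor k A (Res (sigma k A) N) (AdjointModule k A) →ₗ[A] Res (sigma k A) N :=
  Res.map (sigma k A) (Twist.lift LinearMap.id) ∘ₗ Twist.ofDiag k A (Res (sigma k A) N)

theorem adjointAct_of_tmul (x : N) (y : A) :
    adjointAct k A N (DiagTensor.of k A _ _ (Res.of _ N x ⊗ₜ AdjointModule.of k A y)) =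
      Res.of _ N ((Env.tmul 1 y : Env k A) • x) := rfl

theorem adjointAct_map {L : Type*} [AddCommGroup L] [Module k L] [Module A L]
    [IsScalarTower k A L] (f : N →ₗ[Env k A] N') (φ : M →ₗ[A] Res (sigma k A) N)
    (g : L →ₗ[A] AdjointModule k A) :
    Res.map (sigma k A) f ∘ₗ adjointAct k A N ∘ₗ DiagTensor.map φ g =
      adjointAct k A N' ∘ₗ DiagTensor.map (Res.map (sigma k A) f ∘ₗ φ) g := by
  refine DiagTensor.hom_ext fun m l => ?_
  obtain ⟨x, hx⟩ := (Res.of (sigma k A) N).surjective (φ m)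
  obtain ⟨y, hy⟩ := (AdjointModule.of k A).surjective (g l)
  simp only [LinearMap.comp_apply, DiagTensor.map_of_tmul]
  rw [← hx, ← hy, adjointAct_of_tmul, Res.map_of, Res.map_of, adjointAct_of_tmul, map_smul]

theorem adjointMul_map {L : Type*} [AddCommGroup L] [Module k L] [Module A L]
    [IsScalarTower k A L] (φ : M →ₗ[A] Res (sigma k A) (RegularBimodule k A))
    (g : L →ₗ[A] AdjointModule k A) :
    adjointMul k A ∘ₗ DiagTensor.map ((adjointEquiv k A).symm.toLinearMap ∘ₗ φ) g =
      (adjointEquiv k A).symm.toLinearMap ∘ₗ adjointAct k A (RegularBimodule k A) ∘ₗ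
        DiagTensor.map φ g := by
  refine DiagTensor.hom_ext fun m l => ?_
  obtain ⟨x, hx⟩ := (Res.of (sigma k A) (RegularBimodule k A)).surjective (φ m)
  obtain ⟨x, rfl⟩ := (RegularBimodule.of k A).surjective x
  obtain ⟨y, hy⟩ := (AdjointModule.of k A).surjective (g l)
  simp only [LinearMap.comp_apply, DiagTensor.map_of_tmul]
  rw [← hx, ← hy, adjointAct_of_tmul, RegularBimodule.tmul_smul_of, one_mul]
  rfl

variable (k A) in
/-- The unit `k → A` as a homomorphism into the restriction of the regular bimodule. -/
def regularUnit : TrivialModule k A →ₗ[A] Res (sigma k A) (RegularBimodule k A) :=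
  (adjointEquiv k A).toLinearMap ∘ₗ adjointUnit k A

theorem regularUnit_of (r : k) :
    regularUnit k A (TrivialModule.of k A r) =
      Res.of _ _ (RegularBimodule.of k A (algebraMap k A r)) := rfl

/-- Acting on the unit of A returns the acting element. This identifies the augmentation of the
slant on the Hopf side with g preceded by the left augmentation of Γ. -/
theorem adjointAct_map_unit (ε : M →ₗ[A] TrivialModule k A) {L : Type*} [AddCommGroup L]
    [Module k L] [Module A L] [IsScalarTower k A L] (g : L →ₗ[A] AdjointModule k A) :
    adjointAct k A (RegularBimodule k A) ∘ₗ DiagTensor.map (regularUnit k A ∘ₗ ε) g =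
      (adjointEquiv k A).toLinearMap ∘ₗ g ∘ₗ DiagTensor.lid k A L ∘ₗ
        DiagTensor.map ε LinearMap.id := by
  refine DiagTensor.hom_ext fun m l => ?_
  obtain ⟨r, hr⟩ := (TrivialModule.of k A).surjective (ε m)
  obtain ⟨y, hy⟩ := (AdjointModule.of k A).surjective (g l)
  simp only [LinearMap.comp_apply, DiagTensor.map_of_tmul, LinearMap.id_apply]
  rw [← hr, DiagTensor.lid_of_tmul, LinearEquiv.symm_apply_apply, LinearMap.map_smul_of_tower, ← hy,
    regularUnit_of, adjointAct_of_tmul, RegularBimodule.tmul_smul_of, one_mul,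
    ← Algebra.smul_def]
  rfl

end Coefficients

/-! ### The comparison map -/

variable {P : CompleteResolution.{w₁} k A (TrivialModule k A)}
  {X : CompleteResolution.{w₂} k (Env k A) (RegularBimodule k A)}

/-- The chain maps from a resolution of `k` to a resolution of `A` that lift the unit `k → A`. -/
structure ComparisonMap (P : CompleteResolution.{w₁} k A (TrivialModule k A))
    (X : CompleteResolution.{w₂} k (Env k A) (RegularBimodule k A)) where
  map : ∀ n, P.X n →ₗ[A] Res (sigma k A) (X.X n)
  comm : ∀ a b, b + 1 = a → Res.map (sigma k A) (X.d a b) ∘ₗ map a = map b ∘ₗ P.d a b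
  aug : Res.map (sigma k A) X.ε ∘ₗ map 0 = regularUnit k A ∘ₗ P.ε

/-- Freeness along σ makes restricted projectives projective over A, so they are admissible targets
for the comparison theorem. -/
theorem homExact_res [Module.Finite k A] (P : CompleteResolution.{w₁} k A (TrivialModule k A))
    {Q : Type*} [AddCommGroup Q] [Module k Q] [Module (Env k A) Q] [IsScalarTower k (Env k A) Q]
    (hQ : FinRetract (Env k A) (Env k A) Q) : HomExact P.toExactComplex (Res (sigma k A) Q) :=
  P.homExact (Res.finRetract _ (Env.finRetract_sigma k A) hQ)

theorem nonempty_comparisonMap [Module.Finite k A]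
    (P : CompleteResolution.{w₁} k A (TrivialModule k A))
    (X : CompleteResolution.{w₂} k (Env k A) (RegularBimodule k A)) :
    Nonempty (ComparisonMap P X) := by
  obtain ⟨φ, hφ₀, hφ⟩ := ExactComplex.exists_chainMap_of_augmented (C := P.toExactComplex)
    (D := X.res (sigma k A)) (fun n => homExact_res P (Q := X.X n) (X.finRetract n)) P.ε P.ε_comp_d
    (Res.map (sigma k A) X.ε : Res (sigma k A) (X.X 0) →ₗ[A] _) X.ε_surjective X.ε_exact (regularUnit k A)
  exact ⟨⟨φ, hφ, hφ₀⟩⟩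

namespace ComparisonMap

variable (u : ComparisonMap P X)

/-- The map on cochains induced by a comparison map. -/
def cochain (n : ℤ) : (X.X n →ₗ[Env k A] RegularBimodule k A) →ₗ[k]
    (P.X n →ₗ[A] AdjointModule k A) where
  toFun f := (adjointEquiv k A).symm.toLinearMap ∘ₗ Res.map (sigma k A) f ∘ₗ u.map n
  map_add' _ _ := rfl
  map_smul' _ _ := rfl

theorem cochain_comp_d {n n' : ℤ} (hn : n' + 1 = n) (f : X.X n' →ₗ[Env k A] RegularBimodule k A) :
    u.cochain n' f ∘ₗ P.d n n' = u.cochain n (f ∘ₗ X.d n n') := by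
  change (adjointEquiv k A).symm.toLinearMap ∘ₗ Res.map (sigma k A) f ∘ₗ
    (u.map n' ∘ₗ P.d n n') = _
  rw [← u.comm n n' hn]
  rfl

/-- The map on cocycles induced by a comparison map. -/
def cocycle (n : ℤ) : cocycles X (RegularBimodule k A) n →ₗ[k] cocycles P (AdjointModule k A) n :=
  (u.cochain n).restrict fun f hf => by
    rw [mem_cocycles] at hf ⊢
    rw [u.cochain_comp_d rfl, hf, map_zero]

/-- The map on cohomology induced by a comparison map. -/
def cohomology (n : ℤ) :
    TateExt X (RegularBimodule k A) n →ₗ[k] TateExt P (AdjointModule k A) n :=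
  Submodule.mapQ _ _ (u.cocycle n) (by
    intro f hf
    obtain ⟨g, hg⟩ := (mem_coboundaries X).1 hf
    refine (mem_coboundaries P).2 ⟨u.cochain (n - 1) g, ?_⟩
    rw [u.cochain_comp_d (sub_add_cancel n 1), hg]
    rfl)

theorem cohomology_one : u.cohomology 0 (hochschildOne X) = tateOne P := by
  refine congrArg Submodule.Quotient.mk (Subtype.ext ?_)
  change (adjointEquiv k A).symm.toLinearMap ∘ₗ Res.map (sigma k A) X.ε ∘ₗ u.map 0 = _
  rw [u.aug]
  rfl

variable [Module.Finite k A]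

/-- Two chain maps P → X of degree -j are compared: the slant by g after u, and u ⊗ G after Γ
followed by the right action of A on X, where G is the image of g. Both augment to g ∘ u up to a
coboundary; composed with f they represent, up to the common sign, the two sides. -/
theorem cohomology_mul (Γ : DiagonalApprox P) (Θ : BimodDiagonalApprox X) (i j n : ℤ)
    (h : i + j = n) (x : TateExt X (RegularBimodule k A) i)
    (y : TateExt X (RegularBimodule k A) j) :
    u.cohomology n (hochschildMul Θ i j n h x y) =
      tateMul Γ i j n h (u.cohomology i x) (u.cohomology j y) := by
  obtain ⟨f, rfl⟩ := Submodule.Quotient.mk_surjective _ x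
  obtain ⟨g, rfl⟩ := Submodule.Quotient.mk_surjective _ y
  have hf := (mem_cocycles X).1 f.2
  have hg := (mem_cocycles X).1 g.2
  obtain ⟨c, hc, hc'⟩ := hochschildMul_mk Θ h f g
  obtain ⟨e, he, he'⟩ := tateMul_mk Γ h (u.cocycle i f) (u.cocycle j g)
  rw [hc]
  refine Eq.trans ?_ he.symm
  let G : P.X j →ₗ[A] AdjointModule k A := u.cochain j g.1
  have hG : G ∘ₗ P.d (j + 1) j = 0 := (mem_cocycles P).1 (u.cocycle j g).2
  let σ := sigma k A
  obtain ⟨c₁, hc₁⟩ := exists_aug_comp_slant Θ (sub_add_cancel j 1) g.1 hg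
  obtain ⟨c₂, hc₂⟩ := exists_aug_comp_diagonal Γ (sub_add_cancel j 1)
    ((adjointEquiv k A).toLinearMap ∘ₗ G) (by rw [LinearMap.comp_assoc, hG, LinearMap.comp_zero])
  obtain ⟨b, hb⟩ := ExactComplex.exists_coboundary_of_degree (C := P.toExactComplex)
    (D := X.res σ) (fun n => homExact_res P (Q := X.X n) (X.finRetract n)) (sub_add_cancel j 1)
    (fun n m hm => (Res.map σ (slant Θ g.1 n m hm) : Res σ (X.X n) →ₗ[A] Res σ (X.X m)) ∘ₗ u.map n)
    (fun n m hm => adjointAct k A (X.X m) ∘ₗ DiagTensor.map (u.map m) G ∘ₗ Γ.comp m j n hm)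
    (fun n n' m m' hm hm' hn => by
      rw [LinearMap.comp_assoc, ← u.comm n n' hn]
      exact congrArg (fun F => Res.map σ F ∘ₗ u.map n) (slant_comm Θ hg n n' m m' hm hm' hn))
    (fun n n' m m' hm hm' hn => by
      simp only [LinearMap.comp_assoc]
      rw [Γ.comp_d m' j m (j + 1) n n' (by omega) rfl hn hm', LinearMap.comp_add,
        negOnePow_smul_comp, ← LinearMap.comp_assoc _ _ (DiagTensor.map (u.map m') G),
        ← LinearMap.comp_assoc _ _ (DiagTensor.map (u.map m') G), DiagTensor.map_comp_map,
        DiagTensor.map_comp_map, hG, LinearMap.comp_id, LinearMap.comp_id,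
        DiagTensor.map_zero_right, LinearMap.zero_comp, smul_zero, add_zero,
        ← u.comm m m' (by omega), ← LinearMap.comp_assoc (Γ.comp m j n hm) _ (adjointAct k A _),
        ← LinearMap.comp_assoc (Γ.comp m j n hm) _ (adjointAct k A _),
        ← LinearMap.comp_assoc (Γ.comp m j n hm)]
      exact congrArg (· ∘ₗ Γ.comp m j n hm) (adjointAct_map (X.d m m') (u.map m) G))
    (Res.map σ X.ε : Res σ (X.X 0) →ₗ[A] _) X.ε_surjective X.ε_exact (Res.map σ c₁ ∘ₗ u.map (j - 1) - c₂) (by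
      have h1 : Res.map σ X.ε ∘ₗ Res.map σ (slant Θ g.1 j 0 (zero_add j)) ∘ₗ u.map j =
          Res.map σ g.1 ∘ₗ u.map j + (Res.map σ c₁ ∘ₗ u.map (j - 1)) ∘ₗ P.d j (j - 1) := by
        rw [LinearMap.comp_assoc, ← u.comm j (j - 1) (sub_add_cancel j 1)]
        have h2 : X.ε ∘ₗ slant Θ g.1 j 0 (zero_add j) = g.1 + c₁ ∘ₗ X.d j (j - 1) := by
          rw [hc₁, add_sub_cancel]
        exact congrArg (fun F => Res.map σ F ∘ₗ u.map j) h2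
      have h3 : Res.map σ X.ε ∘ₗ adjointAct k A (X.X 0) ∘ₗ DiagTensor.map (u.map 0) G ∘ₗ
          Γ.comp 0 j j (zero_add j) = Res.map σ g.1 ∘ₗ u.map j + c₂ ∘ₗ P.d j (j - 1) := by
        have h4 := congrArg (· ∘ₗ Γ.comp 0 j j (zero_add j)) (adjointAct_map X.ε (u.map 0) G)
        refine h4.trans ?_
        rw [u.aug, adjointAct_map_unit, hc₂]
        exact (add_sub_cancel (Res.map σ g.1 ∘ₗ u.map j) _).symm
      rw [h1, h3, LinearMap.sub_comp]
      abel)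
    (n := n) (n' := n - 1) (m := i) (sub_add_cancel n 1) h rfl
    ((adjointEquiv k A).symm.toLinearMap ∘ₗ (Res.map σ f.1 : Res σ (X.X i) →ₗ[A] _))
    (congrArg (fun F => (adjointEquiv k A).symm.toLinearMap ∘ₗ Res.map σ F) hf)
  refine TateExt.mk_eq_mk (sub_add_cancel n 1) ((i * j).negOnePow • b) ?_
  rw [LinearMap.smul_comp, hb, smul_sub, he']
  congr 1
  · change _ = u.cochain n c.1
    rw [hc', Units.smul_def, Units.smul_def, map_zsmul]
    rfl
  · congr 1
    have h5 := congrArg (· ∘ₗ Γ.comp i j n h) (adjointMul_map (Res.map σ f.1 ∘ₗ u.map i) G)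
    refine Eq.trans ?_ h5.symm
    rw [← adjointAct_map]
    rfl

/-! ### Bijectivity -/

/-- The complex of bimodules induced from a resolution of `k`. -/
@[reducible] def _root_.TateHopf.CompleteResolution.twist
    (P : CompleteResolution.{w₁} k A (TrivialModule k A)) : ExactComplex (Env k A) where
  X n := Twist k A (P.X n)
  d i j := Twist.map (P.d i j)
  exact a b c hab hbc := by
    have h : Function.Exact ((P.d a b).restrictScalars k) ((P.d b c).restrictScalars k) :=
      P.toExactComplex.exact a b c hab hbc
    intro t
    have e : (Twist.map (P.d a b) : Twist k A (P.X a) → Twist k A (P.X b)) = fun t =>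
        Twist.of k A _ (((P.d a b).restrictScalars k).rTensor A ((Twist.of k A _).symm t)) :=
      funext (Twist.map_apply _)
    rw [Twist.map_apply, e]
    exact Module.Flat.rTensor_exact A h t

/-- Over the field, the induced complex is P ⊗ A and its augmentation is that of P tensored with A,
followed by k ⊗ A ≅ A. Flatness gives exactness. -/
theorem twist_aug_exact (P : CompleteResolution.{w₁} k A (TrivialModule k A)) :
    Function.Exact (P.twist.d 1 0) (Twist.lift (regularUnit k A ∘ₗ P.ε)) := by
  have h : Function.Exact ((P.d 1 0).restrictScalars k) (P.ε.restrictScalars k) := P.ε_exact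
  let e : TrivialModule k A ⊗[k] A ≃ₗ[k] A :=
    (TensorProduct.congr (TrivialModule.of k A).symm (LinearEquiv.refl k A)).trans
      (TensorProduct.lid k A)
  have hl (t : TrivialModule k A ⊗[k] A) : Twist.lift (regularUnit k A) (Twist.of k A _ t) =
      RegularBimodule.of k A (e t) := by
    induction t using TensorProduct.induction_on with
    | zero => simp only [map_zero]
    | tmul r x =>
      obtain ⟨r, rfl⟩ := (TrivialModule.of k A).surjective r
      rw [Twist.lift_of_tmul, regularUnit_of, LinearEquiv.symm_apply_apply,
        RegularBimodule.tmul_smul_of, one_mul, ← Algebra.smul_def]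
      rfl
    | add x y hx hy => simp only [map_add, hx, hy]
  have hd : (Twist.map (P.d 1 0) : Twist k A (P.X 1) → Twist k A (P.X 0)) = fun t =>
      Twist.of k A _ (((P.d 1 0).restrictScalars k).rTensor A ((Twist.of k A _).symm t)) :=
    funext (Twist.map_apply _)
  intro t
  rw [← Twist.lift_comp_map, LinearMap.comp_apply, Twist.map_apply, hl,
    LinearEquiv.map_eq_zero_iff, LinearEquiv.map_eq_zero_iff, hd]
  exact Module.Flat.rTensor_exact A h t

theorem twist_aug_surjective (P : CompleteResolution.{w₁} k A (TrivialModule k A)) :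
    Function.Surjective (Twist.lift (regularUnit k A ∘ₗ P.ε)) := by
  intro x
  obtain ⟨x, rfl⟩ := (RegularBimodule.of k A).surjective x
  obtain ⟨p, hp⟩ := P.ε_surjective (TrivialModule.of k A 1)
  refine ⟨Twist.of k A _ (p ⊗ₜ x), ?_⟩
  rw [Twist.lift_of_tmul, LinearMap.comp_apply, hp, regularUnit_of, LinearEquiv.symm_apply_apply,
    RegularBimodule.tmul_smul_of, one_mul, map_one, one_mul]

/-- A chain map v from X to the complex induced from P inverts u up to homotopy. The map adjoint to
u composed with v lifts the identity of A, which gives injectivity; v ∘ u and the unit p ↦ p ⊗ 1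
have the same augmentation, which gives surjectivity. -/
theorem cohomology_bijective (n : ℤ) : Function.Bijective (u.cohomology n) := by
  let E := adjointEquiv k A
  have hY (n : ℤ) : FinRetract (Env k A) (Env k A) (P.twist.X n) := Twist.finRetract (P.finRetract n)
  obtain ⟨v, hv₀, hv⟩ := ExactComplex.exists_chainMap_of_augmented (C := X.toExactComplex)
    (D := P.twist) (fun n => X.homExact (hY n)) X.ε X.ε_comp_d
    (Twist.lift (regularUnit k A ∘ₗ P.ε)) (twist_aug_surjective P) (twist_aug_exact P)
    LinearMap.id
  rw [LinearMap.id_comp] at hv₀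
  have hn := sub_add_cancel n 1
  constructor
  · rw [injective_iff_map_eq_zero]
    intro x hx
    obtain ⟨f, rfl⟩ := Submodule.Quotient.mk_surjective _ x
    have hf := (mem_cocycles X).1 f.2
    obtain ⟨b, hb⟩ := (mem_coboundaries P).1 ((Submodule.Quotient.mk_eq_zero _).1 hx)
    obtain ⟨b', hb'⟩ := ExactComplex.exists_coboundary (C := X.toExactComplex)
      (D := X.toExactComplex) (fun n => X.homExact (X.finRetract n))
      (fun n => Twist.lift (u.map n) ∘ₗ v n) (fun n => LinearMap.id)
      (fun a b hab => by
        rw [← LinearMap.comp_assoc, Twist.comp_lift, u.comm a b hab, ← Twist.lift_comp_map,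
          LinearMap.comp_assoc, LinearMap.comp_assoc, ← hv a b hab])
      (fun a b hab => rfl) (j := 0) (j₁ := 1) (j' := -1) rfl rfl X.ε X.ε_surjective X.ε_exact 0
      (by
        rw [LinearMap.zero_comp, sub_eq_zero, ← LinearMap.comp_assoc, Twist.comp_lift, u.aug, hv₀]
        rfl)
      (n := n) rfl hn f.1 hf
    refine (Submodule.Quotient.mk_eq_zero _).2 ((mem_coboundaries X).2
      ⟨Twist.lift (E.toLinearMap ∘ₗ b) ∘ₗ v (n - 1) - b', ?_⟩)
    have h1 : Res.map (sigma k A) f.1 ∘ₗ u.map n = E.toLinearMap ∘ₗ b ∘ₗ P.d n (n - 1) := by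
      rw [hb]
      rfl
    have h2 : f.1 ∘ₗ Twist.lift (u.map n) ∘ₗ v n =
        Twist.lift (E.toLinearMap ∘ₗ b) ∘ₗ v (n - 1) ∘ₗ X.d n (n - 1) := by
      rw [← hv n (n - 1) hn, ← LinearMap.comp_assoc, Twist.comp_lift, h1,
        ← LinearMap.comp_assoc (v n), Twist.lift_comp_map]
      rfl
    rw [LinearMap.sub_comp, hb', LinearMap.comp_assoc, ← h2]
    exact sub_sub_cancel _ _
  · intro y
    obtain ⟨g, rfl⟩ := Submodule.Quotient.mk_surjective _ y
    have hg := (mem_cocycles P).1 g.2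
    -- The preimage of g is its adjoint extension F to the induced complex, pulled back along v.
    -- Restricting F along the unit returns g.
    let F := Twist.lift (E.toLinearMap ∘ₗ g.1)
    have hF : F ∘ₗ P.twist.d (n + 1) n = 0 := by
      refine (Twist.lift_comp_map _ _).trans (Twist.hom_ext fun m x => ?_)
      rw [LinearMap.comp_assoc, hg, Twist.lift_of_tmul, LinearMap.comp_zero, LinearMap.zero_apply,
        map_zero, smul_zero, LinearMap.zero_apply]
    refine ⟨Submodule.Quotient.mk ⟨F ∘ₗ v n, ?_⟩, ?_⟩
    · rw [mem_cocycles]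
      refine (congrArg (F ∘ₗ ·) (hv (n + 1) n rfl).symm).trans ?_
      rw [← LinearMap.comp_assoc, hF, LinearMap.zero_comp]
    · obtain ⟨b, hb⟩ := ExactComplex.exists_coboundary (C := P.toExactComplex)
        (D := { X := fun n => Res (sigma k A) (Twist k A (P.X n))
                d := fun i j => Res.map (sigma k A) (Twist.map (P.d i j))
                exact := P.twist.exact })
        (fun n => homExact_res P (Q := Twist k A (P.X n)) (hY n))
        (fun n => (Res.map (sigma k A) (v n) : Res (sigma k A) (X.X n) →ₗ[A]
          Res (sigma k A) (Twist k A (P.X n))) ∘ₗ u.map n) (fun n => Twist.unit k A (P.X n))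
        (fun a b hab => by
          rw [LinearMap.comp_assoc, ← u.comm a b hab]
          exact congrArg (fun F => Res.map (sigma k A) F ∘ₗ u.map a) (hv a b hab))
        (fun a b hab => LinearMap.ext fun x => Twist.map_of_tmul (P.d a b) x 1)
        (j := 0) (j₁ := 1) (j' := -1) rfl rfl
        (Res.map (sigma k A) (Twist.lift (regularUnit k A ∘ₗ P.ε)) :
          Res (sigma k A) (Twist k A (P.X 0)) →ₗ[A] _) (twist_aug_surjective P)
        (twist_aug_exact P) 0
        (by
          rw [LinearMap.zero_comp, sub_eq_zero]
          refine (congrArg (fun F => Res.map (sigma k A) F ∘ₗ u.map 0) hv₀).trans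
            (u.aug.trans (LinearMap.ext fun p => (Twist.lift_unit (regularUnit k A ∘ₗ P.ε) p).symm)))
        (n := n) rfl hn (E.symm.toLinearMap ∘ₗ
          (Res.map (sigma k A) F : Res (sigma k A) (Twist k A (P.X n)) →ₗ[A] _))
        (congrArg (fun F => E.symm.toLinearMap ∘ₗ Res.map (sigma k A) F) hF)
      refine TateExt.mk_eq_mk hn b (hb.trans ?_)
      congr 1
      exact LinearMap.ext fun p => congrArg E.symm (Twist.lift_unit (E.toLinearMap ∘ₗ g.1) p)

end ComparisonMap

end Comparison

/-- With this transport, associativity on the adjoint side follows for every Γ from multiplicativity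
of the comparison, without examining Γ itself. -/
theorem IsGradedAlgebra.of_equiv {k : Type*} [Field k] {H H' : ℤ → Type*}
    [∀ n, AddCommGroup (H n)] [∀ n, Module k (H n)] [∀ n, AddCommGroup (H' n)]
    [∀ n, Module k (H' n)] {mul : ∀ i j n : ℤ, i + j = n → H i →ₗ[k] H j →ₗ[k] H n}
    {mul' : ∀ i j n : ℤ, i + j = n → H' i →ₗ[k] H' j →ₗ[k] H' n} {one : H 0} {one' : H' 0}
    (h : IsGradedAlgebra k H mul one) (Φ : ∀ n, H n ≃ₗ[k] H' n) (hone : Φ 0 one = one')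
    (hmul : ∀ i j n h x y, Φ n (mul i j n h x y) = mul' i j n h (Φ i x) (Φ j y)) :
    IsGradedAlgebra k H' mul' one' where
  one_mul n x := by
    obtain ⟨x, rfl⟩ := (Φ n).surjective x
    rw [← hone, ← hmul, h.one_mul]
  mul_one n x := by
    obtain ⟨x, rfl⟩ := (Φ n).surjective x
    rw [← hone, ← hmul, h.mul_one]
  mul_assoc i j l a b n hij hal hjl hib x y z := by
    obtain ⟨x, rfl⟩ := (Φ i).surjective x
    obtain ⟨y, rfl⟩ := (Φ j).surjective y
    obtain ⟨z, rfl⟩ := (Φ l).surjective z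
    rw [← hmul, ← hmul, ← hmul, ← hmul, h.mul_assoc i j l a b n hij hal hjl hib]

end
end TateHopf

theorem theorem7p2 (k : Type u) (A : Type v) [Field k] [Ring A] [HopfAlgebra k A]
    [Module.Finite k A] :
    Nonempty (TateHopf.CompleteResolution.{v} k A (TateHopf.TrivialModule k A)) ∧
    Nonempty (TateHopf.CompleteResolution.{v} k (TateHopf.Env k A)
      (TateHopf.RegularBimodule k A)) ∧
    ∀ (P : TateHopf.CompleteResolution.{w₁} k A (TateHopf.TrivialModule k A))
      (X : TateHopf.CompleteResolution.{w₂} k (TateHopf.Env k A)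
        (TateHopf.RegularBimodule k A)),
      Nonempty (TateHopf.DiagonalApprox P) ∧ Nonempty (TateHopf.BimodDiagonalApprox X) ∧
      ∀ (Γ : TateHopf.DiagonalApprox P) (Θ : TateHopf.BimodDiagonalApprox X),
        TateHopf.IsGradedAlgebra k (TateHopf.TateExt X (TateHopf.RegularBimodule k A))
          (TateHopf.hochschildMul Θ) (TateHopf.hochschildOne X) ∧
        TateHopf.IsGradedAlgebra k (TateHopf.TateExt P (TateHopf.AdjointModule k A))
          (TateHopf.tateMul Γ) (TateHopf.tateOne P) ∧
        ∃ Φ : ∀ n : ℤ, TateHopf.TateExt X (TateHopf.RegularBimodule k A) n ≃ₗ[k]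
            TateHopf.TateExt P (TateHopf.AdjointModule k A) n,
          Φ 0 (TateHopf.hochschildOne X) = TateHopf.tateOne P ∧
          ∀ (i j n : ℤ) (h : i + j = n)
            (x : TateHopf.TateExt X (TateHopf.RegularBimodule k A) i)
            (y : TateHopf.TateExt X (TateHopf.RegularBimodule k A) j),
            Φ n (TateHopf.hochschildMul Θ i j n h x y) =
              TateHopf.tateMul Γ i j n h (Φ i x) (Φ j y) := by
  refine ⟨TateHopf.nonempty_completeResolution_trivial k A,
    TateHopf.nonempty_completeResolution_regular k A, fun P X =>
      ⟨TateHopf.nonempty_diagonalApprox P, TateHopf.nonempty_bimodDiagonalApprox X, fun Γ Θ => ?_⟩⟩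
  obtain ⟨u⟩ := TateHopf.nonempty_comparisonMap P X
  let Φ (n : ℤ) := LinearEquiv.ofBijective (u.cohomology n) (u.cohomology_bijective n)
  have hΘ := TateHopf.isGradedAlgebra_hochschild Θ
  exact ⟨hΘ, hΘ.of_equiv Φ u.cohomology_one (u.cohomology_mul Γ Θ), Φ, u.cohomology_one,
    u.cohomology_mul Γ Θ⟩
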